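/- Let $T$ be a tree with $n$ vertices, let $c:V(T)\to\mathbb{N}$ be query costs and $w:V(T)\to\mathbb{N}$ be weights (arbitrary nonnegative integers). A hidden target $x\in V(T)$ is to be found by querying vertices: a query to $v$ reveals whether $v=x$ and, if not, which connected component of $T-v$ contains $x$. A decision tree $D$ for a connected candidate set $H\subseteq V(T)$ has a root labelled by a vertex $r\in H$ and, for each connected component $K$ of $T[H]-r$, exactly one subtree hung below the root, which is a decision tree for $K$; a decision tree for $T$ is one for $H=V(T)$. Let $Q(D,x)$ be the sequence of vertices on the path in $D$ from the root to $x$. The weighted average-case cost of $D$ is $$c_T(D)=\sum_{x\in V(T)} w(x)\sum_{q\in Q(D,x)}c(q),$$ and $\mathrm{OPT}(T,c,w)$ is the minimum of $c_T(D)$ over all decision trees $D$ for $T$. Theorem. There is an algorithm which, for every real $\varepsilon>0$ and every such instance $(T,c,w)$, outputs a decision tree $D$ for $T$ (as an array of parents) with $$c_T(D)\le(4+\varepsilon)\cdot\mathrm{OPT}(T,c,w)$$ in $O\bigl(n^4(1+1/\varepsilon^2)\bigr)$ steps, with an absolute implied constant; in particular, it runs in time $O(n^4/\varepsilon^2)$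 for $\varepsilon\le 1$. Here the input consists of $n$, the costs, the weights and the adjacency matrix of $T$, and $\varepsilon$ is given to the algorithm by positive integers $p,q$ with $p/q\le\varepsilon\le 2p/q$ (any such pair; for rational $\varepsilon$ one may take $p/q=\varepsilon$). The algorithm is one fixed program for a word RAM with unit-cost operations $+,-,\times,\lfloor\cdot/\cdot\rfloor$, memory access and tests, and all numbers it computes are at most $(n+c(V(T))+w(V(T))+p+q+2)^{\kappa}$ for an absolute constant $\kappa$, so that machine words of $O(\log(n+c(V(T))+w(V(T))+p+q+2))$ bits suffice. -/

import Mathlib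

namespace TreeSearch

/-! ### Searching in graphs -/

section Search

variable {V : Type*}

/-- The vertex set of the connected component of `x` in the subgraph of `G` induced by `S`
(empty if `x ∉ S`). -/
def component (G : SimpleGraph V) (S : Set V) (x : V) : Set V :=
  {y | ∃ (hx : x ∈ S) (hy : y ∈ S), (G.induce S).Reachable ⟨x, hx⟩ ⟨y, hy⟩}

/-- `K` is (the vertex set of) a connected component of the subgraph of `G` induced by `S`. -/
def IsComponent (G : SimpleGraph V) (S K : Set V) : Prop :=
  ∃ x ∈ S, K = component G S x

/-- Decision trees for the candidate set `H` in `G`. The root is a query to a vertex `r ∈ H`. If `r`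
is not the target, the response is a component `K` of `G[H] - r`, and the tree has exactly one
subtree for each such response, which is a decision tree for the candidate set `K`. A decision tree
for `G` is a decision tree for the candidate set of all vertices; each vertex of `G` is queried at
exactly one of its nodes. -/
inductive DecisionTree (G : SimpleGraph V) : Set V → Type _
  | node (H : Set V) (r : V) (hr : r ∈ H)
      (sub : ∀ K : Set V, IsComponent G (H \ {r}) K → DecisionTree G K) : DecisionTree G H

namespace DecisionTree

variable {G : SimpleGraph V}

/-- The vertex that is queried first. -/
def root : {H : Set V} → DecisionTree G H → V
  | _, node _ r _ _ => r

open Classical in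
/-- The sequence of queries made when the target is `x`, from the root down to the query to `x`. -/
noncomputable def queries : {H : Set V} → DecisionTree G H → V → List V
  | _, node H r _ sub, x =>
    if h : x ∈ H \ {r} then
      r :: (sub (component G (H \ {r}) x) ⟨x, h, rfl⟩).queries x
    else [r]

/-- `D.Edge u v`: the node `v` of `D` is a child of the node `u`. -/
def Edge : {H : Set V} → DecisionTree G H → V → V → Prop
  | _, node H r _ sub, u, v =>
    (u = r ∧ ∃ (K : Set V) (hK : IsComponent G (H \ {r}) K), v = (sub K hK).root) ∨
      ∃ (K : Set V) (hK : IsComponent G (H \ {r}) K), (sub K hK).Edge u v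

/-- The weighted average-case cost of a decision tree. -/
noncomputable def cost [Fintype V] {H : Set V} (D : DecisionTree G H) (c w : V → ℕ) : ℕ :=
  ∑ x : V, w x * ((D.queries x).map c).sum

end DecisionTree

/-- The minimum weighted average-case cost of a decision tree for `G`. -/
noncomputable def opt [Fintype V] (G : SimpleGraph V) (c w : V → ℕ) : ℕ :=
  sInf (Set.range fun D : DecisionTree G Set.univ => D.cost c w)

end Search

/-! ### The machine model: structured word-RAM programs

A program uses finitely many scalar registers and finitely many random-access arrays, all holding
natural numbers. Each arithmetic operation, register access, array access, assignment and test takes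
one step. A run is relative to a bound `B` on the numbers that may ever be computed, so that
machine words of `log₂ (B + 1)` bits are enough. -/

/-- The contents of the registers and of the arrays. -/
structure State where
  reg : ℕ → ℕ
  arr : ℕ → ℕ → ℕ

/-- Arithmetic expressions: constants, registers, array entries, and the four operations (with
truncated subtraction and division rounding down). -/
inductive Expr
  | lit (k : ℕ)
  | reg (x : ℕ)
  | get (a : ℕ) (i : Expr)
  | add (e f : Expr)
  | sub (e f : Expr)
  | mul (e f : Expr)
  | div (e f : Expr)

namespace Expr

/-- The value of an expression. -/
def eval (s : State) : Expr → ℕ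
  | lit k => k
  | reg x => s.reg x
  | get a i => s.arr a (i.eval s)
  | add e f => e.eval s + f.eval s
  | sub e f => e.eval s - f.eval s
  | mul e f => e.eval s * f.eval s
  | div e f => e.eval s / f.eval s

/-- The number of steps needed to evaluate an expression. -/
def steps : Expr → ℕ
  | lit _ => 1
  | reg _ => 1
  | get _ i => i.steps + 1
  | add e f => e.steps + f.steps + 1
  | sub e f => e.steps + f.steps + 1
  | mul e f => e.steps + f.steps + 1
  | div e f => e.steps + f.steps + 1

/-- The value of the expression and all values met while it is evaluated are at most `B`. -/
def Fits (B : ℕ) (s : State) : Expr → Prop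
  | lit k => k ≤ B
  | reg x => s.reg x ≤ B
  | get a i => i.Fits B s ∧ s.arr a (i.eval s) ≤ B
  | add e f => e.Fits B s ∧ f.Fits B s ∧ e.eval s + f.eval s ≤ B
  | sub e f => e.Fits B s ∧ f.Fits B s
  | mul e f => e.Fits B s ∧ f.Fits B s ∧ e.eval s * f.eval s ≤ B
  | div e f => e.Fits B s ∧ f.Fits B s

end Expr

/-- Programs. A test `e` counts as true if the value of `e` is not zero. -/
inductive Program
  | skip
  | assign (x : ℕ) (e : Expr)
  | store (a : ℕ) (i e : Expr)
  | seq (P Q : Program)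
  | cond (e : Expr) (P Q : Program)
  | loop (e : Expr) (P : Program)

/-- The state after writing `v` into register `x`. -/
def State.setReg (s : State) (x v : ℕ) : State :=
  { s with reg := Function.update s.reg x v }

/-- The state after writing `v` into entry `i` of array `a`. -/
def State.setArr (s : State) (a i v : ℕ) : State :=
  { s with arr := Function.update s.arr a (Function.update (s.arr a) i v) }

/-- `Runs B P s t s'`: started in the state `s`, the program `P` halts after exactly `t` steps in the
state `s'`, and no number larger than `B` is computed on the way. -/
inductive Runs (B : ℕ) : Program → State → ℕ → State → Prop
  | skip (s : State) : Runs B .skip s 1 s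
  | assign (s : State) (x : ℕ) (e : Expr) (he : e.Fits B s) :
      Runs B (.assign x e) s (e.steps + 1) (s.setReg x (e.eval s))
  | store (s : State) (a : ℕ) (i e : Expr) (hi : i.Fits B s) (he : e.Fits B s) :
      Runs B (.store a i e) s (i.steps + e.steps + 1) (s.setArr a (i.eval s) (e.eval s))
  | seq {P Q : Program} {s₁ s₂ s₃ : State} {t₁ t₂ : ℕ}
      (h₁ : Runs B P s₁ t₁ s₂) (h₂ : Runs B Q s₂ t₂ s₃) :
      Runs B (.seq P Q) s₁ (t₁ + t₂) s₃
  | condTrue {e : Expr} {P Q : Program} {s s' : State} {t : ℕ}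
      (hf : e.Fits B s) (he : e.eval s ≠ 0) (h : Runs B P s t s') :
      Runs B (.cond e P Q) s (e.steps + 1 + t) s'
  | condFalse {e : Expr} {P Q : Program} {s s' : State} {t : ℕ}
      (hf : e.Fits B s) (he : e.eval s = 0) (h : Runs B Q s t s') :
      Runs B (.cond e P Q) s (e.steps + 1 + t) s'
  | loopTrue {e : Expr} {P : Program} {s₁ s₂ s₃ : State} {t₁ t₂ : ℕ}
      (hf : e.Fits B s₁) (he : e.eval s₁ ≠ 0)
      (h₁ : Runs B P s₁ t₁ s₂) (h₂ : Runs B (.loop e P) s₂ t₂ s₃) :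
      Runs B (.loop e P) s₁ (e.steps + 1 + t₁ + t₂) s₃
  | loopFalse {e : Expr} {P : Program} {s : State}
      (hf : e.Fits B s) (he : e.eval s = 0) :
      Runs B (.loop e P) s (e.steps + 1) s

/-! ### Input and output -/

/-- Array with the entries `f 0, …, f (n - 1)`, followed by zeros. -/
def toArray {n : ℕ} (f : Fin n → ℕ) (i : ℕ) : ℕ :=
  if h : i < n then f ⟨i, h⟩ else 0

open Classical in
/-- Row-by-row `n × n` adjacency matrix: the entry `n * u + v` is `1` if `u` and `v` are adjacent;
all other entries are `0`. -/
noncomputable def adjArray {n : ℕ} (G : SimpleGraph (Fin n)) (i : ℕ) : ℕ :=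
  if ∃ u v : Fin n, G.Adj u v ∧ i = n * u + v then 1 else 0

/-- The initial state for the graph `G` on `0, …, n - 1` with query costs `c` and weights `w`, and
accuracy parameter `p / q`: registers `0, 1, 2` hold `n, p, q`, arrays `0, 1, 2` hold the costs,
the weights and the adjacency matrix, and everything else is `0`. -/
noncomputable def input {n : ℕ} (G : SimpleGraph (Fin n)) (c w : Fin n → ℕ) (p q : ℕ) : State where
  reg x := match x with
    | 0 => n
    | 1 => p
    | 2 => q
    | _ => 0
  arr a := match a with
    | 0 => toArray c
    | 1 => toArray w
    | 2 => adjArray G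
    | _ => fun _ => 0

/-- In the final state `s`, array `3` is the parent array of the decision tree `D`: the entry of the
root is `0` and the entry of each child of `u` is `u + 1`. -/
def Outputs {n : ℕ} {G : SimpleGraph (Fin n)} (s : State) (D : DecisionTree G Set.univ) : Prop :=
  s.arr 3 D.root = 0 ∧ ∀ u v : Fin n, D.Edge u v → s.arr 3 v = u + 1

/-- Bound on the numbers that may be computed: polynomial in `n` and in the numbers of the input, so
that words have `O(log (n + c(T) + w(T) + p + q))` bits. -/
def wordBound {n : ℕ} (κ : ℕ) (c w : Fin n → ℕ) (p q : ℕ) : ℕ :=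
  (n + ∑ v, c v + ∑ v, w v + p + q + 2) ^ κ

end TreeSearch

/-! The algorithm repeatedly takes a component `H` of the vertices not queried yet, finds a set `S`
of nearly minimum cost such that every connected part of `H` avoiding `S` has at most half of the
weight of `H`, and queries all of `S`. Each target in `H` then pays at most the cost of `S`, so this
round costs at most w(H)·c(S).

Lower bound. Fix any decision tree `D`, and let `P` consist of the vertices `v` of `H` that `D`
queries for targets carrying more than half of w(H). A connected set always contains a vertex that
`D` queries for all its members (`DecisionTree.exists_common_query`), so `P` is itself a separator
(`DecisionTree.isSeparator_heavy`) and c(S) is at most about c(P). The round is charged to `P`, w(H)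
to each unit of cost. A vertex `v` is charged w(H) < 2·w(candidates v) at first, and after every
round the component containing `v` has lost half of its weight. The geometric series stays below
4·w(candidates v) (`Charged.step`), and the sum of c(v)·w(candidates v) is at most the cost of `D`.
An approximation factor 1 + p/(4q) for the separators thus yields 4 + p/q ≤ 4 + ε.

Separators. Once `H` is rooted at a centroid, only the part containing the root can be too heavy. In
depth-first order the descendants of a vertex form a block, so removing it means jumping to the end
of the block, and a knapsack table finds the lightest root part for each budget of rounded costs
(`IsTable`, `IsTrace`). Rounding needs a scale within a factor 2 of the optimum `x`. The least cap
`B` on single costs that still admits a separator satisfies B ≤ x, and `n * B` always suffices, so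
the multiples of `B` are tried in turn (`findScale_spec`). With precision N ≥ 8nq/p the total
rounding error is at most x·p/(4q) (`IsTrace.mul_le`).

Running time. One table takes O(n(N+1)) steps and one separator O(n) tables; each query takes one
depth-first search in O(n³). A round is paid for by the vertices it removes, which gives O(n⁴ +
n³N), where N = O(1 + n/ε). The word-RAM program is verified with a weakest-precondition calculus
that tracks time and the size of numbers. The order of its queries is turned into a decision tree by
`exists_decisionTree`. -/

namespace TreeSearch

/-! ### Components -/

section Component

variable {V : Type*} {G : SimpleGraph V} {R S H C K : Set V} {x y u : V}

theorem component_subset : component G S x ⊆ S := fun _ ⟨_, hy, _⟩ => hy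

theorem mem_component_self (hx : x ∈ S) : x ∈ component G S x := ⟨hx, hx, .refl _⟩

theorem component_eq_of_mem (h : y ∈ component G S x) : component G S y = component G S x := by
  obtain ⟨hx, hy, h⟩ := h
  ext v
  exact ⟨fun ⟨_, hv, h'⟩ => ⟨hx, hv, h.trans h'⟩, fun ⟨_, hv, h'⟩ => ⟨hy, hv, h.symm.trans h'⟩⟩

theorem component_mono (h : S ⊆ R) : component G S x ⊆ component G R x := by
  rintro v ⟨hx, hv, h'⟩
  exact ⟨h hx, h hv, h'.map (SimpleGraph.induceHomOfLE G h).toHom⟩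

theorem subset_component (hC : (G.induce C).Preconnected) (h : C ⊆ S) (hx : x ∈ C) :
    C ⊆ component G S x := fun _ hy => component_mono h ⟨hx, hy, hC _ _⟩

/-- A walk inside `S` that starts in the component never leaves it, so it also is a walk of the
smaller induced graph. -/
theorem reachable_induce_component {a b : S} (p : (G.induce S).Walk a b)
    (ha : (a : V) ∈ component G S x) :
    ∃ hb : (b : V) ∈ component G S x,
      (G.induce (component G S x)).Reachable ⟨a, ha⟩ ⟨b, hb⟩ := by
  induction p with
  | nil => exact ⟨ha, .refl _⟩
  | @cons a c b hac p ih =>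
    have hc : (c : V) ∈ component G S x := by
      rw [← component_eq_of_mem ha]
      exact ⟨a.2, c.2, hac.reachable⟩
    obtain ⟨hb, h⟩ := ih hc
    refine ⟨hb, SimpleGraph.Reachable.trans (SimpleGraph.Adj.reachable ?_) h⟩
    exact hac

theorem preconnected_component : (G.induce (component G S x)).Preconnected := by
  rintro ⟨y, hy⟩ ⟨v, hv⟩
  have hv' := hv
  rw [← component_eq_of_mem hy] at hv'
  obtain ⟨h1, h2, ⟨p⟩⟩ := hv'
  exact (reachable_induce_component p hy).2

theorem IsComponent.preconnected (h : IsComponent G S K) : (G.induce K).Preconnected := by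
  obtain ⟨x, -, rfl⟩ := h
  exact preconnected_component

theorem IsComponent.subset (h : IsComponent G S K) : K ⊆ S := by
  obtain ⟨x, -, rfl⟩ := h
  exact component_subset

theorem IsComponent.eq_component (h : IsComponent G S K) (hx : x ∈ K) : K = component G S x := by
  obtain ⟨y, -, rfl⟩ := h
  exact (component_eq_of_mem hx).symm

theorem IsComponent.subset_of_mem (h : IsComponent G S K) (hC : (G.induce C).Preconnected)
    (hCS : C ⊆ S) (hx : x ∈ C) (hxK : x ∈ K) : C ⊆ K := by
  rw [h.eq_component hxK]
  exact subset_component hC hCS hx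

theorem IsComponent.diff_of_notMem (h : IsComponent G R H) (hu : u ∉ H) :
    IsComponent G (R \ {u}) H := by
  have hH := h.preconnected
  obtain ⟨x, hx, rfl⟩ := h
  have hsub : component G R x ⊆ R \ {u} := fun v hv =>
    ⟨component_subset hv, fun h => hu (Set.mem_singleton_iff.1 h ▸ hv)⟩
  exact ⟨x, hsub (mem_component_self hx),
    (subset_component hH hsub (mem_component_self hx)).antisymm
      (component_mono Set.sdiff_subset)⟩

theorem IsComponent.component_diff (h : IsComponent G R H) (hx : x ∈ H \ {u}) :
    component G (H \ {u}) x = component G (R \ {u}) x := by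
  refine (component_mono (Set.sdiff_subset_sdiff_left h.subset)).antisymm ?_
  have hxR : x ∈ R \ {u} := ⟨h.subset hx.1, hx.2⟩
  refine subset_component preconnected_component (fun v hv => ⟨?_, (component_subset hv).2⟩)
    (mem_component_self hxR)
  exact h.subset_of_mem preconnected_component (component_subset.trans Set.sdiff_subset)
    (mem_component_self hxR) hx.1 hv

/-- Together with `IsComponent.diff_of_notMem` this describes the effect of a query on a component
of the alive vertices: it is split if it contains the queried vertex and untouched otherwise. -/
theorem IsComponent.of_diff (h : IsComponent G R H) (hK : IsComponent G (H \ {u}) K) :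
    IsComponent G (R \ {u}) K := by
  obtain ⟨x, hx, rfl⟩ := hK
  exact ⟨x, ⟨h.subset hx.1, hx.2⟩, h.component_diff hx⟩

theorem exists_adj_of_preconnected (hC : (G.induce C).Preconnected) {X : Set V}
    (hx : x ∈ C) (hxX : x ∈ X) (hy : y ∈ C) (hyX : y ∉ X) :
    ∃ a ∈ C, ∃ b ∈ C, a ∈ X ∧ b ∉ X ∧ G.Adj a b := by
  obtain ⟨p⟩ := hC ⟨x, hx⟩ ⟨y, hy⟩
  obtain ⟨d, -, h1, h2⟩ := p.exists_boundary_dart {v | (v : V) ∈ X} hxX hyX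
  exact ⟨d.fst, d.fst.2, d.snd, d.snd.2, h1, h2, d.adj⟩

end Component

/-! ### Decision trees from elimination orders -/

section Elimination

variable {V : Type*} {G : SimpleGraph V} {c : V → ℕ} {l : V → ℕ}

/-- A stage of an elimination: the vertices not queried yet, the parent labels assigned so far, and
the total query cost paid by each target so far. -/
structure Stage (V : Type*) where
  alive : Set V
  parent : V → ℕ
  pay : V → ℕ

open Classical in
/-- The stage after a query to `u`, where `l u` is the label of `u` as a parent. -/
noncomputable def Stage.query (G : SimpleGraph V) (c l : V → ℕ) (σ : Stage V) (u : V) :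
    Stage V where
  alive := σ.alive \ {u}
  parent v := if v ∈ component G σ.alive u ∧ v ≠ u then l u else σ.parent v
  pay v := σ.pay v + if v ∈ component G σ.alive u then c u else 0

/-- One query to a vertex that is still alive. -/
def Stage.Step (G : SimpleGraph V) (c l : V → ℕ) (σ τ : Stage V) : Prop :=
  ∃ u ∈ σ.alive, τ = σ.query G c l u

/-- Queries write only to alive vertices. Hence the label and the payment of a vertex are final as
soon as it has been queried itself. -/
theorem Stage.of_notMem {σ τ : Stage V} (h : Relation.ReflTransGen (Stage.Step G c l) σ τ)
    {v : V} (hv : v ∉ σ.alive) : τ.parent v = σ.parent v ∧ τ.pay v = σ.pay v := by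
  induction h using Relation.ReflTransGen.head_induction_on with
  | refl => exact ⟨rfl, rfl⟩
  | head h _ ih =>
    obtain ⟨u, hu, rfl⟩ := h
    have h1 := ih (fun h => hv h.1)
    have h2 : ∀ u, v ∉ component G (Stage.alive _) u := fun u h => hv (component_subset h)
    rw [h1.1, h1.2]
    simp [Stage.query, h2]

/-- Queries in different components do not interact. The first query inside `H` becomes the root,
and the rest of the sequence serves each component that it leaves. All vertices of `H` carry the
common label `a` of the query that separated `H`, so the root inherits it. -/
theorem exists_decisionTree {τ : Stage V} (hτ : τ.alive = ∅) {σ : Stage V}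
    (h : Relation.ReflTransGen (Stage.Step G c l) σ τ) {H : Set V}
    (hH : IsComponent G σ.alive H) {a : ℕ} (ha : ∀ v ∈ H, σ.parent v = a) :
    ∃ D : DecisionTree G H, τ.parent D.root = a ∧ (∀ u v, D.Edge u v → τ.parent v = l u) ∧
      ∀ x ∈ H, τ.pay x = σ.pay x + ((D.queries x).map c).sum := by
  classical
  induction h using Relation.ReflTransGen.head_induction_on generalizing H a with
  | refl =>
    obtain ⟨x, hx, -⟩ := hH
    simp [hτ] at hx
  | @head σ σ' h hr ih =>
    obtain ⟨u, hu, rfl⟩ := h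
    by_cases huH : u ∈ H
    · have hHu := hH.eq_component huH
      have key : ∀ K : Set V, IsComponent G (H \ {u}) K → ∃ D : DecisionTree G K,
          τ.parent D.root = l u ∧ (∀ u v, D.Edge u v → τ.parent v = l u) ∧
          ∀ x ∈ K, τ.pay x = (σ.query G c l u).pay x + ((D.queries x).map c).sum := by
        intro K hK
        refine ih (hH.of_diff hK) fun v hv => ?_
        have := hK.subset hv
        rw [Stage.query]
        simp only [← hHu]
        rw [if_pos ⟨this.1, this.2⟩]
      choose sub h1 h2 h3 using key
      have hu' := Stage.of_notMem hr (v := u) (fun h => h.2 rfl)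
      refine ⟨.node H u huH sub, ?_, ?_, ?_⟩
      · show τ.parent u = a
        rw [hu'.1, ← ha u huH]
        simp [Stage.query]
      · rintro w v (⟨rfl, K, hK, rfl⟩ | ⟨K, hK, hE⟩)
        · exact h1 K hK
        · exact h2 K hK _ _ hE
      · intro x hx
        rw [DecisionTree.queries]
        split_ifs with hxu
        · rw [h3 _ ⟨x, hxu, rfl⟩ x (mem_component_self hxu)]
          simp [Stage.query, ← hHu, hx, add_assoc]
        · have : x = u := by simpa [hx] using hxu
          subst this
          rw [hu'.2]
          simp [Stage.query, ← hHu, hx]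
    -- The component of `u` is disjoint from `H`, so this query changes nothing on `H`.
    · have hne : ∀ v ∈ H, v ∉ component G σ.alive u := fun v hv hv' => huH <| by
        rw [hH.eq_component hv, component_eq_of_mem hv']
        exact mem_component_self hu
      obtain ⟨D, h1, h2, h3⟩ := ih (hH.diff_of_notMem huH) (a := a) fun v hv => by
        simp [Stage.query, hne v hv, ha v hv]
      refine ⟨D, h1, h2, fun x hx => ?_⟩
      rw [h3 x hx]
      simp [Stage.query, hne x hx]

end Elimination

/-! ### The lower bound -/

section LowerBound

variable {V : Type*} {G : SimpleGraph V}

theorem DecisionTree.root_mem_queries {H : Set V} (D : DecisionTree G H) (x : V) :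
    D.root ∈ D.queries x := by
  cases D with
  | node _ r _ sub =>
    rw [queries]
    split_ifs <;> simp [root]

/-- As long as no query hits `C`, the connected set `C` stays within one response, so all targets in
`C` follow the same path down to the first query inside `C`. -/
theorem DecisionTree.exists_common_query {H : Set V} (D : DecisionTree G H) {C : Set V}
    (hC : (G.induce C).Preconnected) (hne : C.Nonempty) (hCH : C ⊆ H) :
    ∃ v ∈ C, ∀ x ∈ C, v ∈ D.queries x := by
  induction D with
  | node H r hr sub ih =>
    by_cases h : r ∈ C
    · exact ⟨r, h, fun x _ => DecisionTree.root_mem_queries (.node H r hr sub) x⟩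
    · obtain ⟨y, hy⟩ := hne
      have hsub : C ⊆ H \ {r} := fun v hv => ⟨hCH hv, fun e => h (Set.mem_singleton_iff.1 e ▸ hv)⟩
      have hcy := subset_component hC hsub hy
      obtain ⟨v, hv, hv'⟩ := ih (component G (H \ {r}) y) ⟨y, hsub hy, rfl⟩ hcy
      refine ⟨v, hv, fun x hx => ?_⟩
      -- The type of `sub K hK` depends on `K`, so the equality of components is substituted instead
      -- of rewritten.
      have key : ∀ (K : Set V) (hK : IsComponent G (H \ {r}) K), K = component G (H \ {r}) y →
          v ∈ (sub K hK).queries x := by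
        rintro K hK rfl
        exact hv' x hx
      rw [queries, dif_pos (hsub hx)]
      exact List.mem_cons_of_mem _ (key _ _ (component_eq_of_mem (hcy hx)))

variable [Fintype V]

open Classical in
/-- The total weight of a set of vertices. -/
noncomputable def weight (w : V → ℕ) (C : Set V) : ℕ := ∑ v with v ∈ C, w v

theorem weight_mono (w : V → ℕ) {C K : Set V} (h : C ⊆ K) : weight w C ≤ weight w K := by
  classical
  refine Finset.sum_le_sum_of_subset fun v => ?_
  simpa using fun hv => h hv

theorem weight_empty (w : V → ℕ) : weight w (∅ : Set V) = 0 := by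
  simp [weight]

/-- The set of targets for which the vertex `v` is queried. -/
def DecisionTree.candidates {H : Set V} (D : DecisionTree G H) (v : V) : Set V :=
  {x | v ∈ D.queries x}

/-- Double counting of the pairs (query, target). Only an inequality is needed, so repetitions in a
query list can be dropped without excluding them. -/
theorem DecisionTree.sum_weight_candidates_le {H : Set V} (D : DecisionTree G H) (c w : V → ℕ) :
    ∑ v, c v * weight w (D.candidates v) ≤ D.cost c w := by
  classical
  simp only [weight, Finset.sum_filter, Finset.mul_sum]
  rw [Finset.sum_comm, cost]
  refine Finset.sum_le_sum fun x _ => ?_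
  have h1 : ∑ v, (c v * if x ∈ D.candidates v then w x else 0)
      = w x * ∑ v ∈ (D.queries x).toFinset, c v := by
    rw [Finset.mul_sum, ← Finset.sum_filter_add_sum_filter_not Finset.univ (· ∈ D.queries x)]
    have h2 : Finset.univ.filter (· ∈ D.queries x) = (D.queries x).toFinset := by ext; simp
    rw [h2, Finset.sum_congr rfl (g := fun v => w x * c v), add_eq_left]
    · refine Finset.sum_eq_zero fun v hv => ?_
      simp only [Finset.mem_filter] at hv
      simp [candidates, hv.2]
    · intro v hv
      simp only [List.mem_toFinset] at hv
      simp [candidates, hv, mul_comm]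
  rw [h1]
  refine Nat.mul_le_mul_left _ ?_
  generalize D.queries x = L
  induction L with
  | nil => simp
  | cons a L ih =>
    rw [List.toFinset_cons, List.map_cons, List.sum_cons]
    by_cases h : a ∈ L.toFinset
    · rw [Finset.insert_eq_of_mem h]
      omega
    · rw [Finset.sum_insert h]
      omega

/-! ### Separators and the charging argument -/

/-- Every connected part of `H` that avoids `S` has at most half of the weight of `H`. -/
def IsSeparator (G : SimpleGraph V) (w : V → ℕ) (H S : Set V) : Prop :=
  ∀ C ⊆ H, Disjoint C S → (G.induce C).Preconnected → 2 * weight w C ≤ weight w H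

open Classical in
/-- The part of `H` that has to be queried by `D` before half of the weight of `H` is excluded. -/
noncomputable def DecisionTree.heavy {K : Set V} (D : DecisionTree G K) (w : V → ℕ) (H : Set V) :
    Finset V :=
  {v | v ∈ H ∧ weight w H < 2 * weight w (D.candidates v ∩ H)}

/-- If a connected `C` avoids the heavy vertices, its common query `v` is not heavy, whereas `C` is
contained in the candidates of `v` within `H`. -/
theorem DecisionTree.isSeparator_heavy (D : DecisionTree G Set.univ) (w : V → ℕ) (H : Set V) :
    IsSeparator G w H (D.heavy w H) := by
  intro C hCH hd hC
  rcases C.eq_empty_or_nonempty with rfl | hne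
  · simp [weight_empty]
  obtain ⟨v, hv, hv'⟩ := D.exists_common_query hC hne (Set.subset_univ _)
  have h1 : v ∉ D.heavy w H := fun h => Set.disjoint_left.1 hd hv h
  have h2 : weight w C ≤ weight w (D.candidates v ∩ H) :=
    weight_mono w fun x hx => ⟨hv' x hx, hCH hx⟩
  simp only [heavy, Finset.mem_filter, Finset.mem_univ, true_and, not_and, not_lt] at h1
  have := h1 (hCH hv)
  omega

/-- The payments so far, up to the factor `β / α`, are charged to the vertices such that the charge
of each vertex `v` remains below four times its contribution to the cost of `D`, even if
another connected part of the alive vertices with `v` is charged. -/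
def Charged (D : DecisionTree G Set.univ) (c w : V → ℕ) (α β : ℕ) (R : Set V) (pay : V → ℕ) :
    Prop :=
  ∃ charge : V → ℕ, α * ∑ x, w x * pay x ≤ β * ∑ v, c v * charge v ∧
    ∀ v, charge v ≤ 4 * weight w (D.candidates v) ∧
      (charge v = 0 ∨ ∀ C ⊆ R, v ∈ C → (G.induce C).Preconnected →
        charge v + 2 * weight w C ≤ 4 * weight w (D.candidates v))

theorem Charged.zero (D : DecisionTree G Set.univ) (c w : V → ℕ) (α β : ℕ) (R : Set V) :
    Charged D c w α β R fun _ => 0 := ⟨fun _ => 0, by simp⟩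

theorem Charged.le {D : DecisionTree G Set.univ} {c w : V → ℕ} {α β : ℕ} {R : Set V}
    {pay : V → ℕ} (h : Charged D c w α β R pay) :
    α * ∑ x, w x * pay x ≤ 4 * β * D.cost c w := by
  obtain ⟨charge, h1, h2⟩ := h
  refine h1.trans ?_
  rw [mul_comm 4 β, mul_assoc]
  refine Nat.mul_le_mul_left _ (le_trans ?_ (Nat.mul_le_mul_left 4 (D.sum_weight_candidates_le c w)))
  rw [Finset.mul_sum]
  refine Finset.sum_le_sum fun v _ => ?_
  have := Nat.mul_le_mul_left (c v) (h2 v).1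
  linarith

/-- The separator `S` is compared with the separator `D.heavy w H`, which is where the round is
charged. For a charged vertex the halving turns the new charge w(H) plus twice the weight of any
later part into at most 2·w(H), which the invariant had kept in reserve. -/
theorem Charged.step {D : DecisionTree G Set.univ} {c w : V → ℕ} {α β : ℕ} {R R' H : Set V}
    {S : Finset V} {pay pay' : V → ℕ} (h : Charged D c w α β R pay)
    (hH : IsComponent G R H) (hS : IsSeparator G w H S)
    (hopt : 0 < weight w H → ∀ P : Finset V, (∀ v ∈ P, v ∈ H) → IsSeparator G w H P →
      α * ∑ v ∈ S, c v ≤ β * ∑ v ∈ P, c v)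
    (hpay : ∑ x, w x * pay' x ≤ ∑ x, w x * pay x + weight w H * ∑ v ∈ S, c v)
    (hR : R' ⊆ R \ S) : Charged D c w α β R' pay' := by
  classical
  obtain ⟨charge, h1, h2⟩ := h
  set P := D.heavy w H with hP
  have hPH : ∀ v ∈ P, v ∈ H := fun v hv => by
    simp only [hP, DecisionTree.heavy, Finset.mem_filter] at hv
    exact hv.2.1
  have hPw : ∀ v ∈ P, weight w H < 2 * weight w (D.candidates v) := fun v hv => by
    simp only [hP, DecisionTree.heavy, Finset.mem_filter] at hv
    have := weight_mono w (Set.inter_subset_left : D.candidates v ∩ H ⊆ D.candidates v)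
    omega
  -- Every heavy vertex takes a charge of w(H) in this round.
  refine ⟨fun v => charge v + if v ∈ P then weight w H else 0, ?_, fun v => ?_⟩
  · have h3 : weight w H * (α * ∑ v ∈ S, c v) ≤ weight w H * (β * ∑ v ∈ P, c v) := by
      rcases Nat.eq_zero_or_pos (weight w H) with h0 | h0
      · simp [h0]
      · exact Nat.mul_le_mul_left _ (hopt h0 P hPH (D.isSeparator_heavy w H))
    have h4 : ∑ v, c v * (charge v + if v ∈ P then weight w H else 0)
        = ∑ v, c v * charge v + weight w H * ∑ v ∈ P, c v := by
      simp only [mul_add, Finset.sum_add_distrib, mul_ite, mul_zero, Finset.sum_ite_mem,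
        Finset.univ_inter, Finset.mul_sum]
      simp only [mul_comm]
    rw [h4]
    calc α * ∑ x, w x * pay' x ≤ α * (∑ x, w x * pay x + weight w H * ∑ v ∈ S, c v) :=
          Nat.mul_le_mul_left _ hpay
      _ = α * ∑ x, w x * pay x + weight w H * (α * ∑ v ∈ S, c v) := by ring
      _ ≤ β * ∑ v, c v * charge v + weight w H * (β * ∑ v ∈ P, c v) := add_le_add h1 h3
      _ = _ := by ring
  · by_cases hv : v ∈ P
    · have hvH := hPH v hv
      have hw := hPw v hv
      -- A first charge is covered because `v` is heavy; a later one by the previous invariant with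
      -- `C = H`.
      have hlt : charge v + 2 * weight w H ≤ 4 * weight w (D.candidates v) := by
        rcases (h2 v).2 with h0 | h0
        · omega
        · exact h0 H hH.subset hvH hH.preconnected
      simp only [hv, if_true]
      refine ⟨by omega, Or.inr fun C hC hvC hCc => ?_⟩
      have h5 : C ⊆ H := hH.subset_of_mem hCc (fun x hx => (hR (hC hx)).1) hvC hvH
      have := hS C h5 (Set.disjoint_left.2 fun x hx => (hR (hC hx)).2) hCc
      omega
    · simp only [hv, if_false, add_zero]
      refine ⟨(h2 v).1, (h2 v).2.imp_right fun h0 C hC => ?_⟩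
      exact h0 C fun x hx => (hR (hC hx)).1

end LowerBound

/-! ### Depth-first orders -/

set_option linter.unusedSectionVars false

section Order

variable {V : Type*} {G : SimpleGraph V} {R H : Set V} {z : V} {m : ℕ} {o : ℕ → V} {π e : ℕ → ℕ}

/-- `o 0, …, o (m - 1)` is the beginning of a depth-first search of `G[R]` from `z`: the successor of
`o (j - 1)` is a neighbor of the latest vertex `o (π j)` that has unvisited neighbors. -/
structure DFSOrder (G : SimpleGraph V) (R : Set V) (z : V) (m : ℕ) (o : ℕ → V) (π : ℕ → ℕ) :
    Prop where
  zero : 0 < m → o 0 = z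
  inj : ∀ i < m, ∀ j < m, o i = o j → i = j
  mem : ∀ i < m, o i ∈ R
  lt : ∀ j < m, 0 < j → π j < j
  adj : ∀ j < m, 0 < j → G.Adj (o (π j)) (o j)
  last : ∀ j < m, ∀ i, π j < i → i < j → ∀ v ∈ R, G.Adj (o i) v → ∃ l < j, o l = v

theorem DFSOrder.nil : DFSOrder G R z 0 o π where
  zero h := absurd h (lt_irrefl _)
  inj _ h := absurd h (Nat.not_lt_zero _)
  mem _ h := absurd h (Nat.not_lt_zero _)
  lt _ h := absurd h (Nat.not_lt_zero _)
  adj _ h := absurd h (Nat.not_lt_zero _)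
  last _ h := absurd h (Nat.not_lt_zero _)

theorem DFSOrder.snoc (h : DFSOrder G R z m o π) {u : V} {i : ℕ} (hu : u ∈ R)
    (hz : m = 0 → u = z) (hnew : ∀ l < m, o l ≠ u) (hi : 0 < m → i < m ∧ G.Adj (o i) u)
    (hlast : ∀ i', i < i' → i' < m → ∀ v ∈ R, G.Adj (o i') v → ∃ l < m, o l = v) :
    DFSOrder G R z (m + 1) (Function.update o m u) (Function.update π m i) := by
  have ho : ∀ l, l < m → Function.update o m u l = o l := fun l hl =>
    Function.update_of_ne hl.ne _ _
  have hp : ∀ l, l < m → Function.update π m i l = π l := fun l hl =>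
    Function.update_of_ne hl.ne _ _
  constructor
  · intro _
    rcases Nat.eq_zero_or_pos m with rfl | hm
    · simpa using hz rfl
    · rw [ho 0 hm, h.zero hm]
  · intro a ha b hb hab
    rcases Nat.lt_succ_iff_lt_or_eq.1 ha with ha | rfl <;>
    rcases Nat.lt_succ_iff_lt_or_eq.1 hb with hb | rfl
    · rw [ho a ha, ho b hb] at hab
      exact h.inj a ha b hb hab
    · rw [ho a ha, Function.update_self] at hab
      exact absurd hab (hnew a ha)
    · rw [ho b hb, Function.update_self] at hab
      exact absurd hab.symm (hnew b hb)
    · rfl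
  · intro a ha
    rcases Nat.lt_succ_iff_lt_or_eq.1 ha with ha | rfl
    · rw [ho a ha]; exact h.mem a ha
    · simpa using hu
  · intro a ha ha0
    rcases Nat.lt_succ_iff_lt_or_eq.1 ha with ha | rfl
    · rw [hp a ha]; exact h.lt a ha ha0
    · simpa using (hi ha0).1
  · intro a ha ha0
    rcases Nat.lt_succ_iff_lt_or_eq.1 ha with ha | rfl
    · rw [hp a ha, ho a ha, ho _ ((h.lt a ha ha0).trans ha)]; exact h.adj a ha ha0
    · simpa [ho _ (hi ha0).1] using (hi ha0).2
  · intro j hj i' h1 h2 v hv hadj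
    rcases Nat.lt_succ_iff_lt_or_eq.1 hj with hj | rfl
    · rw [hp j hj] at h1
      rw [ho i' (h2.trans hj)] at hadj
      obtain ⟨l, hl, rfl⟩ := h.last j hj i' h1 h2 v hv hadj
      exact ⟨l, hl, ho l (hl.trans hj)⟩
    · rw [Function.update_self] at h1
      rw [ho i' h2] at hadj
      obtain ⟨l, hl, rfl⟩ := hlast i' h1 h2 v hv hadj
      exact ⟨l, hl, ho l hl⟩

theorem DFSOrder.mem_component (h : DFSOrder G R z m o π) {i : ℕ} (hi : i < m) :
    o i ∈ component G R z := by
  induction i using Nat.strong_induction_on with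
  | _ i ih =>
    rcases Nat.eq_zero_or_pos i with rfl | h0
    · have := h.mem 0 hi
      rw [h.zero hi] at this ⊢
      exact mem_component_self this
    · have h1 := h.lt i hi h0
      obtain ⟨hz, hp, hr⟩ := ih _ h1 (h1.trans hi)
      refine ⟨hz, h.mem i hi, hr.trans (SimpleGraph.Adj.reachable ?_)⟩
      exact h.adj i hi h0

/-- A proper subset of a component would have an edge leaving it, but the list is closed under
neighbors in `R`. -/
theorem DFSOrder.mem_component_iff (h : DFSOrder G R z m o π) (hm : 0 < m)
    (hc : ∀ i < m, ∀ v ∈ R, G.Adj (o i) v → ∃ l < m, o l = v) {v : V} :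
    v ∈ component G R z ↔ ∃ i < m, o i = v := by
  refine ⟨fun hv => ?_, fun ⟨i, hi, h'⟩ => h' ▸ h.mem_component hi⟩
  by_contra hcon
  have hzc : z ∈ component G R z := h.zero hm ▸ h.mem_component hm
  obtain ⟨a, -, b, hb, ⟨i, hi, rfl⟩, hbX, hab⟩ := exists_adj_of_preconnected
    (X := {v | ∃ i < m, o i = v}) preconnected_component hzc ⟨0, hm, h.zero hm⟩ hv hcon
  exact hbX (hc i hi b (component_subset hb) hab)

/-- An edge between listed vertices that is not a search edge would close a cycle: the search edges
alone already join its ends, so it is not a bridge. -/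
theorem DFSOrder.eq_parent (h : DFSOrder G R z m o π) (hG : G.IsAcyclic) {i j : ℕ} (hj : j < m)
    (hij : i < j) (hadj : G.Adj (o i) (o j)) : i = π j := by
  by_contra hne
  -- The search edges up to position `j` all survive the deletion of the edge from `o i` to `o j`.
  have key : ∀ l ≤ j, (G \ SimpleGraph.fromEdgeSet {s(o i, o j)}).Reachable (o 0) (o l) := by
    intro l hl
    induction l using Nat.strong_induction_on with
    | _ l ih =>
      rcases Nat.eq_zero_or_pos l with rfl | h0
      · exact .refl _
      have hlm : l < m := hl.trans_lt hj
      have h1 := h.lt l hlm h0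
      refine (ih _ h1 (h1.le.trans hl)).trans (SimpleGraph.Adj.reachable ?_)
      rw [SimpleGraph.sdiff_adj]
      refine ⟨h.adj l hlm h0, fun hmem => ?_⟩
      simp only [SimpleGraph.fromEdgeSet_adj, Set.mem_singleton_iff, Sym2.eq_iff] at hmem
      rcases hmem.1 with ⟨h2, h3⟩ | ⟨h2, h3⟩
      · have h4 := h.inj _ hlm _ hj h3
        subst h4
        exact hne (h.inj _ (h1.trans hlm) _ (hij.trans hj) h2).symm
      · have h4 := h.inj _ (h1.trans hlm) _ hj h2
        omega
  have hb := SimpleGraph.isAcyclic_iff_forall_adj_isBridge.1 hG hadj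
  rw [SimpleGraph.isBridge_iff] at hb
  exact hb ((key i hij.le).symm.trans (key j le_rfl))

/-- An order `o` of the vertices of the tree `G[H]` in which the descendants of `o i` (with respect to
the root `o 0`) are `o i, …, o (e i - 1)`. -/
structure Layout (G : SimpleGraph V) (H : Set V) (m : ℕ) (o : ℕ → V) (e : ℕ → ℕ) : Prop where
  pos : 0 < m
  inj : ∀ i < m, ∀ j < m, o i = o j → i = j
  mem_iff : ∀ v, v ∈ H ↔ ∃ i < m, o i = v
  lt : ∀ i < m, i < e i
  le : ∀ i < m, e i ≤ m
  root : e 0 = m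
  cross : ∀ i < m, ∀ a < m, ∀ b < m, G.Adj (o a) (o b) → i ≤ a → a < e i → ¬ (i ≤ b ∧ b < e i) →
    a = i ∧ b < i
  parent : ∀ j < m, 0 < j → ∃ i < j, G.Adj (o i) (o j) ∧
    ∀ a < m, a ≤ i → i < e a → a ≤ j ∧ j < e a
  laminar : ∀ i < m, ∀ a, i ≤ a → a < e i → e a ≤ e i

/-- By `he`, `e i` is the first position after `i` whose parent precedes `i`, or `m`. Depth-first
search never returns to a subtree that it has left, so this end marks exactly the descendants of `o
i`. -/
theorem DFSOrder.layout (h : DFSOrder G R z m o π) (hG : G.IsAcyclic) (hm : 0 < m)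
    (hc : ∀ i < m, ∀ v ∈ R, G.Adj (o i) v → ∃ l < m, o l = v)
    (he : ∀ i < m, i < e i ∧ e i ≤ m ∧ (∀ l, i < l → l < e i → i ≤ π l) ∧
      (e i < m → π (e i) < i)) : Layout G (component G R z) m o e := by
  -- A later vertex lies in the block of `i` exactly if its parent does.
  have block : ∀ i < m, ∀ j < m, 0 < j → ((i < j ∧ j < e i) ↔ (i ≤ π j ∧ π j < e i)) := by
    intro i hi j hj h0
    obtain ⟨h1, h2, h3, h4⟩ := he i hi
    have hlt := h.lt j hj h0
    refine ⟨fun ⟨h5, h6⟩ => ⟨h3 j h5 h6, by omega⟩, fun ⟨h5, h6⟩ => ⟨by omega, ?_⟩⟩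
    by_contra hcon
    have hE : e i < m := by omega
    have h7 := h4 hE
    have hne : e i ≠ j := fun h => by subst h; omega
    -- When the search backtracked above `i` at time `e i`, the vertex `o (π j)` had no unvisited
    -- neighbor left, so `o j` would have been listed already.
    obtain ⟨l, hl, hl'⟩ := h.last (e i) hE (π j) (by omega) h6 (o j) (h.mem j hj) (h.adj j hj h0)
    have := h.inj l (by omega) j hj hl'
    omega
  constructor
  · exact hm
  · exact h.inj
  · exact fun v => h.mem_component_iff hm hc
  · exact fun i hi => (he i hi).1
  · exact fun i hi => (he i hi).2.1
  · by_contra hne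
    have h1 := (he 0 hm).2.1
    have := (he 0 hm).2.2.2 (by omega)
    omega
  · intro i hi a ha b hb hab h1 h2 h3
    rcases lt_trichotomy a b with hlt | rfl | hlt
    · have h4 := h.eq_parent hG hb hlt hab
      have := (block i hi b hb (by omega)).2 ⟨by omega, by omega⟩
      omega
    · exact absurd ⟨h1, h2⟩ h3
    · have h4 := h.eq_parent hG ha hlt hab.symm
      by_cases h5 : a = i
      · exact ⟨h5, by omega⟩
      · have := (block i hi a ha (by omega)).1 ⟨by omega, h2⟩
        omega
  · intro j hj h0
    refine ⟨π j, h.lt j hj h0, h.adj j hj h0, fun a ha h1 h2 => ?_⟩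
    have := (block a ha j hj h0).2 ⟨h1, h2⟩
    omega
  · intro i hi a h1 h2
    have hie := (he i hi).2.1
    obtain ⟨h3, h4, h5, -⟩ := he a (by omega)
    by_contra hcon
    push Not at hcon
    have hE : e i < m := by omega
    have h6 := h5 (e i) h2 hcon
    have := (block i hi (e i) hE (by omega)).2 ⟨by omega, h.lt _ hE (by omega)⟩
    omega

theorem Layout.mem (h : Layout G H m o e) {i : ℕ} (hi : i < m) : o i ∈ H :=
  (h.mem_iff _).2 ⟨i, hi, rfl⟩

/-- A connected set which contains some descendant of `o i` but not all its vertices are descendants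
of `o i` contains `o i`. -/
theorem Layout.mem_of_cross (h : Layout G H m o e) {C : Set V} (hC : (G.induce C).Preconnected)
    (hCH : C ⊆ H) {i a b : ℕ} (hi : i < m) (ha : a < m) (hb : b < m) (haC : o a ∈ C)
    (hbC : o b ∈ C) (h1 : i ≤ a) (h2 : a < e i) (h3 : ¬ (i ≤ b ∧ b < e i)) :
    o i ∈ C ∧ ∃ j < i, o j ∈ C := by
  obtain ⟨x, hx, y, hy, ⟨a', ha', h4, h5, rfl⟩, hyX, hadj⟩ := exists_adj_of_preconnected
    (X := {v | ∃ a < m, i ≤ a ∧ a < e i ∧ o a = v}) hC haC ⟨a, ha, h1, h2, rfl⟩ hbC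
    (by
      rintro ⟨b', hb', h4, h5, h6⟩
      rw [h.inj b' hb' b hb h6] at h4 h5
      exact h3 ⟨h4, h5⟩)
  obtain ⟨b', hb', rfl⟩ := (h.mem_iff y).1 (hCH hy)
  obtain ⟨rfl, h6⟩ := h.cross i hi a' ha' b' hb' hadj h4 h5 fun h6 => hyX ⟨b', hb', h6.1, h6.2, rfl⟩
  exact ⟨hx, b', h6, hy⟩

variable [Fintype V] {w c : V → ℕ}

theorem Layout.weight_eq (h : Layout G H m o e) (w : V → ℕ) :
    weight w H = ∑ l ∈ Finset.range m, w (o l) := by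
  classical
  have : (Finset.univ.filter (· ∈ H)) = (Finset.range m).image o := by
    ext v
    simp [h.mem_iff]
  have h1 : weight w H = ∑ v ∈ Finset.univ.filter (· ∈ H), w v := by
    unfold weight
    congr
  rw [h1, this, Finset.sum_image]
  intro i hi j hj
  simp only [Finset.coe_range, Set.mem_Iio] at hi hj
  exact h.inj i hi j hj

theorem weight_le_sum {C : Set V} {J : Finset ℕ} (h : ∀ v ∈ C, ∃ l ∈ J, o l = v) :
    weight w C ≤ ∑ l ∈ J, w (o l) := by
  classical
  rw [weight]
  calc _ ≤ ∑ v ∈ J.image o, w v := by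
        refine Finset.sum_le_sum_of_subset fun v hv => ?_
        obtain ⟨l, hl, rfl⟩ := h v (by simpa using hv)
        exact Finset.mem_image_of_mem _ hl
    _ ≤ _ := Finset.sum_image_le_of_nonneg fun _ _ => Nat.zero_le _

/-- The last vertex in the order whose descendants carry more than half of the weight is a
centroid. -/
theorem Layout.centroid (h : Layout G H m o e) {i : ℕ} (hi : i < m)
    (h1 : weight w H < 2 * ∑ l ∈ Finset.Ico i (e i), w (o l))
    (h2 : ∀ j < m, i < j → 2 * ∑ l ∈ Finset.Ico j (e j), w (o l) ≤ weight w H)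
    {C : Set V} (hC : (G.induce C).Preconnected) (hCH : C ⊆ H) (hiC : o i ∉ C) :
    2 * weight w C ≤ weight w H := by
  classical
  rcases C.eq_empty_or_nonempty with rfl | ⟨x, hx⟩
  · simp [weight_empty]
  have hex : ∃ j, j < m ∧ o j ∈ C := by
    obtain ⟨j, hj, rfl⟩ := (h.mem_iff x).1 (hCH hx)
    exact ⟨j, hj, hx⟩
  set j := Nat.find hex with hjdef
  obtain ⟨hj, hjC⟩ := Nat.find_spec hex
  have hmin : ∀ l < j, o l ∉ C := fun l hl hlC => Nat.find_min hex hl ⟨by omega, hlC⟩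
  -- Here `j` is the first position of `C`. If `j < i`, then `C` misses the whole block of `i`,
  -- which holds more than half of the weight. If `j > i`, then `C` lies in the block of `j`, which
  -- is light by the choice of `i`.
  rcases lt_trichotomy j i with hlt | heq | hlt
  · have h3 : weight w C ≤ ∑ l ∈ Finset.range m \ Finset.Ico i (e i), w (o l) := by
      refine weight_le_sum fun v hv => ?_
      obtain ⟨l, hl, rfl⟩ := (h.mem_iff v).1 (hCH hv)
      refine ⟨l, ?_, rfl⟩
      simp only [Finset.mem_sdiff, Finset.mem_range, Finset.mem_Ico]
      refine ⟨hl, fun h4 => hiC ?_⟩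
      exact (h.mem_of_cross hC hCH hi hl hj hv hjC h4.1 h4.2 (by omega)).1
    have h4 : Finset.Ico i (e i) ⊆ Finset.range m := fun l hl => by
      have := h.le i hi
      simp only [Finset.mem_Ico, Finset.mem_range] at *
      omega
    have h5 := Finset.sum_sdiff (f := fun l => w (o l)) h4
    rw [← h.weight_eq w] at h5
    omega
  · exact absurd (heq ▸ hjC) hiC
  · refine le_trans (Nat.mul_le_mul_left 2 ?_) (h2 j hj hlt)
    refine weight_le_sum fun v hv => ?_
    obtain ⟨l, hl, rfl⟩ := (h.mem_iff v).1 (hCH hv)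
    refine ⟨l, ?_, rfl⟩
    rw [Finset.mem_Ico]
    by_contra h3
    obtain ⟨-, b, hb, hbC⟩ := h.mem_of_cross hC hCH hj hj hl hjC hv le_rfl (h.lt j hj) h3
    exact hmin b hb hbC

/-! ### The knapsack table -/

/-- The table of the dynamic program: `g i k` is the least weight of the vertices among
`o i, …, o (m - 1)` that remain connected to the root after some of them are removed, where each
removed vertex has weight `a` and cost `d ≤ B`, and the costs, rounded down to multiples of `B / N`,
sum up to at most `k * B / N`. -/
structure IsTable (m : ℕ) (e a d : ℕ → ℕ) (B N : ℕ) (g : ℕ → ℕ → ℕ) : Prop where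
  last : ∀ k ≤ N, g m k = 0
  step : ∀ i < m, ∀ k ≤ N, g i k = if d i ≤ B ∧ d i * N / B ≤ k then
    min (a i + g (i + 1) k) (g (e i) (k - d i * N / B)) else a i + g (i + 1) k

variable {B N : ℕ} {g : ℕ → ℕ → ℕ}

/-- The recurrence is followed along a prescribed removal set: at `i ∈ A` the table may jump over
the block of `i`, otherwise `i` is uncovered and its weight is paid. The condition `hfree` says that
no removed block straddles the current position; it persists because blocks are nested or disjoint.
-/
theorem IsTable.le_sum (hg : IsTable m e (w ∘ o) (c ∘ o) B N g) (h : Layout G H m o e)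
    {A U : Finset ℕ} (hA : ∀ l ∈ A, l < m ∧ c (o l) ≤ B)
    (hU : ∀ l, l ∈ U ↔ l < m ∧ ∀ a ∈ A, ¬ (a ≤ l ∧ l < e a)) {i k : ℕ} (hi : i ≤ m) (hk : k ≤ N)
    (hAk : ∑ l ∈ A with i ≤ l, c (o l) * N / B ≤ k) (hfree : ∀ a ∈ A, a < i → e a ≤ i) :
    g i k ≤ ∑ l ∈ U with i ≤ l, w (o l) := by
  induction hd : m - i using Nat.strong_induction_on generalizing i k with
  | _ d ih =>
    subst hd
    rcases hi.eq_or_lt with rfl | him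
    · rw [hg.last k hk]
      exact Nat.zero_le _
    by_cases hiA : i ∈ A
    · have h1 := h.lt i him
      have h2 := h.le i him
      -- Removed vertices inside the block of `i` are skipped by the jump, and leaving them out only
      -- lowers the cost.
      have hsplit : c (o i) * N / B + ∑ l ∈ A with e i ≤ l, c (o l) * N / B ≤
          ∑ l ∈ A with i ≤ l, c (o l) * N / B := by
        have hsub : insert i (A.filter (e i ≤ ·)) ⊆ A.filter (i ≤ ·) := by
          intro l
          simp only [Finset.mem_insert, Finset.mem_filter]
          rintro (rfl | ⟨h3, h4⟩)
          · exact ⟨hiA, le_rfl⟩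
          · exact ⟨h3, by omega⟩
        refine le_trans (le_of_eq ?_) (Finset.sum_le_sum_of_subset hsub)
        rw [Finset.sum_insert (by simp; omega)]
      rw [hg.step i him k hk, if_pos ⟨(hA i hiA).2, by show c (o i) * N / B ≤ k; omega⟩]
      refine (min_le_right _ _).trans ((ih (m - e i) (by omega) h2 ?_ ?_ ?_ rfl).trans ?_)
      · exact (Nat.sub_le _ _).trans hk
      · show _ ≤ k - c (o i) * N / B; omega
      · intro a ha ha'
        rcases lt_trichotomy a i with h3 | rfl | h3
        · exact (hfree a ha h3).trans h1.le
        · exact le_rfl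
        · exact h.laminar i him a h3.le ha'
      · refine Finset.sum_le_sum_of_subset fun l => ?_
        simp only [Finset.mem_filter]
        exact fun h3 => ⟨h3.1, by omega⟩
    · have hiU : i ∈ U := by
        refine (hU i).2 ⟨him, fun a ha h3 => ?_⟩
        rcases h3.1.eq_or_lt with rfl | h4
        · exact hiA ha
        · have := hfree a ha h4
          omega
      have h3 : g i k ≤ w (o i) + g (i + 1) k := by
        rw [hg.step i him k hk]
        split_ifs
        · exact min_le_left _ _
        · exact le_rfl
      have h4 : w (o i) + ∑ l ∈ U with i + 1 ≤ l, w (o l) ≤ ∑ l ∈ U with i ≤ l, w (o l) := by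
        have hsub : insert i (U.filter (i + 1 ≤ ·)) ⊆ U.filter (i ≤ ·) := by
          intro l
          simp only [Finset.mem_insert, Finset.mem_filter]
          rintro (rfl | ⟨h3, h4⟩)
          · exact ⟨hiU, le_rfl⟩
          · exact ⟨h3, by omega⟩
        refine le_trans (le_of_eq ?_) (Finset.sum_le_sum_of_subset hsub)
        rw [Finset.sum_insert (by simp)]
      refine h3.trans (le_trans (Nat.add_le_add_left (ih (m - (i + 1)) (by omega) (by omega) hk
        ?_ ?_ rfl) _) h4)
      · refine le_trans (Finset.sum_le_sum_of_subset fun l => ?_) hAk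
        simp only [Finset.mem_filter]
        exact fun h3 => ⟨h3.1, by omega⟩
      · intro a ha h5
        have h6 : a ≠ i := fun h6 => hiA (h6 ▸ ha)
        have := hfree a ha (by omega)
        omega

/-- Every separator of small cost is found by the dynamic program. -/
theorem IsTable.le_of_isSeparator (hg : IsTable m e (w ∘ o) (c ∘ o) B N g) (h : Layout G H m o e)
    {P : Finset V} (hP : IsSeparator G w H P) (hPH : ∀ v ∈ P, v ∈ H) (hPB : ∀ v ∈ P, c v ≤ B)
    (hPN : ∑ v ∈ P, c v * N / B ≤ N) :
    2 * g 0 (∑ v ∈ P, c v * N / B) ≤ weight w H := by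
  classical
  -- `A` lists the positions of `P`, and `U` the positions without a removed vertex among their
  -- ancestors and themselves.
  set A : Finset ℕ := (Finset.range m).filter (o · ∈ P) with hAdef
  set U : Finset ℕ := (Finset.range m).filter fun l => ∀ a ∈ A, ¬ (a ≤ l ∧ l < e a) with hUdef
  have hA : ∀ l, l ∈ A ↔ l < m ∧ o l ∈ P := by simp [hAdef]
  have hU : ∀ l, l ∈ U ↔ l < m ∧ ∀ a ∈ A, ¬ (a ≤ l ∧ l < e a) := by simp [hUdef]
  have hsum : ∑ l ∈ A, c (o l) * N / B = ∑ v ∈ P, c v * N / B := by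
    have : A.image o = P := by
      ext v
      simp only [Finset.mem_image, hA]
      constructor
      · rintro ⟨l, ⟨-, hl⟩, rfl⟩
        exact hl
      · intro hv
        obtain ⟨l, hl, rfl⟩ := (h.mem_iff v).1 (hPH v hv)
        exact ⟨l, ⟨hl, hv⟩, rfl⟩
    rw [← this, Finset.sum_image]
    intro i hi j hj
    exact h.inj i ((hA i).1 hi).1 j ((hA j).1 hj).1
  have h1 := hg.le_sum h (A := A) (U := U) (i := 0) (fun l hl => ⟨((hA l).1 hl).1,
    hPB _ ((hA l).1 hl).2⟩) hU (Nat.zero_le _) hPN (by simp [hsum]) (by simp)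
  refine le_trans (Nat.mul_le_mul_left 2 h1) ?_
  simp only [Nat.zero_le, Finset.filter_true]
  have h2 : ∑ l ∈ U, w (o l) = weight w (o '' U) := by
    rw [weight, ← Finset.sum_image (f := w)]
    · congr 1
      ext v
      simp
    · intro i hi j hj
      exact h.inj i ((hU i).1 hi).1 j ((hU j).1 hj).1
  rw [h2]
  refine hP _ ?_ ?_ ?_
  · rintro _ ⟨l, hl, rfl⟩
    exact h.mem ((hU l).1 hl).1
  · rw [Set.disjoint_left]
    rintro _ ⟨l, hl, rfl⟩ hlP
    obtain ⟨hlm, hl'⟩ := (hU l).1 hl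
    exact hl' l ((hA l).2 ⟨hlm, hlP⟩) ⟨le_rfl, h.lt l hlm⟩
  -- `U` is empty if the root is removed. Otherwise it is closed under parents, so all its vertices
  -- are joined to the root and it is a connected set avoiding `P`.
  · by_cases h0 : 0 ∈ U
    swap
    · have hempty : o '' (U : Set ℕ) = ∅ := by
        rw [Set.image_eq_empty, Set.eq_empty_iff_forall_notMem]
        intro l hl
        obtain ⟨hlm, hl'⟩ := (hU l).1 hl
        apply h0
        refine (hU 0).2 ⟨h.pos, fun a ha h3 => hl' a ha ?_⟩
        have h4 : a = 0 := by omega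
        subst h4
        exact ⟨Nat.zero_le _, h.root ▸ hlm⟩
      rw [hempty]
      rintro ⟨x, hx⟩
      exact absurd hx (Set.notMem_empty _)
    have key : ∀ l, ∀ hl : l ∈ U, (G.induce (o '' (U : Set ℕ))).Reachable
        ⟨o 0, 0, h0, rfl⟩ ⟨o l, l, hl, rfl⟩ := by
      intro l
      induction l using Nat.strong_induction_on with
      | _ l ih =>
        intro hl
        rcases Nat.eq_zero_or_pos l with rfl | hl0
        · exact .refl _
        obtain ⟨hlm, hl'⟩ := (hU l).1 hl
        obtain ⟨i, hil, hadj, hi⟩ := h.parent l hlm hl0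
        have hiU : i ∈ U := (hU i).2 ⟨by omega, fun a ha h3 =>
          hl' a ha (hi a ((hA a).1 ha).1 h3.1 h3.2)⟩
        refine (ih i hil hiU).trans (SimpleGraph.Adj.reachable ?_)
        exact hadj
    rintro ⟨_, l, hl, rfl⟩ ⟨_, l', hl', rfl⟩
    exact (key l hl).symm.trans (key l' hl')

/-! ### Recovering separators from the table -/

/-- The state of the reconstruction of a solution from the entry `g 0 k₀` of the table: `S` is the set
of the vertices removed among `o 0, …, o (i - 1)`. -/
structure IsTrace (m : ℕ) (o : ℕ → V) (e : ℕ → ℕ) (w c : V → ℕ) (B N : ℕ) (g : ℕ → ℕ → ℕ)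
    (k₀ i k : ℕ) (S : Finset V) : Prop where
  le : i ≤ m
  cost : ∑ v ∈ S, c v * N / B + k ≤ k₀
  mem : ∀ v ∈ S, c v ≤ B ∧ ∃ a < i, o a = v
  cover : ∃ U : Finset ℕ, (∀ l < i, l ∈ U ∨ ∃ a < i, o a ∈ S ∧ a ≤ l ∧ l < e a) ∧
    ∑ l ∈ U, w (o l) + g i k ≤ g 0 k₀

variable {k₀ i k : ℕ} {S : Finset V}

theorem IsTrace.nil : IsTrace m o e w c B N g k₀ 0 k₀ ∅ where
  le := Nat.zero_le _
  cost := by simp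
  mem := by simp
  cover := ⟨∅, by simp, by simp⟩

theorem IsTrace.keep (h : IsTrace m o e w c B N g k₀ i k S) (hi : i < m)
    (hik : g i k = w (o i) + g (i + 1) k) : IsTrace m o e w c B N g k₀ (i + 1) k S where
  le := hi
  cost := h.cost
  mem v hv := ⟨(h.mem v hv).1, by
    obtain ⟨a, ha, h'⟩ := (h.mem v hv).2
    exact ⟨a, by omega, h'⟩⟩
  cover := by
    classical
    obtain ⟨U, h1, h2⟩ := h.cover
    refine ⟨insert i U, fun l hl => ?_, ?_⟩
    · rcases Nat.lt_succ_iff_lt_or_eq.1 hl with hl | rfl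
      · rcases h1 l hl with h3 | ⟨a, h3, h4⟩
        · exact Or.inl (Finset.mem_insert_of_mem h3)
        · exact Or.inr ⟨a, by omega, h4⟩
      · exact Or.inl (Finset.mem_insert_self _ _)
    · have : ∑ l ∈ insert i U, w (o l) ≤ w (o i) + ∑ l ∈ U, w (o l) := by
        by_cases hU : i ∈ U
        · rw [Finset.insert_eq_of_mem hU]
          omega
        · rw [Finset.sum_insert hU]
      omega

theorem IsTrace.remove [DecidableEq V] (h : IsTrace m o e w c B N g k₀ i k S)
    (hL : Layout G H m o e) (hi : i < m) (hB : c (o i) ≤ B) (hk : c (o i) * N / B ≤ k)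
    (hik : g i k = g (e i) (k - c (o i) * N / B)) :
    IsTrace m o e w c B N g k₀ (e i) (k - c (o i) * N / B) (insert (o i) S) where
  le := hL.le i hi
  cost := by
    have hnew : o i ∉ S := fun hS => by
      obtain ⟨a, ha, h'⟩ := (h.mem _ hS).2
      have := hL.inj a (by omega) i hi h'
      omega
    rw [Finset.sum_insert hnew]
    have := h.cost
    omega
  mem v hv := by
    have h1 := hL.lt i hi
    rcases Finset.mem_insert.1 hv with rfl | hv
    · exact ⟨hB, i, h1, rfl⟩
    · obtain ⟨h2, a, ha, h3⟩ := h.mem v hv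
      exact ⟨h2, a, by omega, h3⟩
  cover := by
    have h1 := hL.lt i hi
    obtain ⟨U, h2, h3⟩ := h.cover
    refine ⟨U, fun l hl => ?_, by omega⟩
    by_cases hli : l < i
    · rcases h2 l hli with h4 | ⟨a, ha, h4, h5⟩
      · exact Or.inl h4
      · exact Or.inr ⟨a, by omega, Finset.mem_insert_of_mem h4, h5⟩
    · exact Or.inr ⟨i, h1, Finset.mem_insert_self _ _, by omega, hl⟩

/-- By `hz`, parts without the root are harmless. A part that contains the root and avoids `S`
consists of uncovered vertices, whose total weight is bounded by the table entry. -/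
theorem IsTrace.isSeparator (h : IsTrace m o e w c B N g k₀ m k S) (hL : Layout G H m o e)
    (hk : 2 * g 0 k₀ ≤ weight w H)
    (hz : ∀ C ⊆ H, (G.induce C).Preconnected → o 0 ∉ C → 2 * weight w C ≤ weight w H) :
    IsSeparator G w H S := by
  intro C hCH hCS hC
  by_cases h0 : o 0 ∈ C
  swap
  · exact hz C hCH hC h0
  obtain ⟨U, h1, h2⟩ := h.cover
  have : weight w C ≤ ∑ l ∈ U, w (o l) := by
    refine weight_le_sum fun v hv => ?_
    obtain ⟨l, hl, rfl⟩ := (hL.mem_iff v).1 (hCH hv)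
    rcases h1 l hl with h3 | ⟨a, ha, haS, h4, h5⟩
    · exact ⟨l, h3, rfl⟩
    exfalso
    -- A connected part that contains the root and a vertex of the block of `a` passes through `o
    -- a`, which is in `S`.
    refine Set.disjoint_left.1 hCS (?_ : o a ∈ C) haS
    rcases Nat.eq_zero_or_pos a with rfl | ha0
    · exact h0
    · exact (hL.mem_of_cross hC hCH ha hl hL.pos hv h0 h4 h5 (by omega)).1
  omega

theorem IsTrace.subset (h : IsTrace m o e w c B N g k₀ i k S) (hL : Layout G H m o e) :
    ∀ v ∈ S, v ∈ H := fun v hv => by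
  obtain ⟨a, ha, rfl⟩ := (h.mem v hv).2
  exact hL.mem (ha.trans_le h.le)

theorem Layout.card_le [DecidableEq V] (hL : Layout G H m o e) (hS : ∀ v ∈ S, v ∈ H) :
    S.card ≤ m := by
  have : S ⊆ (Finset.range m).image o := fun v hv => by
    obtain ⟨l, hl, rfl⟩ := (hL.mem_iff v).1 (hS v hv)
    exact Finset.mem_image_of_mem _ (Finset.mem_range.2 hl)
  simpa using (Finset.card_le_card this).trans Finset.card_image_le

/-- At each position one of the two options of the recurrence attains the entry. This certifies
feasible entries without running a program; `traceBack` later makes the same choices. -/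
theorem IsTable.exists_isTrace (hg : IsTable m e (w ∘ o) (c ∘ o) B N g) (hL : Layout G H m o e)
    (h : IsTrace m o e w c B N g k₀ i k S) (hk₀ : k₀ ≤ N) :
    ∃ k S, IsTrace m o e w c B N g k₀ m k S := by
  classical
  induction hd : m - i using Nat.strong_induction_on generalizing i k S with
  | _ d ih =>
    subst hd
    rcases h.le.eq_or_lt with rfl | hi
    · exact ⟨k, S, h⟩
    have h1 := hL.lt i hi
    have hcost := h.cost
    have hkN : k ≤ N := by omega
    by_cases hc : c (o i) ≤ B ∧ c (o i) * N / B ≤ k ∧ g i k = g (e i) (k - c (o i) * N / B)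
    · exact ih _ (by omega) (h.remove hL hi hc.1 hc.2.1 hc.2.2) rfl
    · refine ih _ (by omega) (h.keep hi ?_) rfl
      rw [hg.step i hi k hkN] at hc ⊢
      simp only [Function.comp] at hc ⊢
      split_ifs at hc ⊢ with h2
      · rcases min_choice (w (o i) + g (i + 1) k) (g (e i) (k - c (o i) * N / B)) with h3 | h3
        · exact h3
        · exact absurd ⟨h2.1, h2.2, h3⟩ hc
      · rfl

/-- `H` has a separator whose vertices cost at most `B` each. -/
def HasSeparator (G : SimpleGraph V) (w c : V → ℕ) (H : Set V) (B : ℕ) : Prop :=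
  ∃ S : Finset V, (∀ v ∈ S, v ∈ H ∧ c v ≤ B) ∧ IsSeparator G w H S

theorem IsTable.hasSeparator (hg : IsTable m e (w ∘ o) (c ∘ o) B N g) (hL : Layout G H m o e)
    (hk₀ : k₀ ≤ N) (hk : 2 * g 0 k₀ ≤ weight w H)
    (hz : ∀ C ⊆ H, (G.induce C).Preconnected → o 0 ∉ C → 2 * weight w C ≤ weight w H) :
    HasSeparator G w c H B := by
  obtain ⟨k, S, h⟩ := hg.exists_isTrace hL IsTrace.nil hk₀
  exact ⟨S, fun v hv => ⟨h.subset hL v hv, (h.mem v hv).1⟩, h.isSeparator hL hk hz⟩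

/-- With precision `0` all rounded costs vanish and only the cap `B` on single costs remains. -/
theorem IsTable.le_of_hasSeparator (hg : IsTable m e (w ∘ o) (c ∘ o) B 0 g)
    (hL : Layout G H m o e) (h : HasSeparator G w c H B) : 2 * g 0 0 ≤ weight w H := by
  obtain ⟨S, h1, h2⟩ := h
  have := hg.le_of_isSeparator hL h2 (fun v hv => (h1 v hv).1) (fun v hv => (h1 v hv).2) (by simp)
  simpa using this

theorem sum_mul_div_mul_le (P : Finset V) (c : V → ℕ) (B N : ℕ) :
    (∑ v ∈ P, c v * N / B) * B ≤ (∑ v ∈ P, c v) * N := by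
  rw [Finset.sum_mul, Finset.sum_mul]
  exact Finset.sum_le_sum fun v _ => Nat.div_mul_le_self _ _

/-- Every separator of cost at most `B` is found by the dynamic program. -/
theorem IsTable.exists_le (hg : IsTable m e (w ∘ o) (c ∘ o) B N g) (hL : Layout G H m o e)
    {P : Finset V} (hP : IsSeparator G w H P) (hPH : ∀ v ∈ P, v ∈ H) (hPB : ∑ v ∈ P, c v ≤ B) :
    ∃ k ≤ N, 2 * g 0 k ≤ weight w H ∧ k * B ≤ (∑ v ∈ P, c v) * N := by
  have h1 : ∑ v ∈ P, c v * N / B ≤ N := by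
    -- For `B = 0` the quotients are zero by convention.
    rcases Nat.eq_zero_or_pos B with rfl | hB
    · simp
    · refine Nat.le_of_mul_le_mul_right ?_ hB
      refine (sum_mul_div_mul_le P c B N).trans ?_
      rw [mul_comm]
      exact Nat.mul_le_mul_left _ hPB
  exact ⟨_, h1, hg.le_of_isSeparator hL hP hPH (fun v hv => (Finset.single_le_sum
    (fun _ _ => Nat.zero_le _) hv).trans hPB) h1, sum_mul_div_mul_le P c B N⟩

/-- The rounding error. -/
theorem IsTrace.mul_le (h : IsTrace m o e w c B N g k₀ m k S) (hL : Layout G H m o e) {x : ℕ}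
    (hk₀ : k₀ * B ≤ x * N) (hB : B ≤ 2 * x) : (∑ v ∈ S, c v) * N ≤ x * (N + 2 * m) := by
  classical
  -- Rounding down loses at most `B / N` per vertex. If `B = 0`, all removed vertices are free.
  have h1 : (∑ v ∈ S, c v) * N ≤ ∑ v ∈ S, (c v * N / B + 1) * B := by
    rw [Finset.sum_mul]
    refine Finset.sum_le_sum fun v hv => ?_
    rcases Nat.eq_zero_or_pos B with rfl | hB
    · have := (h.mem v hv).1
      simp [Nat.le_zero.1 this]
    · have := Nat.lt_mul_div_succ (c v * N) hB
      rw [mul_comm B] at this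
      exact this.le
  have h2 : ∑ v ∈ S, (c v * N / B + 1) * B = (∑ v ∈ S, c v * N / B) * B + S.card * B := by
    rw [← Finset.sum_mul, Finset.sum_add_distrib, add_mul]
    simp
  have h3 := hL.card_le (h.subset hL)
  have h4 := Nat.mul_le_mul_right B h.cost
  have h5 := Nat.mul_le_mul h3 hB
  nlinarith

end Order

/-! ### A program logic -/

section ProgramLogic

infixr:60 " ;; " => Program.seq

/-- The degree of an expression as a polynomial in the numbers that it reads. -/
def Expr.deg : Expr → ℕ
  | lit _ => 1
  | reg _ => 1
  | get _ _ => 1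
  | add e f => max e.deg f.deg + 1
  | sub e _ => e.deg
  | mul e f => e.deg + f.deg
  | div e _ => e.deg

/-- All constants are at most `16` and all degrees at most `8`. -/
def Expr.ok : Expr → Bool
  | lit k => k ≤ 16
  | reg _ => true
  | get _ i => i.ok
  | add e f => e.ok && f.ok && (max e.deg f.deg + 1 ≤ 8 : Bool)
  | sub e f => e.ok && f.ok
  | mul e f => e.ok && f.ok && (e.deg + f.deg ≤ 8 : Bool)
  | div e f => e.ok && f.ok

/-- All numbers in the state are at most `b`. -/
structure Bdd (b : ℕ) (s : State) : Prop where
  sixteen_le : 16 ≤ b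
  reg : ∀ x, s.reg x ≤ b
  arr : ∀ a i, s.arr a i ≤ b

variable {b : ℕ} {s s' : State} {P P' : Program} {e : Expr} {Q Q' : ℕ → State → Prop}

theorem Bdd.lit (h : Bdd b s) {k : ℕ} (hk : k ≤ 16 := by norm_num) : k ≤ b :=
  hk.trans h.sixteen_le

theorem Expr.eval_le (h : Bdd b s) (e : Expr) (he : e.ok = true) : e.eval s ≤ b ^ e.deg := by
  have hb := h.sixteen_le
  induction e with
  | lit k =>
    simp only [ok, decide_eq_true_eq] at he
    simpa [eval, deg] using h.lit he
  | reg x => simpa [eval, deg] using h.reg x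
  | get a i => simpa [eval, deg] using h.arr a _
  | add e f he' hf' =>
    simp only [ok, Bool.and_eq_true, decide_eq_true_eq] at he
    have h1 := (he' he.1.1).trans (Nat.pow_le_pow_right (by omega) (le_max_left e.deg f.deg))
    have h2 := (hf' he.1.2).trans (Nat.pow_le_pow_right (by omega) (le_max_right e.deg f.deg))
    -- The sum of two numbers at most `b ^ d` is at most `b ^ (d + 1)` since `2 ≤ b`; hence the
    -- extra degree for sums.
    simp only [eval, deg, pow_succ]
    nlinarith
  | sub e f he' hf' =>
    simp only [ok, Bool.and_eq_true] at he
    exact (Nat.sub_le _ _).trans (he' he.1)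
  | mul e f he' hf' =>
    simp only [ok, Bool.and_eq_true, decide_eq_true_eq] at he
    simp only [eval, deg, pow_add]
    exact Nat.mul_le_mul (he' he.1.1) (hf' he.1.2)
  | div e f he' hf' =>
    simp only [ok, Bool.and_eq_true] at he
    exact (Nat.div_le_self _ _).trans (he' he.1)

/-- Since `Expr.ok` is a computable check on the syntax alone, the word-size condition for each
concrete expression is settled by `rfl`. -/
theorem Expr.fits (h : Bdd b s) (e : Expr) (he : e.ok = true) : e.Fits (b ^ 8) s := by
  have hb := h.sixteen_le
  have hb' : b ≤ b ^ 8 := Nat.le_self_pow (by norm_num) b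
  induction e with
  | lit k =>
    simp only [ok, decide_eq_true_eq] at he
    exact (h.lit he).trans hb'
  | reg x => exact (h.reg x).trans hb'
  | get a i ih => exact ⟨ih he, (h.arr _ _).trans hb'⟩
  | add e f he' hf' =>
    have h1 := eval_le h _ he
    simp only [ok, Bool.and_eq_true, decide_eq_true_eq] at he
    exact ⟨he' he.1.1, hf' he.1.2, h1.trans (Nat.pow_le_pow_right (by omega) he.2)⟩
  | sub e f he' hf' =>
    simp only [ok, Bool.and_eq_true] at he
    exact ⟨he' he.1, hf' he.2⟩
  | mul e f he' hf' =>
    have h1 := eval_le h _ he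
    simp only [ok, Bool.and_eq_true, decide_eq_true_eq] at he
    exact ⟨he' he.1.1, hf' he.1.2, h1.trans (Nat.pow_le_pow_right (by omega) he.2)⟩
  | div e f he' hf' =>
    simp only [ok, Bool.and_eq_true] at he
    exact ⟨he' he.1, hf' he.2⟩

theorem Bdd.setReg (h : Bdd b s) {v : ℕ} (hv : v ≤ b) (x : ℕ) : Bdd b (s.setReg x v) where
  sixteen_le := h.sixteen_le
  reg y := by
    simp only [State.setReg, Function.update_apply]
    split_ifs
    · exact hv
    · exact h.reg y
  arr := h.arr

theorem Bdd.setArr (h : Bdd b s) {v : ℕ} (hv : v ≤ b) (a i : ℕ) : Bdd b (s.setArr a i v) where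
  sixteen_le := h.sixteen_le
  reg := h.reg
  arr a' i' := by
    simp only [State.setArr, Function.update_apply]
    split_ifs
    · rw [Function.update_apply]
      split_ifs
      · exact hv
      · exact h.arr a i'
    · exact h.arr a' i'

/-! ### Frame conditions and weakest preconditions -/

/-- The program may write into register `x`. -/
def Program.writesReg (x : ℕ) : Program → Bool
  | skip => false
  | assign y _ => x == y
  | store _ _ _ => false
  | seq P Q => P.writesReg x || Q.writesReg x
  | cond _ P Q => P.writesReg x || Q.writesReg x
  | loop _ P => P.writesReg x

/-- The program may write into array `a`. -/
def Program.writesArr (a : ℕ) : Program → Bool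
  | skip => false
  | assign _ _ => false
  | store a' _ _ => a == a'
  | seq P Q => P.writesArr a || Q.writesArr a
  | cond _ P Q => P.writesArr a || Q.writesArr a
  | loop _ P => P.writesArr a

/-- The states agree on everything that `P` does not write. -/
structure Frame (P : Program) (s s' : State) : Prop where
  reg : ∀ x, P.writesReg x = false → s'.reg x = s.reg x
  arr : ∀ a, P.writesArr a = false → s'.arr a = s.arr a

theorem Frame.refl (P : Program) (s : State) : Frame P s s := ⟨fun _ _ => rfl, fun _ _ => rfl⟩

theorem Frame.trans {s₁ s₂ s₃ : State} (h : Frame P s₁ s₂) (h' : Frame P s₂ s₃) :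
    Frame P s₁ s₃ :=
  ⟨fun x hx => (h'.reg x hx).trans (h.reg x hx), fun a ha => (h'.arr a ha).trans (h.arr a ha)⟩

theorem Frame.mono (h : Frame P s s') (hr : ∀ x, P'.writesReg x = false → P.writesReg x = false)
    (ha : ∀ a, P'.writesArr a = false → P.writesArr a = false) : Frame P' s s' :=
  ⟨fun x hx => h.reg x (hr x hx), fun a h' => h.arr a (ha a h')⟩

/-- This lets specifications mention only what changes: that a given register or array is untouched
is decided by `rfl`. -/
theorem Runs.frame {B t : ℕ} (h : Runs B P s t s') : Frame P s s' := by
  induction h with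
  | skip s => exact .refl _ _
  | assign s x e he =>
    refine ⟨fun y hy => ?_, fun _ _ => rfl⟩
    simp only [Program.writesReg, beq_eq_false_iff_ne] at hy
    exact Function.update_of_ne hy _ _
  | store s a i e hi he =>
    refine ⟨fun _ _ => rfl, fun a' ha' => ?_⟩
    simp only [Program.writesArr, beq_eq_false_iff_ne] at ha'
    exact Function.update_of_ne ha' _ _
  | seq h₁ h₂ ih₁ ih₂ =>
    refine (ih₁.mono ?_ ?_).trans (ih₂.mono ?_ ?_) <;>
    simp +contextual [Program.writesReg, Program.writesArr]
  | condTrue hf he h ih =>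
    refine ih.mono ?_ ?_ <;> simp +contextual [Program.writesReg, Program.writesArr]
  | condFalse hf he h ih =>
    refine ih.mono ?_ ?_ <;> simp +contextual [Program.writesReg, Program.writesArr]
  | loopTrue hf he h₁ h₂ ih₁ ih₂ => exact Frame.trans ⟨ih₁.reg, ih₁.arr⟩ ih₂
  | loopFalse hf he => exact .refl _ _

/-- Started in `s`, the program `P` halts, and its running time and its final state satisfy `Q`,
where all stored numbers are at most `b` and all computed numbers are at most `b ^ 8`. -/
def wp (b : ℕ) (P : Program) (s : State) (Q : ℕ → State → Prop) : Prop :=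
  Bdd b s → ∃ t s', Runs (b ^ 8) P s t s' ∧ Bdd b s' ∧ Q t s'

theorem wp.mono (h : wp b P s Q) (h' : ∀ t s', Frame P s s' → Bdd b s' → Q t s' → Q' t s') :
    wp b P s Q' := fun hb => by
  obtain ⟨t, s', h1, h2, h3⟩ := h hb
  exact ⟨t, s', h1, h2, h' t s' h1.frame h2 h3⟩

theorem wp.of_bdd (h : Bdd b s → wp b P s Q) : wp b P s Q := fun hb => h hb hb

theorem wp.skip (h : Q 1 s) : wp b .skip s Q := fun hb => ⟨1, s, .skip s, hb, h⟩

theorem wp.assign {x : ℕ} (he : e.ok = true) (hv : Bdd b s → e.eval s ≤ b)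
    (h : Q (e.steps + 1) (s.setReg x (e.eval s))) : wp b (.assign x e) s Q := fun hb =>
  ⟨_, _, .assign s x e (e.fits hb he), hb.setReg (hv hb) x, h⟩

theorem wp.store {a : ℕ} {i : Expr} (hi : i.ok = true) (he : e.ok = true)
    (hv : Bdd b s → e.eval s ≤ b)
    (h : Q (i.steps + e.steps + 1) (s.setArr a (i.eval s) (e.eval s))) :
    wp b (.store a i e) s Q := fun hb =>
  ⟨_, _, .store s a i e (i.fits hb hi) (e.fits hb he), hb.setArr (hv hb) a _, h⟩

theorem wp.seq (h : wp b P s fun t s' => wp b P' s' fun t' s'' => Q (t + t') s'') :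
    wp b (P ;; P') s Q := fun hb => by
  obtain ⟨t, s', h1, h2, h3⟩ := h hb
  obtain ⟨t', s'', h4, h5, h6⟩ := h3 h2
  exact ⟨_, s'', .seq h1 h4, h5, h6⟩

theorem wp.cond (he : e.ok = true)
    (h₁ : e.eval s ≠ 0 → wp b P s fun t s' => Q (e.steps + 1 + t) s')
    (h₂ : e.eval s = 0 → wp b P' s fun t s' => Q (e.steps + 1 + t) s') :
    wp b (.cond e P P') s Q := fun hb => by
  by_cases h : e.eval s = 0
  · obtain ⟨t, s', h1, h2, h3⟩ := h₂ h hb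
    exact ⟨_, s', .condFalse (e.fits hb he) h h1, h2, h3⟩
  · obtain ⟨t, s', h1, h2, h3⟩ := h₁ h hb
    exact ⟨_, s', .condTrue (e.fits hb he) h h1, h2, h3⟩

/-- The rule for loops, with an invariant `I` that takes the time passed so far into account. -/
theorem wp.loop (I : ℕ → State → Prop) (μ : State → ℕ) (he : e.ok = true) (h₀ : I 0 s)
    (hstep : ∀ T s', Frame P s s' → Bdd b s' → I T s' → e.eval s' ≠ 0 →
      wp b P s' fun t s'' => I (T + (t + e.steps + 1)) s'' ∧ μ s'' < μ s')
    (hQ : ∀ T s', Frame P s s' → Bdd b s' → I T s' → e.eval s' = 0 → Q (T + (e.steps + 1)) s') :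
    wp b (.loop e P) s Q := fun hb => by
  have key : ∀ k T s', Frame P s s' → Bdd b s' → I T s' → μ s' = k →
      ∃ t s'', Runs (b ^ 8) (.loop e P) s' t s'' ∧ Bdd b s'' ∧ Q (T + t) s'' := by
    intro k
    induction k using Nat.strong_induction_on with
    | _ k ih =>
      intro T s' hF hB hI hk
      by_cases h : e.eval s' = 0
      · exact ⟨_, s', .loopFalse (e.fits hB he) h, hB, hQ T s' hF hB hI h⟩
      · obtain ⟨t, s'', h1, h2, h3, h4⟩ := hstep T s' hF hB hI h hB
        obtain ⟨t', s₃, h5, h6, h7⟩ := ih _ (hk ▸ h4) _ s'' (hF.trans h1.frame) h2 h3 rfl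
        refine ⟨_, s₃, .loopTrue (e.fits hB he) h h1 h5, h6, ?_⟩
        convert h7 using 1
        omega
  obtain ⟨t, s', h1, h2, h3⟩ := key _ 0 s (.refl _ _) hb h₀ rfl
  exact ⟨t, s', h1, h2, by simpa using h3⟩

/-- The loop that runs `P` with register `i` from `0` to the value of register `y` minus one. -/
def Program.forLoop (i y : ℕ) (P : Program) : Program :=
  .assign i (.lit 0) ;; .loop (.sub (.reg y) (.reg i)) (P ;; .assign i (.add (.reg i) (.lit 1)))

/-- The counter is set after each body, so the invariant is required for every value of the counter
register. An iteration adds `8` steps, four for the test and four for the increment; the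
initialization and the final test take `6`. -/
theorem wp.forLoop_time {i y : ℕ} (I : ℕ → ℕ → State → Prop) (hi : P.writesReg i = false)
    (hy : P.writesReg y = false) (hiy : y ≠ i)
    (h₀ : ∀ v, I 0 0 (s.setReg i v))
    (hstep : ∀ k < s.reg y, ∀ T s', Frame (.forLoop i y P) s s' → Bdd b s' → s'.reg i = k →
      I k T s' → wp b P s' fun t s'' => ∀ v, I (k + 1) (T + t + 8) (s''.setReg i v))
    (hQ : ∀ T s', Frame (.forLoop i y P) s s' → Bdd b s' →
      I (s.reg y) T s' → Q (T + 6) s') :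
    wp b (.forLoop i y P) s Q := by
  have hF : ∀ s', Frame (P ;; .assign i (.add (.reg i) (.lit 1))) (s.setReg i 0) s' →
      Frame (.forLoop i y P) s s' := by
    refine fun s' h => ⟨fun x hx => ?_, fun a ha => ?_⟩
    · simp only [Program.forLoop, Program.writesReg, Bool.or_eq_false_iff] at hx
      rw [h.reg x (by simp [Program.writesReg, hx])]
      exact Function.update_of_ne (by simpa using hx.1) _ _
    · simp only [Program.forLoop, Program.writesArr, Bool.or_eq_false_iff] at ha
      rw [h.arr a (by simp [Program.writesArr, ha])]
      rfl
  have hFy : ∀ s', Frame (P ;; .assign i (.add (.reg i) (.lit 1))) (s.setReg i 0) s' →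
      s'.reg y = s.reg y := by
    intro s' h
    rw [h.reg y (by simp [Program.writesReg, hy, hiy])]
    exact Function.update_of_ne hiy _ _
  refine wp.seq (wp.assign rfl (fun h => h.lit (k := 0)) ?_)
  refine wp.loop (fun T s' => ∃ k, k ≤ s.reg y ∧ s'.reg i = k ∧ I k T s')
    (fun s' => s.reg y - s'.reg i) rfl
    ⟨0, Nat.zero_le _, by simp [State.setReg, Expr.eval], h₀ 0⟩ ?_ ?_
  · rintro T s' hF' hB ⟨k, hk, hik, hI⟩ hne
    have hlt : k < s.reg y := by
      simp only [Expr.eval] at hne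
      have := hFy s' hF'
      omega
    refine wp.seq ((hstep k hlt T s' (hF s' hF') hB hik hI).mono fun t s'' hF'' hB'' h => ?_)
    have h1 : s''.reg i = k := by rw [hF''.reg i hi, hik]
    refine wp.assign rfl (fun h => ?_) ⟨⟨k + 1, hlt, ?_, ?_⟩, ?_⟩
    · simp only [Expr.eval, h1]
      have := hB.reg y
      rw [hFy s' hF'] at this
      omega
    · simp [State.setReg, Expr.eval, h1]
    · simp only [Expr.steps]
      exact h _
    · simp only [State.setReg, Expr.eval, h1, Function.update_self, hik]
      omega
  · rintro T s' hF' hB ⟨k, hk, hik, hI⟩ h0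
    have : k = s.reg y := by
      simp only [Expr.eval] at h0
      have := hFy s' hF'
      omega
    subst this
    have := hQ T s' (hF s' hF') hB hI
    simp only [Expr.steps]
    convert this using 1
    omega

/-- The rule for loops with a known number of iterations, each of which takes at most `c` steps. -/
theorem wp.forLoop {i y : ℕ} (c : ℕ) (I : ℕ → State → Prop) (hi : P.writesReg i = false)
    (hy : P.writesReg y = false) (hiy : y ≠ i)
    (h₀ : ∀ v, I 0 (s.setReg i v))
    (hstep : ∀ k < s.reg y, ∀ s', Frame (.forLoop i y P) s s' → Bdd b s' → s'.reg i = k →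
      I k s' → wp b P s' fun t s'' => t ≤ c ∧ ∀ v, I (k + 1) (s''.setReg i v))
    (hQ : ∀ t s', Frame (.forLoop i y P) s s' → Bdd b s' → t ≤ s.reg y * (c + 8) + 6 →
      I (s.reg y) s' → Q t s') :
    wp b (.forLoop i y P) s Q := by
  refine wp.forLoop_time (fun k T s' => T ≤ k * (c + 8) ∧ I k s') hi hy hiy
    (fun v => ⟨by simp, h₀ v⟩) ?_ ?_
  · rintro k hk T s' hF hB hik ⟨hT, hI⟩
    refine (hstep k hk s' hF hB hik hI).mono fun t s'' _ _ h v => ⟨?_, h.2 v⟩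
    have := h.1
    linarith
  · rintro T s' hF hB ⟨hT, hI⟩
    exact hQ _ s' hF hB (by omega) hI

end ProgramLogic

/-! ### The search routine -/

section SearchRoutine

variable {n : ℕ} {T : SimpleGraph (Fin n)} {R X : Set (Fin n)} {b : ℕ} {s : State}

theorem toArray_coe (f : Fin n → ℕ) (v : Fin n) : toArray f v = f v := by
  simp [toArray]

theorem adjArray_ne_zero (u v : Fin n) : adjArray T (n * u + v) ≠ 0 ↔ T.Adj u v := by
  classical
  have hn : 0 < n := u.pos
  rw [adjArray, ne_eq, ite_eq_right_iff, Classical.not_imp]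
  refine ⟨fun ⟨⟨u', v', h, he⟩, _⟩ => ?_, fun h => ⟨⟨u, v, h, rfl⟩, one_ne_zero⟩⟩
  have h1 : (u : ℕ) = u' := by
    have := congrArg (· / n) he
    simpa [Nat.mul_add_div hn, Nat.div_eq_of_lt v.2, Nat.div_eq_of_lt v'.2] using this
  have h2 : (v : ℕ) = v' := by
    rw [h1] at he
    omega
  rwa [Fin.ext h1, Fin.ext h2]

/-- Sets the first entries of array `a` to zero, as many as register `y` says. -/
def clear (a i y : ℕ) : Program := .forLoop i y (.store a (.reg i) (.lit 0))

theorem clear_spec {a i y : ℕ} (hiy : y ≠ i) :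
    wp b (clear a i y) s fun t s' => t ≤ s.reg y * 11 + 6 ∧ ∀ v < s.reg y, s'.arr a v = 0 := by
  refine wp.forLoop 3 (fun k s' => ∀ v < k, s'.arr a v = 0) rfl rfl hiy (by simp) ?_ ?_
  · intro k hk s' hF hB hi hI
    refine wp.store rfl rfl (fun h => h.lit (k := 0)) ⟨le_rfl, fun v x hx => ?_⟩
    simp only [State.setArr, State.setReg, Expr.eval, hi, Function.update_self]
    rw [Function.update_apply]
    split_ifs with h
    · rfl
    · exact hI x (by omega)
  · intro t s' hF hB ht hI
    exact ⟨ht, hI⟩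

/-!
The registers `0`, `1` and `2` hold `n`, `p` and `q`. The search starts in the vertex in register `5`.
Array `4` marks the vertices that are removed, array `5` those that are visited. The visited
vertices are listed in array `6`, their number is in register `6`, and the positions of their parents
are in array `7`.
-/

/-- Register `11` becomes an unvisited neighbor of the vertex at position `reg 9`, or `n`. -/
def findNeighbor : Program :=
  .assign 11 (.reg 0) ;;
  .forLoop 10 0
    (.cond (.mul (.mul (.get 2 (.add (.mul (.reg 0) (.get 6 (.reg 9))) (.reg 10)))
        (.sub (.lit 1) (.get 4 (.reg 10)))) (.sub (.lit 1) (.get 5 (.reg 10))))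
      (.assign 11 (.reg 10)) .skip)

/-- Appends the vertex in register `7` to the list, with the parent in register `8`. -/
def visit : Program :=
  .store 6 (.reg 6) (.reg 7) ;; .store 7 (.reg 6) (.reg 8) ;; .store 5 (.reg 7) (.lit 1) ;;
  .assign 6 (.add (.reg 6) (.lit 1))

/-- Finds the last position with an unvisited neighbor (register `8`) and the neighbor
(register `7`, which becomes `n` if there is none). -/
def findNext : Program :=
  .assign 7 (.reg 0) ;;
  .forLoop 9 6 (findNeighbor ;;
    .cond (.sub (.reg 0) (.reg 11)) (.assign 7 (.reg 11) ;; .assign 8 (.reg 9)) .skip)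

/-- Depth-first search. -/
def search : Program :=
  clear 5 10 0 ;; .assign 6 (.lit 0) ;; .assign 7 (.reg 5) ;; .assign 8 (.lit 0) ;;
  .loop (.sub (.reg 0) (.reg 7)) (visit ;; findNext)

/-- The number `n`, the adjacency matrix and the set `R` of the vertices that are not removed. -/
structure Env (T : SimpleGraph (Fin n)) (R : Set (Fin n)) (s : State) : Prop where
  size : s.reg 0 = n
  adj : s.arr 2 = adjArray T
  alive : ∀ v : Fin n, s.arr 4 v = 0 ↔ v ∈ R

theorem Env.frame {P : Program} {s' : State} (h : Env T R s) (hF : Frame P s s')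
    (h0 : P.writesReg 0 = false) (h2 : P.writesArr 2 = false) (h4 : P.writesArr 4 = false) :
    Env T R s' where
  size := (hF.reg 0 h0).trans h.size
  adj := (hF.arr 2 h2).trans h.adj
  alive := by rw [hF.arr 4 h4]; exact h.alive

theorem findNeighbor_spec (hE : Env T R s) {u : Fin n} (hu : s.arr 6 (s.reg 9) = u)
    (hX : ∀ v : Fin n, s.arr 5 v = 0 ↔ v ∉ X) :
    wp b findNeighbor s fun t s' => t ≤ 32 * n + 8 ∧
      ((s'.reg 11 = n ∧ ∀ v ∈ R, T.Adj u v → v ∈ X) ∨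
        ∃ v : Fin n, s'.reg 11 = v ∧ v ∈ R ∧ v ∉ X ∧ T.Adj u v) := by
  refine wp.seq (wp.assign rfl (fun h => h.reg 0) ?_)
  refine wp.forLoop 24 (fun k s' =>
      (s'.reg 11 = n ∧ ∀ v ∈ R, (v : ℕ) < k → T.Adj u v → v ∈ X) ∨
        ∃ v : Fin n, s'.reg 11 = v ∧ v ∈ R ∧ v ∉ X ∧ T.Adj u v) rfl rfl (by decide)
    (fun v => Or.inl ⟨hE.size, by simp⟩) ?_ ?_
  · intro k hk s' hF hB hk' hI
    have hkn : k < n := by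
      have := hE.size
      exact lt_of_lt_of_eq hk this
    -- In these programs a product of tests is a conjunction, and truncated `1 - x` is the negation
    -- of `x`.
    have hg : (Expr.mul (.mul (.get 2 (.add (.mul (.reg 0) (.get 6 (.reg 9))) (.reg 10)))
        (.sub (.lit 1) (.get 4 (.reg 10)))) (.sub (.lit 1) (.get 5 (.reg 10)))).eval s' ≠ 0 ↔
        T.Adj u ⟨k, hkn⟩ ∧ ⟨k, hkn⟩ ∈ R ∧ ⟨k, hkn⟩ ∉ X := by
      have h0 : s'.reg 0 = n := (hF.reg 0 rfl).trans hE.size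
      have h2 : s'.arr 2 = adjArray T := (hF.arr 2 rfl).trans hE.adj
      have h6 : s'.arr 6 (s'.reg 9) = u := by
        rw [hF.arr 6 rfl, hF.reg 9 rfl]
        exact hu
      have h4 := hE.alive ⟨k, hkn⟩
      have h5 := hX ⟨k, hkn⟩
      have ha := adjArray_ne_zero (T := T) u ⟨k, hkn⟩
      rw [← ha, ← h4, ← h5]
      simp only [Expr.eval, h0, h2, h6, hk', hF.arr 4 rfl, hF.arr 5 rfl, State.setReg]
      simp only [ne_eq, mul_eq_zero, not_or, and_assoc]
      refine and_congr_right fun _ => and_congr ?_ ?_ <;> omega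
    refine wp.cond rfl (fun h => ?_) (fun h => ?_)
    · refine wp.assign rfl (fun h => h.reg 10) ⟨by decide, fun v => Or.inr ⟨⟨k, hkn⟩, ?_, ?_⟩⟩
      · exact hk'
      · exact ⟨(hg.1 h).2.1, (hg.1 h).2.2, (hg.1 h).1⟩
    · refine wp.skip ⟨by decide, fun v => ?_⟩
      rcases hI with ⟨h1, h2⟩ | h1
      · refine Or.inl ⟨h1, fun v hv hvk hadj => ?_⟩
        rcases Nat.lt_succ_iff_lt_or_eq.1 hvk with h3 | h3
        · exact h2 v hv h3 hadj
        · obtain rfl : v = ⟨k, hkn⟩ := Fin.ext h3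
          by_contra hX'
          exact hg.2 ⟨hadj, hv, hX'⟩ h
      · exact Or.inr h1
  · intro t s' hF hB ht hI
    have : (s.setReg 11 ((Expr.reg 0).eval s)).reg 0 = n := hE.size
    rw [this] at ht hI
    refine ⟨?_, ?_⟩
    · simp only [Expr.steps]
      omega
    · rcases hI with ⟨h1, h2⟩ | h1
      · exact Or.inl ⟨h1, fun v hv => h2 v hv v.2⟩
      · exact Or.inr h1

/-- Later finds overwrite earlier ones, so the last position with an unvisited neighbor survives, as
the field `DFSOrder.last` demands. -/
theorem findNext_spec (hE : Env T R s) {o : ℕ → Fin n} (ho : ∀ i < s.reg 6, s.arr 6 i = o i)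
    (hX : ∀ v : Fin n, s.arr 5 v = 0 ↔ v ∉ X) :
    wp b findNext s fun t s' => t ≤ s.reg 6 * (32 * n + 30) + 8 ∧
      ((s'.reg 7 = n ∧ ∀ i < s.reg 6, ∀ v ∈ R, T.Adj (o i) v → v ∈ X) ∨
        ∃ v : Fin n, s'.reg 7 = v ∧ v ∈ R ∧ v ∉ X ∧ s'.reg 8 < s.reg 6 ∧
          T.Adj (o (s'.reg 8)) v ∧
          ∀ i, s'.reg 8 < i → i < s.reg 6 → ∀ v ∈ R, T.Adj (o i) v → v ∈ X) := by
  refine wp.seq (wp.assign rfl (fun h => h.reg 0) ?_)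
  refine wp.forLoop (32 * n + 22) (fun k s' =>
      (s'.reg 7 = n ∧ ∀ i < k, ∀ v ∈ R, T.Adj (o i) v → v ∈ X) ∨
        ∃ v : Fin n, s'.reg 7 = v ∧ v ∈ R ∧ v ∉ X ∧ s'.reg 8 < k ∧
          T.Adj (o (s'.reg 8)) v ∧
          ∀ i, s'.reg 8 < i → i < k → ∀ v ∈ R, T.Adj (o i) v → v ∈ X) rfl rfl (by decide)
    (fun v => Or.inl ⟨hE.size, by simp⟩) ?_ ?_
  · intro k hk s' hF hB hk' hI
    have hk6 : k < s.reg 6 := hk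
    have hE' : Env T R s' :=
      Env.frame (s := s.setReg 7 ((Expr.reg 0).eval s)) ⟨hE.size, hE.adj, hE.alive⟩ hF rfl rfl rfl
    refine wp.seq ((findNeighbor_spec hE' (u := o k) (X := X) ?_ ?_).mono
      fun t s₁ hF₁ hB₁ ⟨ht, h⟩ => ?_)
    · rw [hk', hF.arr 6 rfl]
      exact ho k hk6
    · rw [hF.arr 5 rfl]
      exact hX
    have h0 : s₁.reg 0 = n := (hE'.frame hF₁ rfl rfl rfl).size
    have h7 : s₁.reg 7 = s'.reg 7 := hF₁.reg 7 rfl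
    have h8 : s₁.reg 8 = s'.reg 8 := hF₁.reg 8 rfl
    have h9 : s₁.reg 9 = k := (hF₁.reg 9 rfl).trans hk'
    refine wp.cond rfl (fun h' => ?_) (fun h' => ?_)
    · refine wp.seq (wp.assign rfl (fun h => h.reg 11) (wp.assign rfl (fun h => h.reg 9) ⟨?_, ?_⟩))
      · simp only [Expr.steps]
        omega
      · intro _
        refine Or.inr ?_
        rcases h with ⟨h, -⟩ | ⟨v, h, hv, hvX, hadj⟩
        · simp only [Expr.eval] at h'
          omega
        · refine ⟨v, h, hv, hvX, ?_⟩
          have : ((s₁.setReg 7 ((Expr.reg 11).eval s₁)).setReg 8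
              ((Expr.reg 9).eval (s₁.setReg 7 ((Expr.reg 11).eval s₁)))).reg 8 = k := h9
          simp only [State.setReg, Expr.eval, Function.update_apply] at this ⊢
          simp only [h9]
          refine ⟨by simp, by simpa using hadj, fun i h1 h2 => ?_⟩
          simp at h1
          omega
    · refine wp.skip ⟨?_, ?_⟩
      · simp only [Expr.steps]
        omega
      · intro _
        simp only [State.setReg, Function.update_apply]
        simp only [Nat.reduceEqDiff, if_false, h7, h8]
        rcases h with ⟨-, h⟩ | ⟨v, h, -⟩
        · rcases hI with ⟨h1, h2⟩ | ⟨v, h1, h2, h3, h4, h5, h6⟩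
          · refine Or.inl ⟨h1, fun i hi => ?_⟩
            rcases Nat.lt_succ_iff_lt_or_eq.1 hi with hi | rfl
            · exact h2 i hi
            · exact h
          · refine Or.inr ⟨v, h1, h2, h3, by omega, h5, fun i hi hik => ?_⟩
            rcases Nat.lt_succ_iff_lt_or_eq.1 hik with hik | rfl
            · exact h6 i hi hik
            · exact h
        · simp only [Expr.eval] at h'
          omega
  · intro t s' hF hB ht hI
    refine ⟨?_, hI⟩
    have h1 : (s.setReg 7 ((Expr.reg 0).eval s)).reg 6 = s.reg 6 := rfl
    rw [h1] at ht
    simp only [Expr.steps]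
    linarith

theorem DFSOrder.card_le {V : Type*} [Fintype V] {G : SimpleGraph V} {R : Set V} {z : V} {m : ℕ}
    {o : ℕ → V} {π : ℕ → ℕ} (h : DFSOrder G R z m o π) : m ≤ Fintype.card V := by
  have := Fintype.card_le_of_injective (fun i : Fin m => o i) fun i j hij =>
    Fin.ext (h.inj i i.2 j j.2 hij)
  simpa using this

/-- The result of a depth-first search for the component of `z`. -/
structure Searched (T : SimpleGraph (Fin n)) (R : Set (Fin n)) (z : Fin n) (o : ℕ → Fin n)
    (s : State) : Prop where
  list : ∀ i < s.reg 6, s.arr 6 i = o i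
  pos : 0 < s.reg 6
  le : s.reg 6 ≤ n
  order : DFSOrder T R z (s.reg 6) o (s.arr 7)
  closed : ∀ i < s.reg 6, ∀ v ∈ R, T.Adj (o i) v → ∃ l < s.reg 6, o l = v

/-- Each of at most `n` iterations lists a new vertex and scans the rows of all listed vertices,
which takes O(n²). -/
theorem search_spec (hE : Env T R s) {z : Fin n} (hz : s.reg 5 = z) (hzR : z ∈ R) :
    wp b search s fun t s' => t ≤ 150 * n ^ 3 ∧ ∃ o, Searched T R z o s' := by
  have hn : 0 < n := z.pos
  refine wp.seq (clear_spec (by decide) |>.mono fun t₀ s₀ hF₀ hB₀ ⟨ht₀, hX₀⟩ => ?_)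
  have hE₀ := hE.frame hF₀ rfl rfl rfl
  have hz₀ : s₀.reg 5 = z := (hF₀.reg 5 rfl).trans hz
  rw [hE.size] at ht₀ hX₀
  refine wp.seq (wp.assign rfl (fun h => h.lit (k := 0)) ?_)
  refine wp.seq (wp.assign rfl (fun h => h.reg 5) ?_)
  refine wp.seq (wp.assign rfl (fun h => h.lit (k := 0)) ?_)
  -- The value `n` in register `7` signals that the list is closed. Otherwise registers `7` and `8`
  -- hold the next vertex and the position of its parent, which is a dummy for the very first
  -- vertex.
  refine wp.loop (fun τ s' => τ ≤ s'.reg 6 * (32 * n ^ 2 + 30 * n + 50) ∧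
      ∃ o : ℕ → Fin n, DFSOrder T R z (s'.reg 6) o (s'.arr 7) ∧
      (∀ i < s'.reg 6, s'.arr 6 i = o i) ∧
      (∀ v : Fin n, s'.arr 5 v = 0 ↔ v ∉ {v | ∃ l < s'.reg 6, o l = v}) ∧
      ((s'.reg 7 = n ∧ 0 < s'.reg 6 ∧
          ∀ i < s'.reg 6, ∀ v ∈ R, T.Adj (o i) v → ∃ l < s'.reg 6, o l = v) ∨
        ∃ u : Fin n, s'.reg 7 = u ∧ u ∈ R ∧ (s'.reg 6 = 0 → u = z) ∧
          (∀ l < s'.reg 6, o l ≠ u) ∧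
          (0 < s'.reg 6 → s'.reg 8 < s'.reg 6 ∧ T.Adj (o (s'.reg 8)) u) ∧
          ∀ i, s'.reg 8 < i → i < s'.reg 6 → ∀ v ∈ R, T.Adj (o i) v →
            ∃ l < s'.reg 6, o l = v))
    (fun s' => n - s'.reg 6) rfl ?_ ?_ ?_
  · refine ⟨Nat.zero_le _, fun _ => z, ?_, ?_, ?_, ?_⟩
    · exact .nil
    · exact fun i hi => absurd hi (Nat.not_lt_zero _)
    · intro v
      have h1 : ¬ ∃ l < 0, z = v := by simp
      exact ⟨fun _ => h1, fun _ => hX₀ v v.2⟩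
    · refine Or.inr ⟨z, hz₀, hzR, fun _ => rfl, ?_, ?_, ?_⟩
      · exact fun i hi => absurd hi (Nat.not_lt_zero _)
      · exact fun hi => absurd hi (Nat.not_lt_zero _)
      · exact fun i _ hi => absurd hi (Nat.not_lt_zero _)
  · rintro τ s₁ hF₁ hB₁ ⟨hτ, o, hord, hlist, hX, hnext⟩ hne
    have hE₁ : Env T R s₁ := Env.frame (s := (((s₀.setReg 6 _).setReg 7 _).setReg 8 _))
      ⟨hE₀.size, hE₀.adj, hE₀.alive⟩ hF₁ rfl rfl rfl
    have h7 : s₁.reg 7 ≠ n := by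
      simp only [Expr.eval, hE₁.size] at hne
      omega
    obtain ⟨u, hu, huR, huz, hnew, hpar, hlast⟩ := hnext.resolve_left fun h => h7 h.1
    set m := s₁.reg 6 with hm
    -- Appending before the store is executed shows that there is room for one more vertex, which
    -- bounds both the counter and the number of iterations.
    have hord' := hord.snoc huR huz hnew hpar hlast
    have hmn : m + 1 ≤ n := by simpa using hord'.card_le
    refine wp.seq (wp.seq (wp.store rfl rfl (fun h => h.reg 7) ?_))
    refine wp.seq (wp.store rfl rfl (fun h => h.reg 8) ?_)
    refine wp.seq (wp.store rfl rfl (fun h => h.lit (k := 1)) ?_)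
    refine wp.assign rfl (fun _ => ?_) ?_
    · show m + 1 ≤ b
      have := hB₁.reg 0
      rw [hE₁.size] at this
      omega
    set s₂ : State := ((((s₁.setArr 6 m (s₁.reg 7)).setArr 7 m (s₁.reg 8)).setArr 5 (s₁.reg 7)
      1).setReg 6 (m + 1)) with hs₂
    change wp b findNext s₂ _
    have hE₂ : Env T R s₂ := ⟨hE₁.size, hE₁.adj, hE₁.alive⟩
    have h26 : s₂.reg 6 = m + 1 := rfl
    have hlist₂ : ∀ i < s₂.reg 6, s₂.arr 6 i = Function.update o m u i := by
      intro i hi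
      have h1 : s₂.arr 6 i = Function.update (s₁.arr 6) m (s₁.reg 7) i := rfl
      rw [h1, hu, Function.update_apply, Function.update_apply]
      split_ifs with h2
      · rfl
      · exact hlist i (by omega)
    have hX₂ : ∀ v : Fin n, s₂.arr 5 v = 0 ↔
        v ∉ {v | ∃ l < m + 1, Function.update o m u l = v} := by
      intro v
      have h1 : s₂.arr 5 v = Function.update (s₁.arr 5) (s₁.reg 7) 1 v := rfl
      rw [h1, hu, Function.update_apply]
      split_ifs with h2
      · simp only [false_iff, not_not]
        exact ⟨m, Nat.lt_succ_self m, by simpa using (Fin.ext h2).symm⟩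
      · rw [hX v, not_iff_not]
        constructor
        · rintro ⟨l, hl, rfl⟩
          exact ⟨l, by omega, Function.update_of_ne (by omega) _ _⟩
        · rintro ⟨l, hl, rfl⟩
          rcases Nat.lt_succ_iff_lt_or_eq.1 hl with hl | rfl
          · exact ⟨l, hl, (Function.update_of_ne (by omega) _ _).symm⟩
          · simp at h2
    refine (findNext_spec hE₂ hlist₂ hX₂).mono fun t s₃ hF₃ hB₃ ⟨ht, h⟩ => ?_
    have h36 : s₃.reg 6 = m + 1 := hF₃.reg 6 rfl
    have h37 : s₃.arr 7 = Function.update (s₁.arr 7) m (s₁.reg 8) := hF₃.arr 7 rfl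
    simp only [h26] at h ht
    rw [h36, h37, hF₃.arr 6 rfl, hF₃.arr 5 rfl]
    refine ⟨⟨?_, _, hord', fun i hi => hlist₂ i hi, hX₂, ?_⟩, by omega⟩
    · simp only [Expr.steps]
      have h2 : (m + 1) * (32 * n + 30) ≤ n * (32 * n + 30) := Nat.mul_le_mul_right _ hmn
      nlinarith
    · rcases h with ⟨h1, h2⟩ | ⟨v, h1, h2, h3, h4, h5, h6⟩
      · exact Or.inl ⟨h1, by omega, h2⟩
      · refine Or.inr ⟨v, h1, h2, fun h => by omega, fun l hl hlv => h3 ⟨l, hl, hlv⟩,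
          fun _ => ⟨h4, h5⟩, h6⟩
  · rintro τ s₁ hF₁ hB₁ ⟨hτ, o, hord, hlist, hX, hnext⟩ hne
    have hE₁ : Env T R s₁ := Env.frame (s := (((s₀.setReg 6 _).setReg 7 _).setReg 8 _))
      ⟨hE₀.size, hE₀.adj, hE₀.alive⟩ hF₁ rfl rfl rfl
    have hmn : s₁.reg 6 ≤ n := by simpa using hord.card_le
    rcases hnext with ⟨h1, h2, h3⟩ | ⟨u, hu, -⟩
    · refine ⟨?_, o, ⟨hlist, h2, hmn, hord, h3⟩⟩
      simp only [Expr.steps]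
      have h4 := Nat.mul_le_mul_right (32 * n ^ 2 + 30 * n + 50) hmn
      have h5 : 1 ≤ n := hn
      nlinarith [Nat.mul_le_mul h5 h5, Nat.mul_le_mul (Nat.mul_le_mul h5 h5) (le_refl n),
        Nat.mul_le_mul h5 (le_refl n)]
    · simp only [Expr.eval, hE₁.size, hu] at hne
      omega

end SearchRoutine

/-! ### The centroid -/

section Centroid

variable {n : ℕ} {T : SimpleGraph (Fin n)} {R H : Set (Fin n)} {b : ℕ} {s : State}
  {o : ℕ → Fin n} {w : Fin n → ℕ}

/-- Array `8` becomes the list of the ends of the blocks of descendants. -/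
def findEnds : Program :=
  .forLoop 13 6
    (.assign 15 (.add (.reg 13) (.lit 1)) ;;
    .forLoop 14 6
      (.cond (.mul (.sub (.lit 1) (.add (.sub (.reg 14) (.reg 15)) (.sub (.reg 15) (.reg 14))))
          (.sub (.add (.get 7 (.reg 14)) (.lit 1)) (.reg 13)))
        (.assign 15 (.add (.reg 14) (.lit 1))) .skip) ;;
    .store 8 (.reg 13) (.reg 15))

/-- Register `15` moves from `j` to `j + 1` only if the parent of `j` does not precede the current
position, so it stops for good at the first violation. -/
theorem findEnds_spec :
    wp b findEnds s fun t s' => t ≤ s.reg 6 * (30 * s.reg 6 + 30) + 6 ∧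
      ∀ i < s.reg 6, i < s'.arr 8 i ∧ s'.arr 8 i ≤ s.reg 6 ∧
        (∀ l, i < l → l < s'.arr 8 i → i ≤ s.arr 7 l) ∧
        (s'.arr 8 i < s.reg 6 → s.arr 7 (s'.arr 8 i) < i) := by
  set m := s.reg 6 with hm
  refine wp.forLoop (30 * m + 22) (fun k s' => ∀ i < k, i < s'.arr 8 i ∧ s'.arr 8 i ≤ m ∧
        (∀ l, i < l → l < s'.arr 8 i → i ≤ s.arr 7 l) ∧
        (s'.arr 8 i < m → s.arr 7 (s'.arr 8 i) < i)) rfl rfl (by decide) (by simp) ?_ ?_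
  · intro k hk s₁ hF₁ hB₁ hk₁ hI
    have h6 : s₁.reg 6 = m := hF₁.reg 6 rfl
    have h7 : s₁.arr 7 = s.arr 7 := hF₁.arr 7 rfl
    refine wp.seq (wp.assign rfl (fun _ => ?_) ?_)
    · have := hB₁.reg 6
      simp only [Expr.eval, hk₁]
      omega
    refine wp.seq ?_
    refine wp.forLoop 22 (fun j s' => k < s'.reg 15 ∧ s'.reg 15 ≤ max j (k + 1) ∧
        (∀ l, k < l → l < s'.reg 15 → k ≤ s.arr 7 l) ∧
        (s'.reg 15 < j → s.arr 7 (s'.reg 15) < k)) rfl rfl (by decide) ?_ ?_ ?_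
    · intro v
      have h : ((s₁.setReg 15 ((Expr.add (.reg 13) (.lit 1)).eval s₁)).setReg 14 v).reg 15
          = k + 1 := by
        simp [State.setReg, Expr.eval, hk₁]
      rw [h]
      exact ⟨by omega, by simp, fun l _ _ => by omega, by simp⟩
    · intro j hj s₂ hF₂ hB₂ hj₂ ⟨h1, h2, h3, h4⟩
      have hjm : j < m := by
        rw [← h6]
        exact hj
      have h13 : s₂.reg 13 = k := (hF₂.reg 13 rfl).trans hk₁
      have h7' : s₂.arr 7 = s.arr 7 := (hF₂.arr 7 rfl).trans h7
      refine wp.cond rfl (fun h => ?_) (fun h => ?_)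
      · refine wp.assign rfl (fun _ => ?_) ⟨by decide, fun v => ?_⟩
        · have h5 := hB₂.reg 6
          rw [hF₂.reg 6 rfl] at h5
          have h5' : m ≤ b := by
            rw [← h6]
            exact h5
          simp only [Expr.eval, hj₂]
          omega
        · have h15 : ((s₂.setReg 15 ((Expr.add (.reg 14) (.lit 1)).eval s₂)).setReg 14 v).reg 15
              = j + 1 := by
            simp [State.setReg, Expr.eval, hj₂]
          rw [h15]
          simp only [Expr.eval, hj₂, h13, h7', ne_eq, mul_eq_zero, not_or] at h
          refine ⟨by omega, by omega, fun l hl hl' => ?_, fun h => absurd h (lt_irrefl _)⟩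
          rcases Nat.lt_succ_iff_lt_or_eq.1 hl' with h5 | rfl
          · exact h3 l hl (by omega)
          · omega
      · refine wp.skip ⟨by decide, fun v => ?_⟩
        have h15 : (s₂.setReg 14 v).reg 15 = s₂.reg 15 := rfl
        rw [h15]
        simp only [Expr.eval, hj₂, h13, h7', mul_eq_zero] at h
        refine ⟨h1, by omega, h3, fun h5 => ?_⟩
        by_cases h6 : s₂.reg 15 = j
        · rw [h6]
          omega
        · exact h4 (by omega)
    · intro t s₂ hF₂ hB₂ ht ⟨h1, h2, h3, h4⟩
      have h13 : s₂.reg 13 = k := (hF₂.reg 13 rfl).trans hk₁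
      have h6' : (s₁.setReg 15 ((Expr.add (.reg 13) (.lit 1)).eval s₁)).reg 6 = m := h6
      have h8 : s₂.arr 8 = s₁.arr 8 := hF₂.arr 8 rfl
      rw [h6'] at ht h2 h4
      refine wp.store rfl rfl (fun h => h.reg 15) ⟨?_, fun v i hi => ?_⟩
      · simp only [Expr.steps]
        omega
      · have h9 : ((s₂.setArr 8 ((Expr.reg 13).eval s₂) ((Expr.reg 15).eval s₂)).setReg 13 v).arr 8
            = Function.update (s₁.arr 8) k (s₂.reg 15) := by
          simp [State.setReg, State.setArr, Expr.eval, h13, h8]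
        rw [h9, Function.update_apply]
        split_ifs with h10
        · subst h10
          exact ⟨h1, by omega, h3, h4⟩
        · exact hI i (by omega)
  · intro t s' hF hB ht hI
    exact ⟨by simpa [add_assoc] using ht, hI⟩

/-- Explores the component of the vertex in register `5`. -/
def explore : Program := search ;; findEnds

/-- The list of the vertices of the component `H` in depth-first order and the ends of the blocks of
descendants have been computed. -/
structure Explored (T : SimpleGraph (Fin n)) (H : Set (Fin n)) (o : ℕ → Fin n) (s : State) :
    Prop where
  list : ∀ i < s.reg 6, s.arr 6 i = o i
  le : s.reg 6 ≤ n
  layout : Layout T H (s.reg 6) o (s.arr 8)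

theorem Explored.frame {P : Program} {s' : State} (h : Explored T H o s) (hF : Frame P s s')
    (h6 : P.writesReg 6 = false) (h6' : P.writesArr 6 = false) (h8 : P.writesArr 8 = false) :
    Explored T H o s' := by
  have h1 := hF.reg 6 h6
  have h2 := hF.arr 6 h6'
  have h3 := hF.arr 8 h8
  constructor
  · rw [h1, h2]
    exact h.list
  · rw [h1]
    exact h.le
  · rw [h1, h3]
    exact h.layout

theorem explore_spec (hT : T.IsAcyclic) (hE : Env T R s) {z : Fin n} (hz : s.reg 5 = z)
    (hzR : z ∈ R) :
    wp b explore s fun t s' => t ≤ 216 * n ^ 3 ∧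
      ∃ o, o 0 = z ∧ Explored T (component T R z) o s' := by
  have hn : 1 ≤ n := z.pos
  refine wp.seq ((search_spec hE hz hzR).mono fun t s₁ hF₁ hB₁ ⟨ht, o, h⟩ => ?_)
  refine findEnds_spec.mono fun t' s₂ hF₂ hB₂ ⟨ht', h'⟩ => ⟨?_, o, h.order.zero h.pos, ?_⟩
  · have h1 : s₁.reg 6 * (30 * s₁.reg 6 + 30) ≤ n * (30 * n + 30) :=
      Nat.mul_le_mul h.le (by have := h.le; omega)
    have h2 : n ≤ n ^ 3 := Nat.le_self_pow (by norm_num) n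
    have h3 : n ^ 2 ≤ n ^ 3 := Nat.pow_le_pow_right hn (by norm_num)
    nlinarith
  · constructor
    · rw [hF₂.reg 6 rfl, hF₂.arr 6 rfl]
      exact h.list
    · rw [hF₂.reg 6 rfl]
      exact h.le
    · rw [hF₂.reg 6 rfl]
      exact h.order.layout hT h.pos h.closed h'

theorem Layout.sum_le {V : Type*} [Fintype V] {G : SimpleGraph V} {H : Set V} {m : ℕ} {o : ℕ → V}
    {e : ℕ → ℕ} (h : Layout G H m o e) (w : V → ℕ) {J : Finset ℕ} (hJ : ∀ l ∈ J, l < m) :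
    ∑ l ∈ J, w (o l) ≤ weight w H := by
  rw [h.weight_eq]
  exact Finset.sum_le_sum_of_subset fun l hl => Finset.mem_range.2 (hJ l hl)

theorem weight_le_univ {V : Type*} [Fintype V] (w : V → ℕ) (C : Set V) :
    weight w C ≤ ∑ v, w v := by
  classical
  exact Finset.sum_le_sum_of_subset (Finset.subset_univ _)

/-- Register `12` becomes the weight of the component. -/
def sumWeight : Program :=
  .assign 12 (.lit 0) ;;
  .forLoop 14 6 (.assign 12 (.add (.reg 12) (.get 1 (.get 6 (.reg 14)))))

theorem sumWeight_spec (hX : Explored T H o s) (hw : s.arr 1 = toArray w) (hwb : ∑ v, w v ≤ b) :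
    wp b sumWeight s fun t s' => t ≤ 14 * n + 8 ∧ s'.reg 12 = weight w H := by
  refine wp.seq (wp.assign rfl (fun h => h.lit (k := 0)) ?_)
  refine wp.forLoop 6 (fun k s' => s'.reg 12 = ∑ l ∈ Finset.range k, w (o l)) rfl rfl
    (by decide) (fun _ => rfl) ?_ ?_
  · intro k hk s' hF hB hk' hI
    have hk6 : k < s.reg 6 := hk
    have hv : (Expr.add (.reg 12) (.get 1 (.get 6 (.reg 14)))).eval s'
        = ∑ l ∈ Finset.range (k + 1), w (o l) := by
      have h1 : s'.arr 1 = toArray w := (hF.arr 1 rfl).trans hw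
      have h6 : s'.arr 6 k = o k := by
        rw [hF.arr 6 rfl]
        exact hX.list k hk6
      rw [Finset.sum_range_succ]
      simp only [Expr.eval, hI, hk', h1, h6, toArray_coe]
    refine wp.assign rfl (fun _ => ?_) ⟨by decide, fun _ => ?_⟩
    · rw [hv]
      refine (hX.layout.sum_le w fun l hl => ?_).trans ((weight_le_univ w H).trans hwb)
      have := Finset.mem_range.1 hl
      omega
    · simpa [State.setReg] using hv
  · intro t s' hF hB ht hI
    refine ⟨?_, ?_⟩
    · have h1 : (s.setReg 12 ((Expr.lit 0).eval s)).reg 6 = s.reg 6 := rfl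
      rw [h1] at ht
      have := hX.le
      simp only [Expr.steps]
      omega
    · rw [hX.layout.weight_eq]
      exact hI

/-- Register `16` becomes the weight of the block at position `reg 13`. -/
def blockWeight : Program :=
  .assign 16 (.lit 0) ;;
  .forLoop 14 6
    (.cond (.mul (.sub (.add (.reg 14) (.lit 1)) (.reg 13))
        (.sub (.get 8 (.reg 13)) (.reg 14)))
      (.assign 16 (.add (.reg 16) (.get 1 (.get 6 (.reg 14))))) .skip)

theorem blockWeight_spec (hX : Explored T H o s) (hw : s.arr 1 = toArray w)
    (hwb : ∑ v, w v ≤ b) {i : ℕ} (hi : s.reg 13 = i) (him : i < s.reg 6) :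
    wp b blockWeight s fun t s' => t ≤ 30 * n + 8 ∧
      s'.reg 16 = ∑ l ∈ Finset.Ico i (s.arr 8 i), w (o l) := by
  refine wp.seq (wp.assign rfl (fun h => h.lit (k := 0)) ?_)
  refine wp.forLoop 20 (fun k s' => s'.reg 16 =
    ∑ l ∈ (Finset.range k).filter (fun l => i ≤ l ∧ l < s.arr 8 i), w (o l)) rfl rfl
    (by decide) (fun _ => rfl) ?_ ?_
  · intro k hk s' hF hB hk' hI
    have hk6 : k < s.reg 6 := hk
    have h13 : s'.reg 13 = i := (hF.reg 13 rfl).trans hi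
    have h8 : s'.arr 8 = s.arr 8 := hF.arr 8 rfl
    have hg : (Expr.mul (.sub (.add (.reg 14) (.lit 1)) (.reg 13))
        (.sub (.get 8 (.reg 13)) (.reg 14))).eval s' ≠ 0 ↔ i ≤ k ∧ k < s.arr 8 i := by
      simp only [Expr.eval, hk', h13, h8, ne_eq, mul_eq_zero, not_or]
      omega
    refine wp.cond rfl (fun h => ?_) (fun h => ?_)
    · have hv : (Expr.add (.reg 16) (.get 1 (.get 6 (.reg 14)))).eval s'
          = ∑ l ∈ (Finset.range (k + 1)).filter (fun l => i ≤ l ∧ l < s.arr 8 i), w (o l) := by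
        have h1 : s'.arr 1 = toArray w := (hF.arr 1 rfl).trans hw
        have h6 : s'.arr 6 k = o k := by
          rw [hF.arr 6 rfl]
          exact hX.list k hk6
        rw [Finset.range_add_one, Finset.filter_insert, if_pos (hg.1 h),
          Finset.sum_insert (by simp)]
        simp only [Expr.eval, hI, hk', h1, h6, toArray_coe]
        ring
      refine wp.assign rfl (fun _ => ?_) ⟨by decide, fun _ => ?_⟩
      · rw [hv]
        refine (hX.layout.sum_le w fun l hl => ?_).trans ((weight_le_univ w H).trans hwb)
        have := Finset.mem_range.1 (Finset.mem_filter.1 hl).1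
        omega
      · simpa [State.setReg] using hv
    · refine wp.skip ⟨by decide, fun _ => ?_⟩
      rw [Finset.range_add_one, Finset.filter_insert, if_neg (fun h' => hg.2 h' h)]
      exact hI
  · intro t s' hF hB ht hI
    have h1 : (s.setReg 16 ((Expr.lit 0).eval s)).reg 6 = s.reg 6 := rfl
    rw [h1] at ht hI
    refine ⟨?_, ?_⟩
    · have := hX.le
      simp only [Expr.steps]
      omega
    · rw [hI]
      congr 1
      ext l
      have := hX.layout.le i him
      simp only [Finset.mem_filter, Finset.mem_range, Finset.mem_Ico]
      omega

/-- Register `12` becomes the weight of the component and register `17` a centroid. -/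
def findCentroid : Program :=
  sumWeight ;; .assign 17 (.reg 5) ;;
  .forLoop 13 6 (blockWeight ;;
    .cond (.sub (.mul (.lit 2) (.reg 16)) (.reg 12)) (.assign 17 (.get 6 (.reg 13))) .skip)

/-- Each connected part of `H` without `z` has at most half of the weight of `H`. -/
def IsCentroid (T : SimpleGraph (Fin n)) (w : Fin n → ℕ) (H : Set (Fin n)) (z : Fin n) : Prop :=
  z ∈ H ∧ ∀ C ⊆ H, (T.induce C).Preconnected → z ∉ C → 2 * weight w C ≤ weight w H

/-- The scan keeps the last position whose block is heavier than half, as required by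
`Layout.centroid`. -/
theorem findCentroid_spec (hX : Explored T H o s) (hw : s.arr 1 = toArray w)
    (hwb : ∑ v, w v ≤ b) (h5 : s.reg 5 = o 0) :
    wp b findCentroid s fun t s' => t ≤ 80 * n ^ 2 + 20 ∧ s'.reg 12 = weight w H ∧
      ∃ z : Fin n, s'.reg 17 = z ∧ IsCentroid T w H z := by
  refine wp.seq ((sumWeight_spec hX hw hwb).mono fun t₁ s₁ hF₁ hB₁ ⟨ht₁, h12⟩ => ?_)
  have hX₁ := hX.frame hF₁ rfl rfl rfl
  refine wp.seq (wp.assign rfl (fun h => h.reg 5) ?_)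
  have h617 : (s₁.setReg 17 ((Expr.reg 5).eval s₁)).reg 6 = s.reg 6 := hF₁.reg 6 rfl
  refine wp.forLoop (30 * n + 20) (fun k s' => (s'.reg 17 = o 0 ∧ ∀ j < k,
      2 * ∑ l ∈ Finset.Ico j (s.arr 8 j), w (o l) ≤ weight w H) ∨
    ∃ i < s.reg 6, s'.reg 17 = o i ∧ weight w H < 2 * ∑ l ∈ Finset.Ico i (s.arr 8 i), w (o l) ∧
      ∀ j < k, i < j → 2 * ∑ l ∈ Finset.Ico j (s.arr 8 j), w (o l) ≤ weight w H) rfl rfl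
    (by decide) (fun _ => Or.inl ⟨(hF₁.reg 5 rfl).trans h5, by simp⟩) ?_ ?_
  · intro k hk s₂ hF₂ hB₂ hk₂ hI
    have hk6 : k < s.reg 6 := by rwa [h617] at hk
    have hX₂ : Explored T H o s₂ := Explored.frame (s := s₁.setReg 17 ((Expr.reg 5).eval s₁))
      ⟨hX₁.list, hX₁.le, hX₁.layout⟩ hF₂ rfl rfl rfl
    have h12' : s₂.reg 12 = weight w H := (hF₂.reg 12 rfl).trans h12
    have h8 : s₂.arr 8 = s.arr 8 := (hF₂.arr 8 rfl).trans (hF₁.arr 8 rfl)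
    have h6 : s₂.reg 6 = s.reg 6 := (hF₂.reg 6 rfl).trans (hF₁.reg 6 rfl)
    refine wp.seq ((blockWeight_spec hX₂ (((hF₂.arr 1 rfl).trans (hF₁.arr 1 rfl)).trans hw) hwb
      hk₂ (by omega)).mono fun t₃ s₃ hF₃ hB₃ ⟨ht₃, h16⟩ => ?_)
    rw [h8] at h16
    have h12'' : s₃.reg 12 = weight w H := (hF₃.reg 12 rfl).trans h12'
    refine wp.cond rfl (fun h => ?_) (fun h => ?_)
    · simp only [Expr.eval, h12'', h16] at h
      refine wp.assign rfl (fun h => h.arr 6 _) ⟨?_, fun _ => Or.inr ⟨k, hk6, ?_, by omega, ?_⟩⟩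
      · simp only [Expr.steps]
        omega
      · have h13 : s₃.reg 13 = k := (hF₃.reg 13 rfl).trans hk₂
        have h6' : s₃.arr 6 = s₂.arr 6 := hF₃.arr 6 rfl
        simp [State.setReg, Expr.eval, h13, h6', hX₂.list k (by omega)]
      · intro j hj hkj
        omega
    · simp only [Expr.eval, h12'', h16] at h
      refine wp.skip ⟨?_, fun v => ?_⟩
      · simp only [Expr.steps]
        omega
      · have h17 : (s₃.setReg 13 v).reg 17 = s₂.reg 17 := hF₃.reg 17 rfl
        rw [h17]
        rcases hI with ⟨h1, h2⟩ | ⟨i, h1, h2, h3, h4⟩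
        · refine Or.inl ⟨h1, fun j hj => ?_⟩
          rcases Nat.lt_succ_iff_lt_or_eq.1 hj with hj | rfl
          · exact h2 j hj
          · omega
        · refine Or.inr ⟨i, h1, h2, h3, fun j hj hij => ?_⟩
          rcases Nat.lt_succ_iff_lt_or_eq.1 hj with hj | rfl
          · exact h4 j hj hij
          · omega
  · intro t s₂ hF₂ hB₂ ht hI
    rw [h617] at ht hI
    refine ⟨?_, (hF₂.reg 12 rfl).trans h12, ?_⟩
    · have h1 := Nat.mul_le_mul_right (30 * n + 20 + 8) hX.le
      have hn : 1 ≤ n := (o 0).pos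
      simp only [Expr.steps]
      nlinarith
    · rcases hI with ⟨h1, h2⟩ | ⟨i, h1, h2, h3, h4⟩
      -- No block qualifies, not even that of the root, so the component has weight zero and any
      -- vertex is a centroid.
      · refine ⟨o 0, h1, hX.layout.mem hX.layout.pos, fun C hC _ _ => ?_⟩
        have h3 := h2 0 hX.layout.pos
        rw [hX.layout.root, ← Finset.range_eq_Ico, ← hX.layout.weight_eq] at h3
        have := weight_mono w hC
        omega
      · exact ⟨o i, h2, hX.layout.mem h1, fun C hC hCc hi =>
          hX.layout.centroid h1 h3 (fun j hj hij => h4 j hj hij) hCc hC hi⟩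

end Centroid

/-! ### The dynamic program -/

section Knapsack

variable {n : ℕ} {T : SimpleGraph (Fin n)} {H : Set (Fin n)} {b : ℕ} {s : State}
  {o : ℕ → Fin n} {w c : Fin n → ℕ} {B N : ℕ}

/-!
The bound `B` is in register `18`, the precision `N` in register `19`, and `N + 1` in register `20`.
The table is in array `10`, with rows of length `N + 1`.
-/

/-- Computes entry `reg 22` of row `reg 23`, where registers `24` and `25` hold the vertex and its
rounded cost. -/
def fillEntry : Program :=
  .assign 26 (.add (.get 1 (.reg 24))
    (.get 10 (.add (.mul (.add (.reg 23) (.lit 1)) (.reg 20)) (.reg 22)))) ;;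
  .cond (.mul (.sub (.add (.reg 18) (.lit 1)) (.get 0 (.reg 24)))
      (.sub (.add (.reg 22) (.lit 1)) (.reg 25)))
    (.cond (.sub (.reg 26)
        (.get 10 (.add (.mul (.get 8 (.reg 23)) (.reg 20)) (.sub (.reg 22) (.reg 25)))))
      (.assign 26 (.get 10 (.add (.mul (.get 8 (.reg 23)) (.reg 20))
        (.sub (.reg 22) (.reg 25))))) .skip) .skip ;;
  .store 10 (.add (.mul (.reg 23) (.reg 20)) (.reg 22)) (.reg 26)

theorem fillEntry_spec {A : ℕ → ℕ} {v : Fin n} {d i k : ℕ} (hA : s.arr 10 = A)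
    (hw : s.arr 1 = toArray w) (hc : s.arr 0 = toArray c) (h18 : s.reg 18 = B)
    (h20 : s.reg 20 = N + 1) (h22 : s.reg 22 = k) (h23 : s.reg 23 = i) (h24 : s.reg 24 = v)
    (h25 : s.reg 25 = d) (hb : w v + A ((i + 1) * (N + 1) + k) ≤ b) :
    wp b fillEntry s fun t s' => t ≤ 64 ∧
      s'.arr 10 = Function.update A (i * (N + 1) + k) (if c v ≤ B ∧ d ≤ k then
        min (w v + A ((i + 1) * (N + 1) + k)) (A (s.arr 8 i * (N + 1) + (k - d)))
        else w v + A ((i + 1) * (N + 1) + k)) := by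
  have hval : (Expr.add (.get 1 (.reg 24))
    (.get 10 (.add (.mul (.add (.reg 23) (.lit 1)) (.reg 20)) (.reg 22)))).eval s
      = w v + A ((i + 1) * (N + 1) + k) := by
    simp only [Expr.eval, hw, hA, h20, h22, h23, h24, toArray_coe]
  refine wp.seq (wp.assign rfl (fun _ => by rw [hval]; exact hb) ?_)
  rw [hval]
  set x := w v + A ((i + 1) * (N + 1) + k)
  have hend : ∀ (s₁ : State) (y : ℕ), s₁.reg 20 = N + 1 → s₁.reg 22 = k → s₁.reg 23 = i →
      s₁.arr 10 = A → s₁.reg 26 = y →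
      wp b (.store 10 (.add (.mul (.reg 23) (.reg 20)) (.reg 22)) (.reg 26)) s₁ fun t s' =>
        t ≤ 8 ∧ s'.arr 10 = Function.update A (i * (N + 1) + k) y := by
    intro s₁ y h20 h22 h23 hA h26
    refine wp.store rfl rfl (fun h => h.reg 26) ⟨by decide, ?_⟩
    simp [State.setArr, Expr.eval, h20, h22, h23, hA, h26]
  have h : (Expr.get 10 (.add (.mul (.get 8 (.reg 23)) (.reg 20))
      (.sub (.reg 22) (.reg 25)))).eval (s.setReg 26 x)
      = A (s.arr 8 i * (N + 1) + (k - d)) := by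
    simp [State.setReg, Expr.eval, hA, h20, h22, h23, h25]
  -- The truncated difference `x + 1 - y` is nonzero exactly if `y ≤ x`.
  have hg : (Expr.mul (.sub (.add (.reg 18) (.lit 1)) (.get 0 (.reg 24)))
      (.sub (.add (.reg 22) (.lit 1)) (.reg 25))).eval (s.setReg 26 x) ≠ 0 ↔ c v ≤ B ∧ d ≤ k := by
    simp [State.setReg, Expr.eval, h18, h22, h24, h25, hc, toArray_coe]
    omega
  refine wp.seq (wp.cond rfl (fun h1 => ?_) (fun h1 => ?_))
  · rw [if_pos (hg.1 h1)]
    have h26 : (s.setReg 26 x).reg 26 = x := by simp [State.setReg]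
    refine wp.cond rfl (fun h2 => ?_) (fun h2 => ?_)
    · refine wp.assign rfl (fun h => h.arr 10 _) ?_
      refine wp.mono (hend _ (min x (A (s.arr 8 i * (N + 1) + (k - d)))) ?_ ?_ ?_ ?_ ?_) ?_
      · exact h20
      · exact h22
      · exact h23
      · exact hA
      · rw [h]
        simp only [Expr.eval] at h2 h
        rw [h, h26] at h2
        simp [State.setReg]
        omega
      · intro t s' _ _ h'
        simp only [Expr.steps]
        exact ⟨by omega, h'.2⟩
    · refine wp.skip ?_
      refine wp.mono (hend _ (min x (A (s.arr 8 i * (N + 1) + (k - d)))) ?_ ?_ ?_ ?_ ?_) ?_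
      · exact h20
      · exact h22
      · exact h23
      · exact hA
      · simp only [Expr.eval] at h2 h
        rw [h, h26] at h2
        rw [h26]
        omega
      · intro t s' _ _ h'
        simp only [Expr.steps]
        exact ⟨by omega, h'.2⟩
  · rw [if_neg fun h2 => hg.2 h2 h1]
    refine wp.skip (wp.mono (hend _ x ?_ ?_ ?_ ?_ (by simp [State.setReg])) ?_)
    · exact h20
    · exact h22
    · exact h23
    · exact hA
    intro t s' _ _ h'
    simp only [Expr.steps]
    exact ⟨by omega, h'.2⟩

theorem table_index_inj {L i j k l : ℕ} (hk : k < L) (hl : l < L) (h : i * L + k = j * L + l) :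
    i = j ∧ k = l := by
  have hL : 0 < L := by omega
  have h1 : i = j := by
    have := congrArg (· / L) h
    simpa [mul_comm _ L, Nat.mul_add_div hL, Nat.div_eq_of_lt hk, Nat.div_eq_of_lt hl] using this
  subst h1
  exact ⟨rfl, by omega⟩

/-- Computes row `reg 23`. -/
def fillRow : Program :=
  .assign 24 (.get 6 (.reg 23)) ;;
  .assign 25 (.div (.mul (.get 0 (.reg 24)) (.reg 19)) (.reg 18)) ;;
  .forLoop 22 20 fillEntry

/-- Row `i` reads only the rows `i + 1` and `e i`, which lie strictly below it and are not disturbed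
while it is written. -/
theorem fillRow_spec (hX : Explored T H o s) (hw : s.arr 1 = toArray w)
    (hc : s.arr 0 = toArray c) (hcb : (∑ v, c v) * N ≤ b) (h18 : s.reg 18 = B)
    (h19 : s.reg 19 = N) (h20 : s.reg 20 = N + 1) {i : ℕ} (him : i < s.reg 6)
    (h23 : s.reg 23 = i) (hb : ∀ k ≤ N, w (o i) + s.arr 10 ((i + 1) * (N + 1) + k) ≤ b) :
    wp b fillRow s fun t s' => t ≤ 72 * (N + 1) + 18 ∧
      (∀ j k, j ≠ i → k ≤ N → s'.arr 10 (j * (N + 1) + k) = s.arr 10 (j * (N + 1) + k)) ∧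
      ∀ k ≤ N, s'.arr 10 (i * (N + 1) + k) =
        if c (o i) ≤ B ∧ c (o i) * N / B ≤ k then
          min (w (o i) + s.arr 10 ((i + 1) * (N + 1) + k))
            (s.arr 10 (s.arr 8 i * (N + 1) + (k - c (o i) * N / B)))
        else w (o i) + s.arr 10 ((i + 1) * (N + 1) + k) := by
  have h24 : (Expr.get 6 (.reg 23)).eval s = o i := by
    simp [Expr.eval, h23, hX.list i him]
  have h25 : (Expr.div (.mul (.get 0 (.reg 24)) (.reg 19)) (.reg 18)).eval
      (s.setReg 24 (o i)) = c (o i) * N / B := by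
    simp [Expr.eval, State.setReg, hc, h18, h19, toArray_coe]
  refine wp.seq (wp.assign rfl (fun h => h.arr 6 _) ?_)
  rw [h24]
  refine wp.seq (wp.assign rfl (fun _ => ?_) ?_)
  · rw [h25]
    refine (Nat.div_le_self _ _).trans (le_trans (Nat.mul_le_mul_right _ ?_) hcb)
    exact Finset.single_le_sum (f := c) (fun _ _ => Nat.zero_le _) (Finset.mem_univ _)
  rw [h25]
  set s₀ := (s.setReg 24 (o i)).setReg 25 (c (o i) * N / B)
  have hi := hX.layout.lt i him
  have h20' : s₀.reg 20 = N + 1 := h20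
  refine wp.forLoop 64 (fun k s' =>
      (∀ j l, l ≤ N → (j ≠ i ∨ k ≤ l) →
        s'.arr 10 (j * (N + 1) + l) = s.arr 10 (j * (N + 1) + l)) ∧
      ∀ l < k, l ≤ N → s'.arr 10 (i * (N + 1) + l) =
        if c (o i) ≤ B ∧ c (o i) * N / B ≤ l then
          min (w (o i) + s.arr 10 ((i + 1) * (N + 1) + l))
            (s.arr 10 (s.arr 8 i * (N + 1) + (l - c (o i) * N / B)))
        else w (o i) + s.arr 10 ((i + 1) * (N + 1) + l)) rfl rfl (by decide)
    (fun _ => ⟨fun _ _ _ _ => rfl, fun l hl => absurd hl (Nat.not_lt_zero _)⟩) ?_ ?_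
  · intro k hk s₁ hF₁ hB₁ hk₁ ⟨h1, h2⟩
    have hkN : k ≤ N := by omega
    have h8 : s₁.arr 8 = s.arr 8 := hF₁.arr 8 rfl
    have h3 : s₁.arr 10 ((i + 1) * (N + 1) + k) = s.arr 10 ((i + 1) * (N + 1) + k) :=
      h1 _ _ hkN (Or.inl (by omega))
    have h4 : s₁.arr 10 (s.arr 8 i * (N + 1) + (k - c (o i) * N / B))
        = s.arr 10 (s.arr 8 i * (N + 1) + (k - c (o i) * N / B)) :=
      h1 _ _ ((Nat.sub_le _ _).trans hkN) (Or.inl (by omega))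
    refine (fillEntry_spec (w := w) (c := c) (N := N) (B := B) (i := i) (v := o i)
      (d := c (o i) * N / B) rfl ((hF₁.arr 1 rfl).trans hw) ((hF₁.arr 0 rfl).trans hc)
      ((hF₁.reg 18 rfl).trans h18) ((hF₁.reg 20 rfl).trans h20) hk₁ ((hF₁.reg 23 rfl).trans h23)
      (hF₁.reg 24 rfl) (hF₁.reg 25 rfl) ?_).mono fun t s₂ hF₂ hB₂ ⟨ht, h⟩ => ⟨ht, fun v => ?_⟩
    · rw [h3]
      exact hb k hkN
    rw [h3, h8, h4] at h
    have h5 : (s₂.setReg 22 v).arr 10 = s₂.arr 10 := rfl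
    rw [h5, h]
    refine ⟨fun j l hl hjl => ?_, fun l hl hlN => ?_⟩
    · rw [Function.update_of_ne]
      · exact h1 j l hl (hjl.imp_right fun h => by omega)
      · intro h6
        have := table_index_inj (by omega) (by omega) h6
        omega
    · rcases Nat.lt_succ_iff_lt_or_eq.1 hl with hl | rfl
      · rw [Function.update_of_ne]
        · exact h2 l hl hlN
        · intro h6
          have := table_index_inj (by omega) (by omega) h6
          omega
      · rw [Function.update_self]
  · intro t s' hF hB ht ⟨h1, h2⟩
    rw [h20'] at ht h2
    refine ⟨?_, fun j k hj hk => h1 j k hk (Or.inl hj), fun k hk => h2 k (by omega) hk⟩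
    simp only [Expr.steps]
    omega

/-- Computes the table. -/
def fillTable : Program :=
  .assign 20 (.add (.reg 19) (.lit 1)) ;;
  .forLoop 22 20 (.store 10 (.add (.mul (.reg 6) (.reg 20)) (.reg 22)) (.lit 0)) ;;
  .forLoop 21 6 (.assign 23 (.sub (.sub (.reg 6) (.lit 1)) (.reg 21)) ;; fillRow)

/-- The entries of the table. -/
def table (N : ℕ) (s : State) (i k : ℕ) : ℕ := s.arr 10 (i * (N + 1) + k)

theorem fillTable_spec (hX : Explored T H o s) (hw : s.arr 1 = toArray w)
    (hc : s.arr 0 = toArray c) (hwb : ∑ v, w v ≤ b) (hNb : N + 1 ≤ b)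
    (hcb : (∑ v, c v) * N ≤ b) (h18 : s.reg 18 = B) (h19 : s.reg 19 = N) :
    wp b fillTable s fun t s' => t ≤ n * (72 * (N + 1) + 60) + 20 * (N + 1) ∧
      s'.reg 20 = N + 1 ∧
      IsTable (s.reg 6) (s.arr 8) (w ∘ o) (c ∘ o) B N (table N s') := by
  set m := s.reg 6 with hm
  refine wp.seq (wp.assign rfl (fun _ => ?_) ?_)
  · simp only [Expr.eval, h19]
    exact hNb
  have hv : (Expr.add (.reg 19) (.lit 1)).eval s = N + 1 := by simp [Expr.eval, h19]
  rw [hv]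
  have h20 : (s.setReg 20 (N + 1)).reg 20 = N + 1 := by simp [State.setReg]
  refine wp.seq ?_
  refine wp.forLoop 8 (fun k s' => ∀ l < k, l ≤ N → s'.arr 10 (m * (N + 1) + l) = 0) rfl rfl
    (by decide) (fun _ l hl => absurd hl (Nat.not_lt_zero _)) ?_ ?_
  · intro k hk s₁ hF₁ hB₁ hk₁ hI
    refine wp.store rfl rfl (fun h => h.lit (k := 0)) ⟨by decide, fun v l hl hlN => ?_⟩
    have h6 : s₁.reg 6 = m := hF₁.reg 6 rfl
    have h20' : s₁.reg 20 = N + 1 := (hF₁.reg 20 rfl).trans h20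
    simp only [State.setArr, State.setReg, Expr.eval, Function.update_self, h6, h20', hk₁]
    rw [Function.update_apply]
    split_ifs with h
    · rfl
    · exact hI l (by
        rcases Nat.lt_succ_iff_lt_or_eq.1 hl with hl | rfl
        · exact hl
        · exact absurd rfl h) hlN
  intro t₁ s₁ hF₁ hB₁ ht₁ hlast
  rw [h20] at ht₁ hlast
  have h6₁ : s₁.reg 6 = m := hF₁.reg 6 rfl
  -- Rows are filled from the last one upwards. The bound by the weight of the remaining vertices is
  -- carried along to keep the entries within the word size.
  refine wp.forLoop (72 * (N + 1) + 30) (fun j s' =>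
      (∀ l ≤ N, s'.arr 10 (m * (N + 1) + l) = 0) ∧
      ∀ i < m, m ≤ i + j → ∀ k ≤ N, table N s' i k ≤ ∑ l ∈ Finset.Ico i m, w (o l) ∧
        table N s' i k = if c (o i) ≤ B ∧ c (o i) * N / B ≤ k then
          min (w (o i) + table N s' (i + 1) k) (table N s' (s.arr 8 i) (k - c (o i) * N / B))
          else w (o i) + table N s' (i + 1) k) rfl rfl (by decide) ?_ ?_ ?_
  · exact fun _ => ⟨fun l hl => hlast l (by omega) hl, fun i hi h => by omega⟩
  · intro j hj s₂ hF₂ hB₂ hj₂ ⟨h1, h2⟩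
    rw [h6₁] at hj
    have h6₂ : s₂.reg 6 = m := (hF₂.reg 6 rfl).trans h6₁
    have hv : (Expr.sub (.sub (.reg 6) (.lit 1)) (.reg 21)).eval s₂ = m - 1 - j := by
      simp [Expr.eval, h6₂, hj₂]
    refine wp.seq (wp.assign rfl (fun h => ?_) ?_)
    · rw [hv]
      have := h.reg 6
      omega
    rw [hv]
    set i := m - 1 - j with hi
    have him : i < m := by omega
    have h8 : s₂.arr 8 = s.arr 8 := (hF₂.arr 8 rfl).trans (hF₁.arr 8 rfl)
    have hX₂ : Explored T H o (s₂.setReg 23 i) := by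
      constructor
      · show ∀ l < s₂.reg 6, s₂.arr 6 l = o l
        rw [h6₂, hF₂.arr 6 rfl, hF₁.arr 6 rfl]
        exact hX.list
      · show s₂.reg 6 ≤ n
        rw [h6₂]
        exact hX.le
      · show Layout T H (s₂.reg 6) o (s₂.arr 8)
        rw [h6₂, h8]
        exact hX.layout
    have hsum : w (o i) + ∑ l ∈ Finset.Ico (i + 1) m, w (o l) = ∑ l ∈ Finset.Ico i m, w (o l) :=
      (Finset.sum_eq_sum_Ico_succ_bot him fun l => w (o l)).symm
    have hnext : ∀ k ≤ N, table N s₂ (i + 1) k ≤ ∑ l ∈ Finset.Ico (i + 1) m, w (o l) := by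
      intro k hk
      by_cases h3 : i + 1 < m
      · exact (h2 (i + 1) h3 (by omega) k hk).1
      · have h4 : i + 1 = m := by omega
        rw [h4, table, h1 k hk]
        exact Nat.zero_le _
    have hbound : ∀ k ≤ N, w (o i) + table N s₂ (i + 1) k ≤ ∑ l ∈ Finset.Ico i m, w (o l) :=
      fun k hk => hsum ▸ Nat.add_le_add_left (hnext k hk) _
    have hle : ∑ l ∈ Finset.Ico i m, w (o l) ≤ b :=
      (hX.layout.sum_le w fun l hl => (Finset.mem_Ico.1 hl).2).trans
        ((weight_le_univ w H).trans hwb)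
    refine (fillRow_spec (w := w) (c := c) (N := N) (B := B) (i := i) hX₂
      (((hF₂.arr 1 rfl).trans (hF₁.arr 1 rfl)).trans hw)
      (((hF₂.arr 0 rfl).trans (hF₁.arr 0 rfl)).trans hc) hcb
      (((hF₂.reg 18 rfl).trans (hF₁.reg 18 rfl)).trans h18)
      (((hF₂.reg 19 rfl).trans (hF₁.reg 19 rfl)).trans h19)
      (((hF₂.reg 20 rfl).trans (hF₁.reg 20 rfl)).trans h20) (him.trans_eq h6₂.symm)
      (by simp [State.setReg]) fun k hk => (hbound k hk).trans hle).mono ?_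
    rintro t s₃ hF₃ hB₃ ⟨ht, h3, h4⟩
    have h8' : (s₂.setReg 23 i).arr 8 i = s.arr 8 i := congrFun h8 i
    rw [h8'] at h4
    refine ⟨?_, fun v => ?_⟩
    · simp only [Expr.steps]
      omega
    have ht3 : ∀ j' k, j' ≠ i → k ≤ N → table N (s₃.setReg 21 v) j' k = table N s₂ j' k :=
      fun j' k h5 h6 => h3 j' k h5 h6
    refine ⟨fun l hl => ?_, fun i' hi' hij k hk => ?_⟩
    · exact (h3 m l (by omega) hl).trans (h1 l hl)
    · have h5 := hX.layout.lt i' hi'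
      rw [ht3 (i' + 1) k (by omega) hk,
        ht3 (s.arr 8 i') _ (by omega) ((Nat.sub_le _ _).trans hk)]
      by_cases h6 : i' = i
      · subst h6
        have h7 := h4 k hk
        refine ⟨?_, h7⟩
        refine le_trans (le_trans (le_of_eq h7) ?_) (hbound k hk)
        split_ifs
        · exact min_le_left _ _
        · exact le_rfl
      · rw [ht3 i' k h6 hk]
        exact h2 i' hi' (by omega) k hk
  · intro t s₂ hF₂ hB₂ ht ⟨h1, h2⟩
    rw [h6₁] at ht h2
    refine ⟨?_, ?_, ?_⟩
    · have h3 := Nat.mul_le_mul_right (72 * (N + 1) + 30 + 8) hX.le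
      have hn : 1 ≤ n := (o 0).pos
      simp only [Expr.steps]
      nlinarith
    · exact ((hF₂.reg 20 rfl).trans (hF₁.reg 20 rfl)).trans h20
    · exact ⟨h1, fun i hi k hk => (h2 i hi (by omega) k hk).2⟩

/-- Register `27` becomes the least feasible budget, or `N + 1`. -/
def findBudget : Program :=
  .assign 27 (.reg 20) ;;
  .forLoop 22 20
    (.cond (.mul (.sub (.add (.reg 27) (.lit 1)) (.reg 20))
        (.sub (.add (.reg 12) (.lit 1)) (.mul (.lit 2) (.get 10 (.reg 22)))))
      (.assign 27 (.reg 22)) .skip)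

/-- Register `27` holds the least `k ≤ N` with `2 * g 0 k ≤ W`, or `N + 1` if there is none. -/
def IsBudget (N W : ℕ) (g : ℕ → ℕ → ℕ) (k : ℕ) : Prop :=
  k ≤ N + 1 ∧ (k ≤ N → 2 * g 0 k ≤ W) ∧ ∀ l < k, W < 2 * g 0 l

theorem findBudget_spec (h20 : s.reg 20 = N + 1) {W : ℕ} (h12 : s.reg 12 = W) :
    wp b findBudget s fun t s' => t ≤ 26 * (N + 1) + 8 ∧ IsBudget N W (table N s) (s'.reg 27) := by
  refine wp.seq (wp.assign rfl (fun h => h.reg 20) ?_)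
  refine wp.forLoop 18 (fun k s' => (s'.reg 27 = N + 1 ∧ ∀ l < k, W < 2 * s.arr 10 l) ∨
    (s'.reg 27 ≤ N ∧ 2 * s.arr 10 (s'.reg 27) ≤ W ∧ ∀ l < s'.reg 27, W < 2 * s.arr 10 l))
    rfl rfl (by decide) (fun _ => Or.inl ⟨h20, by simp⟩) ?_ ?_
  · intro k hk s₁ hF₁ hB₁ hk₁ hI
    have h20' : s₁.reg 20 = N + 1 := (hF₁.reg 20 rfl).trans h20
    have hkN : k ≤ N := by
      have : k < s.reg 20 := hk
      omega
    have h12' : s₁.reg 12 = W := (hF₁.reg 12 rfl).trans h12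
    have h10 : s₁.arr 10 = s.arr 10 := hF₁.arr 10 rfl
    -- The first factor of the test is nonzero only while register `27` still holds `N + 1`, so only
    -- the first feasible budget is stored.
    refine wp.cond rfl (fun h => ?_) (fun h => ?_)
    · simp only [Expr.eval, h20', hk₁, h12', h10, ne_eq, mul_eq_zero, not_or] at h
      refine wp.assign rfl (fun h => h.reg 22) ⟨by decide, fun v => Or.inr ?_⟩
      have h27 : ((s₁.setReg 27 ((Expr.reg 22).eval s₁)).setReg 22 v).reg 27 = k := hk₁
      rw [h27]
      rcases hI with ⟨h1, h2⟩ | ⟨h1, h2, h3⟩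
      · exact ⟨hkN, by omega, h2⟩
      · omega
    · simp only [Expr.eval, h20', hk₁, h12', h10, mul_eq_zero] at h
      refine wp.skip ⟨by decide, fun v => ?_⟩
      have h27 : (s₁.setReg 22 v).reg 27 = s₁.reg 27 := rfl
      rw [h27]
      rcases hI with ⟨h1, h2⟩ | h1
      · refine Or.inl ⟨h1, fun l hl => ?_⟩
        rcases Nat.lt_succ_iff_lt_or_eq.1 hl with hl | rfl
        · exact h2 l hl
        · omega
      · exact Or.inr h1
  · intro t s₁ hF₁ hB₁ ht hI
    have h20' : (s.setReg 27 ((Expr.reg 20).eval s)).reg 20 = N + 1 := h20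
    rw [h20'] at ht hI
    refine ⟨?_, ?_⟩
    · simp only [Expr.steps]
      omega
    · rw [IsBudget]
      simp only [table, zero_mul, zero_add]
      rcases hI with ⟨h1, h2⟩ | ⟨h1, h2, h3⟩
      · exact ⟨by omega, fun h => by omega, fun l hl => h2 l (by omega)⟩
      · exact ⟨by omega, fun _ => h2, h3⟩

/-- The dynamic program for the bound in register `18` and the precision in register `19`. -/
def knapsack : Program := fillTable ;; findBudget

/-- The result of the dynamic program. -/
structure Solved (H : Set (Fin n)) (o : ℕ → Fin n) (w c : Fin n → ℕ) (B N : ℕ) (s : State) :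
    Prop where
  size : s.reg 20 = N + 1
  table : IsTable (s.reg 6) (s.arr 8) (w ∘ o) (c ∘ o) B N (table N s)
  budget : IsBudget N (weight w H) (TreeSearch.table N s) (s.reg 27)

theorem knapsack_spec (hX : Explored T H o s) (hw : s.arr 1 = toArray w)
    (hc : s.arr 0 = toArray c) (hwb : ∑ v, w v ≤ b) (hNb : N + 1 ≤ b)
    (hcb : (∑ v, c v) * N ≤ b) (h12 : s.reg 12 = weight w H) (h18 : s.reg 18 = B)
    (h19 : s.reg 19 = N) :
    wp b knapsack s fun t s' => t ≤ 190 * n * (N + 1) ∧ Solved H o w c B N s' := by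
  refine wp.seq ((fillTable_spec hX hw hc hwb hNb hcb h18 h19).mono ?_)
  rintro t₁ s₁ hF₁ hB₁ ⟨ht₁, h20, htab⟩
  refine (findBudget_spec h20 ((hF₁.reg 12 rfl).trans h12)).mono ?_
  rintro t₂ s₂ hF₂ hB₂ ⟨ht₂, h27⟩
  have h10 : table N s₂ = table N s₁ := by
    funext i k
    rw [table, table, hF₂.arr 10 rfl]
  refine ⟨?_, (hF₂.reg 20 rfl).trans h20, ?_, ?_⟩
  · have hn : 1 ≤ n := (o 0).pos
    have h1 : 1 ≤ N + 1 := by omega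
    have h2 := Nat.mul_le_mul hn (le_refl (N + 1))
    have h3 := Nat.mul_le_mul (le_refl n) h1
    nlinarith
  · rw [h10, hF₂.reg 6 rfl, hF₂.arr 8 rfl, hF₁.reg 6 rfl, hF₁.arr 8 rfl]
    exact htab
  · rw [h10]
    exact h27

end Knapsack

/-! ### The separator -/

section Separator

variable {n : ℕ} {T : SimpleGraph (Fin n)} {H : Set (Fin n)} {b : ℕ} {s : State}
  {o : ℕ → Fin n} {w c : Fin n → ℕ} {B N : ℕ}

/-- The centroid alone is a separator, which provides the initial value of the bottleneck search. -/
theorem IsCentroid.hasSeparator {z : Fin n} (hz : IsCentroid T w H z) (c : Fin n → ℕ) :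
    HasSeparator T w c H (c z) := by
  refine ⟨{z}, fun v hv => ?_, fun C hC hd hCc => hz.2 C hC hCc fun h => ?_⟩
  · obtain rfl := Finset.mem_singleton.1 hv
    exact ⟨hz.1, le_rfl⟩
  · exact Set.disjoint_left.1 hd h (by simp)

/-- `B` is the least bound such that the vertices that cost at most `B` contain a separator. -/
def IsBottleneck (T : SimpleGraph (Fin n)) (w c : Fin n → ℕ) (H : Set (Fin n)) (B : ℕ) : Prop :=
  HasSeparator T w c H B ∧ ∀ u ∈ H, HasSeparator T w c H (c u) → B ≤ c u

/-- A separator of a connected set of positive weight is nonempty, and the largest cost in it is a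
feasible cap. -/
theorem IsBottleneck.le_sum (hB : IsBottleneck T w c H B) (hH : (T.induce H).Preconnected)
    (hw : 0 < weight w H) {P : Finset (Fin n)} (hPH : ∀ v ∈ P, v ∈ H)
    (hP : IsSeparator T w H P) : B ≤ ∑ v ∈ P, c v := by
  have hne : P.Nonempty := by
    rw [Finset.nonempty_iff_ne_empty]
    rintro rfl
    have := hP H le_rfl (by simp) hH
    omega
  obtain ⟨u, hu, hmax⟩ := P.exists_max_image c hne
  refine (hB.2 u (hPH u hu) ⟨P, fun v hv => ⟨hPH v hv, hmax v hv⟩, hP⟩).trans ?_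
  exact Finset.single_le_sum (f := c) (fun _ _ => Nat.zero_le _) hu

/-- Register `28` becomes the bottleneck cost. -/
def findBottleneck : Program :=
  .assign 19 (.lit 0) ;; .assign 28 (.get 0 (.get 6 (.lit 0))) ;;
  .forLoop 29 6 (.assign 18 (.get 0 (.get 6 (.reg 29))) ;; knapsack ;;
    .cond (.mul (.sub (.reg 20) (.reg 27)) (.sub (.reg 28) (.reg 18)))
      (.assign 28 (.reg 18)) .skip)

theorem findBottleneck_spec (hX : Explored T H o s) (hz : IsCentroid T w H (o 0))
    (hw : s.arr 1 = toArray w) (hc : s.arr 0 = toArray c) (hwb : ∑ v, w v ≤ b)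
    (h12 : s.reg 12 = weight w H) :
    wp b findBottleneck s fun t s' => t ≤ 240 * n ^ 2 ∧ IsBottleneck T w c H (s'.reg 28) := by
  refine wp.seq (wp.assign rfl (fun h => h.lit (k := 0)) (wp.seq ?_))
  refine wp.assign rfl (fun h => h.arr 0 _) ?_
  set s₀ := (s.setReg 19 ((Expr.lit 0).eval s)).setReg 28
    ((Expr.get 0 (.get 6 (.lit 0))).eval (s.setReg 19 ((Expr.lit 0).eval s)))
  have h28 : s₀.reg 28 = c (o 0) := by
    have h1 : s.arr 6 0 = o 0 := hX.list 0 hX.layout.pos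
    simp [s₀, State.setReg, Expr.eval, hc, h1, toArray_coe]
  refine wp.forLoop (190 * n + 26) (fun k s' => HasSeparator T w c H (s'.reg 28) ∧
    ∀ j < k, HasSeparator T w c H (c (o j)) → s'.reg 28 ≤ c (o j)) rfl rfl
    (by decide) (fun v => ⟨?_, by simp⟩) ?_ ?_
  · have : (s₀.setReg 29 v).reg 28 = c (o 0) := h28
    rw [this]
    exact hz.hasSeparator c
  · intro k hk s₁ hF₁ hB₁ hk₁ ⟨h1, h2⟩
    have hX₁ : Explored T H o s₁ :=
      Explored.frame (s := s₀) ⟨hX.list, hX.le, hX.layout⟩ hF₁ rfl rfl rfl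
    have hk6 : k < s₁.reg 6 := by
      rw [hF₁.reg 6 rfl]
      exact hk
    have hc₁ : s₁.arr 0 = toArray c := (hF₁.arr 0 rfl).trans hc
    have hv : (Expr.get 0 (.get 6 (.reg 29))).eval s₁ = c (o k) := by
      simp [Expr.eval, hk₁, hX₁.list k hk6, hc₁, toArray_coe]
    refine wp.seq (wp.assign rfl (fun h => h.arr 0 _) ?_)
    rw [hv]
    have hX₂ : Explored T H o (s₁.setReg 18 (c (o k))) := ⟨hX₁.list, hX₁.le, hX₁.layout⟩
    have h19 : s₁.reg 19 = 0 := hF₁.reg 19 rfl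
    refine wp.seq (wp.of_bdd fun hb => ?_)
    refine (knapsack_spec (N := 0) (B := c (o k)) hX₂ ((hF₁.arr 1 rfl).trans hw) hc₁ hwb
      (hb.lit (k := 1)) (by simp) ((hF₁.reg 12 rfl).trans h12) (by simp [State.setReg]) h19).mono ?_
    rintro t s₃ hF₃ hB₃ ⟨ht, hS⟩
    have h20 : s₃.reg 20 = 1 := hS.size
    have h18 : s₃.reg 18 = c (o k) := (hF₃.reg 18 rfl).trans (by simp [State.setReg])
    have h28' : s₃.reg 28 = s₁.reg 28 := hF₃.reg 28 rfl
    have hX₃ := hX₂.frame hF₃ rfl rfl rfl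
    obtain ⟨h3, h4, h5⟩ := hS.budget
    -- At precision `0` the only budget is `0`, so the dynamic program decides whether the cap is
    -- feasible.
    have hfeas : s₃.reg 27 = 0 ↔ HasSeparator T w c H (c (o k)) := by
      constructor
      · intro h
        refine hS.table.hasSeparator hX₃.layout (k₀ := 0) le_rfl ?_ hz.2
        simpa [h] using h4 (by omega)
      · intro h
        by_contra h6
        have h7 := hS.table.le_of_hasSeparator hX₃.layout h
        have := h5 0 (by omega)
        omega
    refine wp.cond rfl (fun h => ?_) (fun h => ?_)
    · simp only [Expr.eval, h20, h18, h28', ne_eq, mul_eq_zero, not_or] at h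
      refine wp.assign rfl (fun h => h.reg 18) ⟨?_, fun v => ?_⟩
      · simp only [Expr.steps]
        omega
      · have h6 : ((s₃.setReg 28 ((Expr.reg 18).eval s₃)).setReg 29 v).reg 28 = c (o k) := h18
        rw [h6]
        refine ⟨hfeas.1 (by omega), fun j hj hs => ?_⟩
        rcases Nat.lt_succ_iff_lt_or_eq.1 hj with hj | rfl
        · have := h2 j hj hs
          omega
        · exact le_rfl
    · simp only [Expr.eval, h20, h18, h28', mul_eq_zero] at h
      refine wp.skip ⟨?_, fun v => ?_⟩
      · simp only [Expr.steps]
        omega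
      · have h6 : (s₃.setReg 29 v).reg 28 = s₁.reg 28 := h28'
        rw [h6]
        refine ⟨h1, fun j hj hs => ?_⟩
        rcases Nat.lt_succ_iff_lt_or_eq.1 hj with hj | rfl
        · exact h2 j hj hs
        · have := hfeas.2 hs
          omega
  · intro t s₁ hF₁ hB₁ ht ⟨h1, h2⟩
    have h6 : s₀.reg 6 = s.reg 6 := rfl
    rw [h6] at ht h2
    refine ⟨?_, h1, fun u hu => ?_⟩
    · have h3 := Nat.mul_le_mul_right (190 * n + 26 + 8) hX.le
      have hn : 1 ≤ n := (o 0).pos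
      simp only [Expr.steps]
      nlinarith
    · obtain ⟨j, hj, rfl⟩ := (hX.layout.mem_iff u).1 hu
      exact h2 j hj

/-- Register `18` becomes the least multiple of the bottleneck cost for which the dynamic program
finds a separator, if its precision is the number in register `4`. -/
def findScale : Program :=
  .assign 19 (.reg 4) ;; .assign 30 (.lit 0) ;; .assign 20 (.lit 0) ;;
  .loop (.sub (.add (.reg 27) (.lit 1)) (.reg 20))
    (.assign 30 (.add (.reg 30) (.lit 1)) ;; .assign 18 (.mul (.reg 30) (.reg 28)) ;; knapsack)

/-- A failure at scale `j * B` shows that every separator costs more than `j * B`. Some separator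
costs at most `B` per vertex, so success comes within as many trials as there are vertices in `H`.
The first success is at most twice the cost of any separator. -/
theorem findScale_spec (hX : Explored T H o s) (hH : (T.induce H).Preconnected)
    (hw : s.arr 1 = toArray w) (hc : s.arr 0 = toArray c) (hwb : ∑ v, w v ≤ b)
    (hNb : N + 1 ≤ b) (hcb : (∑ v, c v) * N ≤ b) (hcb' : n * ∑ v, c v ≤ b)
    (h12 : s.reg 12 = weight w H) (hpos : 0 < weight w H) (h4 : s.reg 4 = N)
    (hB : IsBottleneck T w c H (s.reg 28)) :
    wp b findScale s fun t s' => t ≤ 230 * n ^ 2 * (N + 1) ∧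
      Solved H o w c (s'.reg 18) N s' ∧ s'.reg 19 = N ∧ s'.reg 27 ≤ N ∧
      ∀ P : Finset (Fin n), (∀ v ∈ P, v ∈ H) → IsSeparator T w H P →
        s'.reg 18 ≤ 2 * ∑ v ∈ P, c v := by
  set B := s.reg 28 with hBdef
  obtain ⟨S, hSB, hS⟩ := hB.1
  have hSH : ∀ v ∈ S, v ∈ H := fun v hv => (hSB v hv).1
  have hSsum : ∑ v ∈ S, c v ≤ s.reg 6 * B := by
    refine (Finset.sum_le_card_nsmul S c B fun v hv => (hSB v hv).2).trans ?_
    exact Nat.mul_le_mul_right _ (hX.layout.card_le hSH)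
  have hBc : B ≤ ∑ v, c v := (hB.le_sum hH hpos hSH hS).trans
    (Finset.sum_le_sum_of_subset (Finset.subset_univ _))
  refine wp.seq (wp.assign rfl (fun h => h.reg 4) ?_)
  refine wp.seq (wp.assign rfl (fun h => h.lit (k := 0)) ?_)
  -- Setting register `20` to zero makes the loop test true at first, whatever register `27`
  -- contains.
  refine wp.seq (wp.assign rfl (fun h => h.lit (k := 0)) ?_)
  refine wp.loop (fun τ s' => τ ≤ s'.reg 30 * (190 * n * (N + 1) + 14) ∧
    ((s'.reg 30 = 0 ∧ s'.reg 20 = 0) ∨ (1 ≤ s'.reg 30 ∧ s'.reg 30 ≤ s.reg 6 ∧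
      s'.reg 18 = s'.reg 30 * B ∧ Solved H o w c (s'.reg 18) N s' ∧
      ∀ P : Finset (Fin n), (∀ v ∈ P, v ∈ H) → IsSeparator T w H P →
        s'.reg 18 ≤ 2 * ∑ v ∈ P, c v)))
    (fun s' => s.reg 6 - s'.reg 30) rfl ?_ ?_ ?_
  · exact ⟨Nat.zero_le _, Or.inl ⟨rfl, rfl⟩⟩
  · rintro τ s₁ hF₁ hB₁ ⟨hτ, hI⟩ hg
    set j := s₁.reg 30 with hj
    have hX₁ : Explored T H o s₁ :=
      Explored.frame (s := ((s.setReg 19 _).setReg 30 _).setReg 20 _)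
        ⟨hX.list, hX.le, hX.layout⟩ hF₁ rfl rfl rfl
    have h28 : s₁.reg 28 = B := hF₁.reg 28 rfl
    have h6 : s₁.reg 6 = s.reg 6 := hF₁.reg 6 rfl
    have hsmall : ∀ P : Finset (Fin n), (∀ v ∈ P, v ∈ H) → IsSeparator T w H P →
        j = 0 ∨ j * B < ∑ v ∈ P, c v := by
      intro P hPH hP
      rcases hI with ⟨h1, h2⟩ | ⟨h1, h2, h3, h5, -⟩
      · exact Or.inl h1
      · right
        by_contra h7
        obtain ⟨k, hk, hk', -⟩ := h5.table.exists_le hX₁.layout hP hPH (by omega)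
        have h8 := h5.budget.2.2 k
        simp only [Expr.eval, h5.size] at hg
        have := h5.budget.1
        have := h8 (by omega)
        omega
    have hjm : j < s.reg 6 := by
      rcases hsmall S hSH hS with h1 | h1
      · rw [h1]
        exact hX.layout.pos
      · exact lt_of_mul_lt_mul_right (h1.trans_le hSsum) (Nat.zero_le _)
    have hv1 : (Expr.add (.reg 30) (.lit 1)).eval s₁ = j + 1 := rfl
    have hv2 : (Expr.mul (.reg 30) (.reg 28)).eval (s₁.setReg 30 (j + 1)) = (j + 1) * B := by
      simp [Expr.eval, State.setReg, h28]
    refine wp.seq (wp.assign rfl (fun h => ?_) ?_)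
    · rw [hv1]
      have := h.reg 6
      omega
    rw [hv1]
    refine wp.seq (wp.assign rfl (fun h => ?_) ?_)
    · rw [hv2]
      have := hX.le
      exact (Nat.mul_le_mul (by omega) hBc).trans hcb'
    rw [hv2]
    set s₂ := (s₁.setReg 30 (j + 1)).setReg 18 ((j + 1) * B)
    have hX₂ : Explored T H o s₂ := ⟨hX₁.list, hX₁.le, hX₁.layout⟩
    refine (knapsack_spec (b := b) (N := N) (B := (j + 1) * B) hX₂
      ((hF₁.arr 1 rfl).trans hw) ((hF₁.arr 0 rfl).trans hc) hwb hNb hcb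
      ((hF₁.reg 12 rfl).trans h12) (by simp [s₂, State.setReg]) ((hF₁.reg 19 rfl).trans h4)).mono ?_
    rintro t s₃ hF₃ hB₃ ⟨ht, hsol⟩
    have h30 : s₃.reg 30 = j + 1 := hF₃.reg 30 rfl
    have h18 : s₃.reg 18 = (j + 1) * B := (hF₃.reg 18 rfl).trans (by simp [s₂, State.setReg])
    rw [h30, h18]
    refine ⟨⟨?_, Or.inr ⟨by omega, hjm, rfl, hsol, fun P hPH hP => ?_⟩⟩, by omega⟩
    · simp only [Expr.steps]
      linarith
    · rcases hsmall P hPH hP with h1 | h1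
      · have := hB.le_sum hH hpos hPH hP
        rw [h1]
        omega
      · have h2 : 1 ≤ j ∨ j = 0 := by omega
        rcases h2 with h2 | h2
        · nlinarith
        · have := hB.le_sum hH hpos hPH hP
          rw [h2]
          omega
  · rintro τ s₁ hF₁ hB₁ ⟨hτ, hI⟩ hg
    simp only [Expr.eval] at hg
    rcases hI with ⟨-, h1⟩ | ⟨h1, h2, h3, h5, h6⟩
    · omega
    · refine ⟨?_, h5, (hF₁.reg 19 rfl).trans h4, ?_, h6⟩
      · have h7 : s₁.reg 30 * (190 * n * (N + 1) + 14) ≤ n * (190 * n * (N + 1) + 14) :=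
          Nat.mul_le_mul_right _ (h2.trans hX.le)
        have hn : 1 ≤ n := (o 0).pos
        have h8 : n * 1 ≤ n * n := Nat.mul_le_mul_left _ hn
        have h9 : n * n * 1 ≤ n * n * (N + 1) := Nat.mul_le_mul_left _ (by omega)
        simp only [Expr.steps]
        nlinarith
      · have := h5.size
        omega

/-- Reconstructs the separator found by the dynamic program and marks it in array `11`. -/
def traceBack : Program :=
  clear 11 10 0 ;; .assign 31 (.lit 0) ;; .assign 32 (.reg 27) ;;
  .loop (.sub (.reg 6) (.reg 31))
    (.assign 24 (.get 6 (.reg 31)) ;;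
    .assign 25 (.div (.mul (.get 0 (.reg 24)) (.reg 19)) (.reg 18)) ;;
    .assign 26 (.get 10 (.add (.mul (.reg 31) (.reg 20)) (.reg 32))) ;;
    .assign 33 (.get 10 (.add (.mul (.get 8 (.reg 31)) (.reg 20)) (.sub (.reg 32) (.reg 25)))) ;;
    .cond (.mul (.mul (.sub (.add (.reg 18) (.lit 1)) (.get 0 (.reg 24)))
          (.sub (.add (.reg 32) (.lit 1)) (.reg 25)))
        (.sub (.lit 1) (.add (.sub (.reg 26) (.reg 33)) (.sub (.reg 33) (.reg 26)))))
      (.store 11 (.reg 24) (.lit 1) ;; .assign 32 (.sub (.reg 32) (.reg 25)) ;;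
        .assign 31 (.get 8 (.reg 31)))
      (.assign 31 (.add (.reg 31) (.lit 1))))

/-- The entries of array `a` that are not zero mark the set `S`. -/
def Marked (a : ℕ) (S : Finset (Fin n)) (s : State) : Prop :=
  ∀ v : Fin n, s.arr a v ≠ 0 ↔ v ∈ S

/-- No choices are stored in the table: comparing an entry with the one after the jump reveals
whether removing the vertex attains it. -/
theorem traceBack_spec (hn : s.reg 0 = n) (hX : Explored T H o s) (hc : s.arr 0 = toArray c)
    (hcb : (∑ v, c v) * N ≤ b) (h18 : s.reg 18 = B) (h19 : s.reg 19 = N)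
    (h27 : s.reg 27 ≤ N) (hS : Solved H o w c B N s) :
    wp b traceBack s fun t s' => t ≤ 120 * n ∧
      ∃ k S, IsTrace (s.reg 6) o (s.arr 8) w c B N (table N s) (s.reg 27) (s.reg 6) k S ∧
        Marked 11 S s' := by
  refine wp.seq ((clear_spec (by decide)).mono ?_)
  rintro t₀ s₀ hF₀ hB₀ ⟨ht₀, h11⟩
  rw [hn] at ht₀ h11
  refine wp.seq (wp.assign rfl (fun h => h.lit (k := 0)) (wp.seq ?_))
  refine wp.assign rfl (fun h => h.reg 27) ?_
  refine wp.loop (fun τ s' => τ ≤ s'.reg 31 * 72 ∧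
    ∃ S, IsTrace (s.reg 6) o (s.arr 8) w c B N (table N s) (s.reg 27) (s'.reg 31) (s'.reg 32) S ∧
      Marked 11 S s') (fun s' => s.reg 6 - s'.reg 31) rfl ?_ ?_ ?_
  · refine ⟨Nat.zero_le _, ∅, ?_, ?_⟩
    · have h1 : ((s₀.setReg 31 ((Expr.lit 0).eval s₀)).setReg 32
        ((Expr.reg 27).eval (s₀.setReg 31 ((Expr.lit 0).eval s₀)))).reg 32 = s.reg 27 :=
        hF₀.reg 27 rfl
      rw [h1]
      exact IsTrace.nil
    · intro v
      have h1 : s₀.arr 11 v = 0 := h11 v v.2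
      exact ⟨fun h => absurd h1 h, fun h => absurd h (Finset.notMem_empty _)⟩
  · rintro τ s₁ hF₁ hB₁ ⟨hτ, S, hT, hM⟩ hg
    set i := s₁.reg 31 with hi
    set k := s₁.reg 32 with hk
    have h6 : s₁.reg 6 = s.reg 6 := (hF₁.reg 6 rfl).trans (hF₀.reg 6 rfl)
    have h8 : s₁.arr 8 = s.arr 8 := (hF₁.arr 8 rfl).trans (hF₀.arr 8 rfl)
    have h10 : s₁.arr 10 = s.arr 10 := (hF₁.arr 10 rfl).trans (hF₀.arr 10 rfl)
    have h0 : s₁.arr 0 = toArray c := ((hF₁.arr 0 rfl).trans (hF₀.arr 0 rfl)).trans hc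
    have h18₁ : s₁.reg 18 = B := ((hF₁.reg 18 rfl).trans (hF₀.reg 18 rfl)).trans h18
    have h19₁ : s₁.reg 19 = N := ((hF₁.reg 19 rfl).trans (hF₀.reg 19 rfl)).trans h19
    have h20₁ : s₁.reg 20 = N + 1 := ((hF₁.reg 20 rfl).trans (hF₀.reg 20 rfl)).trans hS.size
    have him : i < s.reg 6 := by
      simp only [Expr.eval, h6] at hg
      omega
    have hilt := hX.layout.lt i him
    have hkN : k ≤ N := by
      have := hT.cost
      omega
    have hv1 : (Expr.get 6 (.reg 31)).eval s₁ = o i := by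
      have : s₁.arr 6 i = o i := by
        rw [hF₁.arr 6 rfl]
        exact (congrFun (hF₀.arr 6 rfl) i).trans (hX.list i him)
      exact this
    refine wp.seq (wp.assign rfl (fun h => h.arr 6 _) ?_)
    rw [hv1]
    set d := c (o i) * N / B with hd
    have hv2 : (Expr.div (.mul (.get 0 (.reg 24)) (.reg 19)) (.reg 18)).eval
        (s₁.setReg 24 (o i)) = d := by
      simp [Expr.eval, State.setReg, h0, h18₁, h19₁, toArray_coe, hd]
    refine wp.seq (wp.assign rfl (fun _ => ?_) ?_)
    · rw [hv2]
      refine (Nat.div_le_self _ _).trans (le_trans (Nat.mul_le_mul_right _ ?_) hcb)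
      exact Finset.single_le_sum (f := c) (fun _ _ => Nat.zero_le _) (Finset.mem_univ _)
    rw [hv2]
    have hv3 : (Expr.get 10 (.add (.mul (.reg 31) (.reg 20)) (.reg 32))).eval
        ((s₁.setReg 24 (o i)).setReg 25 d) = table N s i k := by
      simp [Expr.eval, State.setReg, h10, h20₁, table, ← hi, ← hk]
    refine wp.seq (wp.assign rfl (fun h => h.arr 10 _) ?_)
    rw [hv3]
    have hv4 : (Expr.get 10 (.add (.mul (.get 8 (.reg 31)) (.reg 20))
        (.sub (.reg 32) (.reg 25)))).eval
        (((s₁.setReg 24 (o i)).setReg 25 d).setReg 26 (table N s i k))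
        = table N s (s.arr 8 i) (k - d) := by
      simp [Expr.eval, State.setReg, h10, h8, h20₁, table, ← hi, ← hk]
    refine wp.seq (wp.assign rfl (fun h => h.arr 10 _) ?_)
    rw [hv4]
    set s₂ := (((s₁.setReg 24 (o i)).setReg 25 d).setReg 26 (table N s i k)).setReg 33
      (table N s (s.arr 8 i) (k - d)) with hs₂
    -- Two numbers are equal exactly if both truncated differences vanish.
    have hguard : (Expr.mul (.mul (.sub (.add (.reg 18) (.lit 1)) (.get 0 (.reg 24)))
          (.sub (.add (.reg 32) (.lit 1)) (.reg 25)))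
        (.sub (.lit 1) (.add (.sub (.reg 26) (.reg 33)) (.sub (.reg 33) (.reg 26))))).eval s₂ ≠ 0
        ↔ c (o i) ≤ B ∧ d ≤ k ∧ table N s i k = table N s (s.arr 8 i) (k - d) := by
      have e1 : s₂.reg 18 = B := h18₁
      have e2 : s₂.reg 24 = o i := by simp [s₂, State.setReg]
      have e3 : s₂.reg 25 = d := by simp [s₂, State.setReg]
      have e4 : s₂.reg 26 = table N s i k := by simp [s₂, State.setReg]
      have e5 : s₂.reg 33 = table N s (s.arr 8 i) (k - d) := by simp [s₂, State.setReg]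
      have e6 : s₂.arr 0 = toArray c := h0
      have e7 : s₂.reg 32 = k := rfl
      simp only [Expr.eval, e1, e2, e3, e4, e5, e6, e7, toArray_coe, ne_eq, mul_eq_zero, not_or]
      generalize table N s i k = x
      generalize table N s (s.arr 8 i) (k - d) = y
      generalize d = d
      omega
    refine wp.cond rfl (fun h => ?_) (fun h => ?_)
    · obtain ⟨e1, e2, e3⟩ := hguard.1 h
      refine wp.seq (wp.store rfl rfl (fun h => h.lit (k := 1)) (wp.seq ?_))
      refine wp.assign rfl (fun h => (Nat.sub_le _ _).trans (h.reg 32)) ?_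
      refine wp.assign rfl (fun h => h.arr 8 _) ?_
      have e25 : s₂.reg 25 = d := by simp [s₂, State.setReg]
      have e24 : s₂.reg 24 = o i := by simp [s₂, State.setReg]
      set s₃ := s₂.setArr 11 ((Expr.reg 24).eval s₂) ((Expr.lit 1).eval s₂) with hs₃
      have f31 : ((s₃.setReg 32 ((Expr.sub (.reg 32) (.reg 25)).eval s₃)).setReg 31
          ((Expr.get 8 (.reg 31)).eval
            (s₃.setReg 32 ((Expr.sub (.reg 32) (.reg 25)).eval s₃)))).reg 31 = s.arr 8 i := by
        have : s₁.arr 8 i = s.arr 8 i := congrFun h8 i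
        exact this
      have f32 : ((s₃.setReg 32 ((Expr.sub (.reg 32) (.reg 25)).eval s₃)).setReg 31
          ((Expr.get 8 (.reg 31)).eval
            (s₃.setReg 32 ((Expr.sub (.reg 32) (.reg 25)).eval s₃)))).reg 32 = k - d := by
        have : k - s₂.reg 25 = k - d := by rw [e25]
        exact this
      rw [f31, f32]
      refine ⟨⟨?_, insert (o i) S, hT.remove hX.layout him e1 e2 e3, fun v => ?_⟩, ?_⟩
      · simp only [Expr.steps]
        omega
      · have e11 : s₃.arr 11 = Function.update (s₁.arr 11) (o i) 1 := by
          simp only [hs₃, State.setArr, Expr.eval, e24, Function.update_self]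
          rfl
        show s₃.arr 11 v ≠ 0 ↔ _
        rw [e11, Function.update_apply, Finset.mem_insert]
        split_ifs with h'
        · simp [Fin.ext h']
        · rw [hM v, or_iff_right fun e => h' (congrArg Fin.val e)]
      · omega
    -- If removal is not allowed or does not attain the minimum, keeping the vertex does.
    · have hstep : table N s i k = w (o i) + table N s (i + 1) k := by
        have h1 := fun h' => hguard.2 h' h
        have h2 := hS.table.step i him k hkN
        simp only [Function.comp] at h2
        rw [← hd] at h2
        split_ifs at h2 with h3
        · rcases min_choice (w (o i) + table N s (i + 1) k) (table N s (s.arr 8 i) (k - d))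
            with h4 | h4
          · rw [h2, h4]
          · exact absurd ⟨h3.1, h3.2, h2.trans h4⟩ h1
        · exact h2
      have f31 : (s₂.setReg 31 ((Expr.add (.reg 31) (.lit 1)).eval s₂)).reg 31 = i + 1 := rfl
      have f32 : (s₂.setReg 31 ((Expr.add (.reg 31) (.lit 1)).eval s₂)).reg 32 = k := rfl
      refine wp.assign rfl (fun h => ?_) ?_
      · have h1 : s₁.reg 6 ≤ b := h.reg 6
        have h2 : (Expr.add (.reg 31) (.lit 1)).eval s₂ = i + 1 := rfl
        omega
      · rw [f31, f32]
        refine ⟨⟨?_, S, hT.keep him hstep, hM⟩, by omega⟩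
        simp only [Expr.steps]
        omega
  · rintro τ s₁ hF₁ hB₁ ⟨hτ, S, hT, hM⟩ hg
    have h6 : s₁.reg 6 = s.reg 6 := (hF₁.reg 6 rfl).trans (hF₀.reg 6 rfl)
    have h31 : s₁.reg 31 = s.reg 6 := by
      simp only [Expr.eval, h6] at hg
      have := hT.le
      omega
    rw [h31] at hT hτ
    refine ⟨?_, _, S, hT, hM⟩
    have := hX.le
    have := (o 0).pos
    simp only [Expr.steps]
    omega

/-- Marks a separator of the explored component, with root in register `5`, in array `11`. -/
def findSeparator : Program :=
  .cond (.reg 12) (findBottleneck ;; findScale ;; traceBack)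
    (clear 11 10 0 ;; .store 11 (.reg 5) (.lit 1))

/-- `S` is a separator of `H` whose cost is at most `β / α` times the cost of any other one. -/
structure IsGoodSeparator (T : SimpleGraph (Fin n)) (w c : Fin n → ℕ) (α β : ℕ)
    (H : Set (Fin n)) (S : Finset (Fin n)) : Prop where
  nonempty : S.Nonempty
  subset : ∀ v ∈ S, v ∈ H
  isSeparator : IsSeparator T w H S
  le : 0 < weight w H → ∀ P : Finset (Fin n), (∀ v ∈ P, v ∈ H) → IsSeparator T w H P →
    α * ∑ v ∈ S, c v ≤ β * ∑ v ∈ P, c v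

/-- `IsTrace.mul_le` bounds c(S)·N by x(N + 2m) for any competing cost `x`, and `hN` turns the
excess 2mx into at most the fraction p/(4q) of xN. -/
theorem findSeparator_spec {p q : ℕ} (hn : s.reg 0 = n) (hX : Explored T H o s)
    (hH : (T.induce H).Preconnected) (hz : IsCentroid T w H (o 0)) (h5 : s.reg 5 = o 0)
    (hw : s.arr 1 = toArray w) (hc : s.arr 0 = toArray c) (hwb : ∑ v, w v ≤ b)
    (hNb : N + 1 ≤ b) (hcb : (∑ v, c v) * N ≤ b) (hcb' : n * ∑ v, c v ≤ b)
    (h12 : s.reg 12 = weight w H) (h4 : s.reg 4 = N) (hq : 0 < q)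
    (hN : 8 * n * q ≤ p * N) :
    wp b findSeparator s fun t s' => t ≤ 600 * n ^ 2 * (N + 1) ∧
      ∃ S, IsGoodSeparator T w c (4 * q) (4 * q + p) H S ∧ Marked 11 S s' := by
  have hn1 : 1 ≤ n := (o 0).pos
  have hnn : n * 1 ≤ n * n := Nat.mul_le_mul_left _ hn1
  have hnN : n * n * 1 ≤ n * n * (N + 1) := Nat.mul_le_mul_left _ (by omega)
  refine wp.cond rfl (fun hW => ?_) (fun hW => ?_)
  · have hpos : 0 < weight w H := by
      rw [← h12]
      exact Nat.pos_of_ne_zero hW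
    refine wp.seq ((findBottleneck_spec hX hz hw hc hwb h12).mono ?_)
    rintro t₁ s₁ hF₁ hB₁ ⟨ht₁, hB⟩
    have hX₁ := hX.frame hF₁ rfl rfl rfl
    refine wp.seq ((findScale_spec (N := N) hX₁ hH ((hF₁.arr 1 rfl).trans hw)
      ((hF₁.arr 0 rfl).trans hc) hwb hNb hcb hcb' ((hF₁.reg 12 rfl).trans h12) hpos
      ((hF₁.reg 4 rfl).trans h4) hB).mono ?_)
    rintro t₂ s₂ hF₂ hB₂ ⟨ht₂, hS, h19, h27, hopt⟩
    have hX₂ := hX₁.frame hF₂ rfl rfl rfl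
    refine (traceBack_spec (((hF₂.reg 0 rfl).trans (hF₁.reg 0 rfl)).trans hn) hX₂
      (((hF₂.arr 0 rfl).trans (hF₁.arr 0 rfl)).trans hc) hcb rfl h19 h27 hS).mono ?_
    rintro t₃ s₃ hF₃ hB₃ ⟨ht₃, k, S, hT, hM⟩
    have hsep := hT.isSeparator hX₂.layout (hS.budget.2.1 h27) hz.2
    refine ⟨?_, S, ⟨?_, hT.subset hX₂.layout, hsep, fun _ P hPH hP => ?_⟩, hM⟩
    · simp only [Expr.steps]
      nlinarith
    · rw [Finset.nonempty_iff_ne_empty]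
      rintro rfl
      have := hsep H le_rfl (by simp) hH
      omega
    · set x := ∑ v ∈ P, c v
      -- A competitor within the scale has a feasible rounded budget, which is no smaller than the
      -- least one. Above the scale the bound `N` on the budget suffices.
      have hbud : s₂.reg 27 * s₂.reg 18 ≤ x * N := by
        by_cases hle : x ≤ s₂.reg 18
        · obtain ⟨l, hl, hl', hl''⟩ := hS.table.exists_le hX₂.layout hP hPH hle
          refine le_trans (Nat.mul_le_mul_right _ ?_) hl''
          by_contra hlt
          have := hS.budget.2.2 l (by omega)
          omega
        · rw [mul_comm]
          exact Nat.mul_le_mul (by omega) h27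
      have h1 := hT.mul_le hX₂.layout hbud (hopt P hPH hP)
      have hN0 : 0 < N := by
        rcases Nat.eq_zero_or_pos N with rfl | h
        · have : 0 < n * q := Nat.mul_pos hn1 hq
          nlinarith
        · exact h
      refine Nat.le_of_mul_le_mul_right ?_ hN0
      have h2 := Nat.mul_le_mul_left (4 * q) h1
      have h3 : 8 * s₂.reg 6 * q ≤ p * N :=
        le_trans (Nat.mul_le_mul_right _ (Nat.mul_le_mul_left _ hX₂.le)) hN
      have h4 := Nat.mul_le_mul_left x h3
      calc 4 * q * (∑ v ∈ S, c v) * N = 4 * q * ((∑ v ∈ S, c v) * N) := by ring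
        _ ≤ _ := h2
        _ = 4 * q * x * N + x * (8 * s₂.reg 6 * q) := by ring
        _ ≤ 4 * q * x * N + x * (p * N) := Nat.add_le_add_left h4 _
        _ = (4 * q + p) * x * N := by ring
  -- Without weight nothing is charged, but some vertex must be queried to make progress.
  · have hzero : weight w H = 0 := by
      rw [← h12]
      exact hW
    refine wp.seq ((clear_spec (by decide)).mono ?_)
    rintro t₀ s₀ hF₀ hB₀ ⟨ht₀, h11⟩
    rw [hn] at ht₀ h11
    have h5₀ : s₀.reg 5 = o 0 := (hF₀.reg 5 rfl).trans h5
    refine wp.store rfl rfl (fun h => h.lit (k := 1)) ⟨?_, {o 0}, ⟨by simp, ?_, ?_, ?_⟩, ?_⟩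
    · simp only [Expr.steps]
      nlinarith
    · intro v hv
      obtain rfl := Finset.mem_singleton.1 hv
      exact hz.1
    · intro C hC _ _
      have := weight_mono w hC
      omega
    · intro h
      omega
    · intro v
      have e11 : (s₀.setArr 11 ((Expr.reg 5).eval s₀) ((Expr.lit 1).eval s₀)).arr 11
          = Function.update (s₀.arr 11) (o 0) 1 := by
        simp only [State.setArr, Expr.eval, h5₀, Function.update_self]
      rw [e11, Function.update_apply, Finset.mem_singleton]
      split_ifs with h
      · simp [Fin.ext h]
      · simp [h11 v v.2, Fin.ext_iff, h]

end Separator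

/-! ### The algorithm -/

section Algorithm

variable {n : ℕ} {T : SimpleGraph (Fin n)} {R H : Set (Fin n)} {b : ℕ} {s : State}
  {w c : Fin n → ℕ}

/-- The label of `u` as a parent. -/
def label (u : Fin n) : ℕ := u + 1

/-- The arrays `3` and `4` represent the stage `σ` of an elimination, and register `3` counts the
vertices that are still alive. -/
structure AtStage (T : SimpleGraph (Fin n)) (σ : Stage (Fin n)) (s : State) : Prop where
  env : Env T σ.alive s
  parent : ∀ v : Fin n, s.arr 3 v = σ.parent v
  count : s.reg 3 = σ.alive.ncard

theorem AtStage.frame {P : Program} {s' : State} {σ : Stage (Fin n)} (h : AtStage T σ s)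
    (hF : Frame P s s') (h0 : P.writesReg 0 = false) (h3 : P.writesReg 3 = false)
    (h2 : P.writesArr 2 = false) (h3' : P.writesArr 3 = false) (h4 : P.writesArr 4 = false) :
    AtStage T σ s' where
  env := h.env.frame hF h0 h2 h4
  parent v := by
    rw [hF.arr 3 h3']
    exact h.parent v
  count := (hF.reg 3 h3).trans h.count

/-- Queries the vertex in register `34`. -/
def queryVertex : Program :=
  .assign 5 (.reg 34) ;; search ;;
  .forLoop 35 6 (.cond (.reg 35)
    (.store 3 (.get 6 (.reg 35)) (.add (.reg 34) (.lit 1))) .skip) ;;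
  .store 4 (.reg 34) (.lit 1) ;; .assign 3 (.sub (.reg 3) (.lit 1))

/-- A search from `v` lists exactly the component that gets the label of `v`. Position `0`, which is
`v` itself, is skipped because `v` keeps the label of its own parent. -/
theorem queryVertex_spec {σ : Stage (Fin n)} (h : AtStage T σ s) {v : Fin n} (hv : s.reg 34 = v)
    (hvR : v ∈ σ.alive) :
    wp b queryVertex s fun t s' => t ≤ 190 * n ^ 3 ∧ AtStage T (σ.query T c label v) s' := by
  classical
  have hn : 1 ≤ n := v.pos
  refine wp.seq (wp.assign rfl (fun h => h.reg 34) (wp.seq ?_))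
  have hE : Env T σ.alive (s.setReg 5 ((Expr.reg 34).eval s)) :=
    ⟨h.env.size, h.env.adj, h.env.alive⟩
  refine (search_spec hE (z := v) hv hvR).mono ?_
  rintro t₁ s₁ hF₁ hB₁ ⟨ht₁, o, hS⟩
  have h34 : s₁.reg 34 = v := (hF₁.reg 34 rfl).trans hv
  have hE₁ := hE.frame hF₁ rfl rfl rfl
  have h3₁ : s₁.arr 3 = s.arr 3 := hF₁.arr 3 rfl
  have hmem : ∀ x, x ∈ component T σ.alive v ↔ ∃ i < s₁.reg 6, o i = x := fun x =>
    hS.order.mem_component_iff hS.pos hS.closed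
  refine wp.seq ?_
  refine wp.forLoop 8 (fun k s' => ∀ x : Fin n, s'.arr 3 x =
    if ∃ i < k, i < s₁.reg 6 ∧ 0 < i ∧ o i = x then (v : ℕ) + 1 else σ.parent x)
    rfl rfl (by decide) ?_ ?_ ?_
  · intro _ x
    have e : s₁.arr 3 x = σ.parent x := (congrFun h3₁ x).trans (h.parent x)
    rw [if_neg (by rintro ⟨i, hi, -⟩; omega)]
    exact e
  · intro k hk s₂ hF₂ hB₂ hk₂ hI
    have h34₂ : s₂.reg 34 = v := (hF₂.reg 34 rfl).trans h34
    have h6 : s₂.arr 6 k = o k := by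
      rw [hF₂.arr 6 rfl]
      exact hS.list k hk
    refine wp.cond rfl (fun h => ?_) (fun h => ?_)
    · have hk0 : 0 < k := by
        simp only [Expr.eval, hk₂] at h
        omega
      refine wp.store rfl rfl (fun hb => ?_) ⟨by decide, fun y x => ?_⟩
      · have h1 := hb.reg 0
        rw [hF₂.reg 0 rfl, hE₁.size] at h1
        have h2 := v.2
        simp only [Expr.eval, h34₂]
        omega
      · have e3 : ((s₂.setArr 3 ((Expr.get 6 (.reg 35)).eval s₂)
            ((Expr.add (.reg 34) (.lit 1)).eval s₂)).setReg 35 y).arr 3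
            = Function.update (s₂.arr 3) (o k) (v + 1) := by
          simp [State.setArr, State.setReg, Expr.eval, hk₂, h6, h34₂]
        rw [e3, Function.update_apply]
        split_ifs with h1 h2 h2
        · rfl
        · exact absurd ⟨k, by omega, hk, hk0, Fin.ext h1.symm⟩ h2
        · obtain ⟨i, hi, hi6, hi0, rfl⟩ := h2
          have hik : i ≠ k := fun h => h1 (by rw [h])
          rw [hI, if_pos ⟨i, by omega, hi6, hi0, rfl⟩]
        · rw [hI, if_neg]
          rintro ⟨i, hi, hi'⟩
          exact h2 ⟨i, by omega, hi'⟩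
    · have hk0 : k = 0 := by
        simp only [Expr.eval, hk₂] at h
        omega
      refine wp.skip ⟨by decide, fun y x => ?_⟩
      refine (hI x).trans ?_
      congr 1
      subst hk0
      simp only [eq_iff_iff]
      constructor
      · rintro ⟨i, hi, hi'⟩
        exact ⟨i, by omega, hi'⟩
      · rintro ⟨i, hi, -, hi0, -⟩
        omega
  · intro t₂ s₂ hF₂ hB₂ ht₂ hI
    have hE₂ := hE₁.frame hF₂ rfl rfl rfl
    have h34₂ : s₂.reg 34 = v := (hF₂.reg 34 rfl).trans h34
    have h3 : s₂.reg 3 = σ.alive.ncard := ((hF₂.reg 3 rfl).trans (hF₁.reg 3 rfl)).trans h.count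
    refine wp.seq (wp.store rfl rfl (fun h => h.lit (k := 1)) ?_)
    refine wp.assign rfl (fun h => (Nat.sub_le _ _).trans (h.reg 3)) ⟨?_, ⟨?_, ?_, ?_⟩, ?_, ?_⟩
    · have h1 := Nat.mul_le_mul_right (8 + 8) hS.le
      have h2 : n ≤ n ^ 3 := Nat.le_self_pow (by norm_num) n
      simp only [Expr.steps]
      omega
    · exact hE₂.size
    · exact hE₂.adj
    · intro x
      have e4 : (s₂.setArr 4 ((Expr.reg 34).eval s₂) ((Expr.lit 1).eval s₂)).arr 4
          = Function.update (s₂.arr 4) v 1 := by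
        simp [State.setArr, Expr.eval, h34₂]
      show (s₂.setArr 4 ((Expr.reg 34).eval s₂) ((Expr.lit 1).eval s₂)).arr 4 x = 0 ↔ _
      rw [e4, Function.update_apply]
      simp only [Stage.query, Set.mem_sdiff, Set.mem_singleton_iff]
      split_ifs with h1
      · simp [Fin.ext h1]
      · rw [hE₂.alive x]
        exact ⟨fun h2 => ⟨h2, fun h3 => h1 (congrArg Fin.val h3)⟩, fun h2 => h2.1⟩
    · intro x
      refine (hI x).trans ?_
      simp only [Stage.query, label]
      congr 1
      rw [hmem, eq_iff_iff]
      constructor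
      · rintro ⟨i, hi, -, hi0, rfl⟩
        refine ⟨⟨i, hi, rfl⟩, fun h1 => ?_⟩
        rw [← hS.order.zero hS.pos] at h1
        have := hS.order.inj i hi 0 hS.pos h1
        omega
      · rintro ⟨⟨i, hi, rfl⟩, h1⟩
        refine ⟨i, hi, hi, Nat.pos_of_ne_zero fun h2 => h1 ?_, rfl⟩
        rw [h2]
        exact hS.order.zero hS.pos
    · have e3 : ((s₂.setArr 4 ((Expr.reg 34).eval s₂) ((Expr.lit 1).eval s₂)).setReg 3
          ((Expr.sub (.reg 3) (.lit 1)).eval (s₂.setArr 4 ((Expr.reg 34).eval s₂)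
            ((Expr.lit 1).eval s₂)))).reg 3 = s₂.reg 3 - 1 := rfl
      rw [e3, h3]
      simp only [Stage.query]
      rw [Set.ncard_sdiff_singleton_of_mem hvR]

/-- Queries the vertices that are marked in array `11`. -/
def queryMarked : Program :=
  .forLoop 34 0 (.cond (.get 11 (.reg 34)) queryVertex .skip)

/-- Whatever the order of the queries, the component of a marked vertex at its turn is contained in
`H`, so each query is paid by at most the weight of `H`. -/
theorem queryMarked_spec {σ : Stage (Fin n)} (h : AtStage T σ s) (hH : IsComponent T σ.alive H)
    {S : Finset (Fin n)} (hSH : ∀ v ∈ S, v ∈ H) (hM : Marked 11 S s) :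
    wp b queryMarked s fun t s' => t ≤ 12 * n + 6 + S.card * (190 * n ^ 3) ∧
      ∃ τ, Relation.ReflTransGen (Stage.Step T c label) σ τ ∧ AtStage T τ s' ∧
        τ.alive = σ.alive \ S ∧
        ∑ x, w x * τ.pay x ≤ ∑ x, w x * σ.pay x + weight w H * ∑ v ∈ S, c v := by
  classical
  refine wp.forLoop_time (fun k t s' =>
    t ≤ k * 12 + (S.filter fun v : Fin n => (v : ℕ) < k).card * (190 * n ^ 3) ∧
      ∃ τ, Relation.ReflTransGen (Stage.Step T c label) σ τ ∧ AtStage T τ s' ∧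
        τ.alive = σ.alive \ (S.filter fun v : Fin n => (v : ℕ) < k : Finset (Fin n)) ∧
        ∑ x, w x * τ.pay x ≤ ∑ x, w x * σ.pay x +
          weight w H * ∑ v ∈ S.filter (fun v : Fin n => (v : ℕ) < k), c v)
    rfl rfl (by decide) ?_ ?_ ?_
  · intro v
    exact ⟨Nat.zero_le _, σ, .refl, ⟨⟨h.env.size, h.env.adj, h.env.alive⟩, h.parent, h.count⟩,
      by simp, by simp⟩
  · rintro k hk t s₁ hF₁ hB₁ hk₁ ⟨ht, τ, hστ, hτ, halive, hpay⟩
    have hkn : k < n := by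
      rw [h.env.size] at hk
      exact hk
    set v : Fin n := ⟨k, hkn⟩ with hv
    have h11 : s₁.arr 11 = s.arr 11 := hF₁.arr 11 rfl
    have hg : (Expr.get 11 (.reg 34)).eval s₁ ≠ 0 ↔ v ∈ S := by
      simp only [Expr.eval, hk₁, h11]
      exact hM v
    have hnot : v ∉ S.filter fun u : Fin n => (u : ℕ) < k := by simp [hv]
    refine wp.cond rfl (fun h1 => ?_) (fun h1 => ?_)
    · have hvS := hg.1 h1
      have hfil : (S.filter fun u : Fin n => (u : ℕ) < k + 1) = insert v (S.filter fun u : Fin n => (u : ℕ) < k) := by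
        ext u
        simp only [Finset.mem_filter, Finset.mem_insert, Fin.ext_iff, hv]
        constructor
        · rintro ⟨h2, h3⟩
          by_cases h4 : (u : ℕ) = k
          · exact Or.inl h4
          · exact Or.inr ⟨h2, by omega⟩
        · rintro (h2 | ⟨h2, h3⟩)
          · have : u = v := Fin.ext h2
            exact ⟨this ▸ hvS, by omega⟩
          · exact ⟨h2, by omega⟩
      have hvR : v ∈ τ.alive := by
        rw [halive]
        exact ⟨hH.subset (hSH v hvS), by simpa using hnot⟩
      refine (queryVertex_spec (c := c) hτ hk₁ hvR).mono ?_
      rintro t' s₂ hF₂ hB₂ ⟨ht', hτ'⟩ y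
      rw [hfil, Finset.card_insert_of_notMem hnot, Finset.sum_insert hnot]
      refine ⟨?_, _, hστ.tail ⟨v, hvR, rfl⟩,
        ⟨⟨hτ'.env.size, hτ'.env.adj, hτ'.env.alive⟩, hτ'.parent, hτ'.count⟩, ?_, ?_⟩
      · simp only [Expr.steps]
        nlinarith
      · simp only [Stage.query, halive]
        ext u
        simp only [Set.mem_sdiff, Set.mem_singleton_iff, Finset.coe_insert, Set.mem_insert_iff]
        tauto
      · have h2 : ∑ x, w x * (τ.query T c label v).pay x
            = ∑ x, w x * τ.pay x + weight w (component T τ.alive v) * c v := by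
          simp only [Stage.query, mul_add, Finset.sum_add_distrib, mul_ite, mul_zero]
          rw [weight, Finset.sum_mul, Finset.sum_filter]
        have h3 : weight w (component T τ.alive v) ≤ weight w H := by
          refine weight_mono w ?_
          rw [hH.eq_component (hSH v hvS)]
          refine component_mono ?_
          rw [halive]
          exact Set.sdiff_subset
        have h4 := Nat.mul_le_mul_right (c v) h3
        rw [h2, mul_add]
        omega
    · have hvS : v ∉ S := fun h2 => hg.2 h2 h1
      have hfil : (S.filter fun u : Fin n => (u : ℕ) < k + 1) = S.filter fun u : Fin n => (u : ℕ) < k := by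
        ext u
        simp only [Finset.mem_filter]
        refine and_congr_right fun h2 => ?_
        have : (u : ℕ) ≠ k := fun h3 => hvS (by rwa [← show u = v from Fin.ext h3])
        omega
      refine wp.skip fun y => ?_
      rw [hfil]
      refine ⟨?_, τ, hστ, ⟨⟨hτ.env.size, hτ.env.adj, hτ.env.alive⟩, hτ.parent, hτ.count⟩,
        halive, hpay⟩
      simp only [Expr.steps]
      omega
  · rintro t s₁ hF₁ hB₁ ⟨ht, τ, hτ⟩
    have hfil : (S.filter fun u : Fin n => (u : ℕ) < s.reg 0) = S := by
      rw [h.env.size]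
      exact Finset.filter_true_of_mem fun u _ => u.2
    rw [hfil] at ht hτ
    refine ⟨?_, τ, hτ⟩
    rw [h.env.size] at ht
    omega

/-- Register `5` becomes a vertex that is still alive. -/
def findAlive : Program :=
  .forLoop 34 0 (.cond (.sub (.lit 1) (.get 4 (.reg 34))) (.assign 5 (.reg 34)) .skip)

theorem findAlive_spec (h : Env T R s) (hR : R.Nonempty) :
    wp b findAlive s fun t s' => t ≤ 16 * n + 6 ∧ ∃ v ∈ R, s'.reg 5 = (v : ℕ) := by
  refine wp.forLoop 8 (fun k s' => (∃ v ∈ R, (v : ℕ) < k) → ∃ v ∈ R, s'.reg 5 = (v : ℕ))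
    rfl rfl (by decide) (by simp) ?_ ?_
  · intro k hk s₁ hF₁ hB₁ hk₁ hI
    have hkn : k < n := by
      rw [h.size] at hk
      exact hk
    have h4 : s₁.arr 4 = s.arr 4 := hF₁.arr 4 rfl
    have hv := h.alive ⟨k, hkn⟩
    refine wp.cond rfl (fun h1 => ?_) (fun h1 => ?_)
    · refine wp.assign rfl (fun h => h.reg 34) ⟨by decide, fun _ _ => ⟨⟨k, hkn⟩, ?_, hk₁⟩⟩
      simp only [Expr.eval, hk₁, h4] at h1
      exact hv.1 (show s.arr 4 k = 0 by omega)
    · refine wp.skip ⟨by decide, fun _ ⟨v, hvR, hvk⟩ => ?_⟩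
      rcases Nat.lt_succ_iff_lt_or_eq.1 hvk with h2 | h2
      · exact hI ⟨v, hvR, h2⟩
      · obtain rfl : v = ⟨k, hkn⟩ := Fin.ext h2
        have := hv.2 hvR
        simp only [Expr.eval, hk₁, h4] at h1
        have h5 : s.arr 4 k = 0 := this
        omega
  · intro t s₁ hF₁ hB₁ ht hI
    rw [h.size] at ht hI
    obtain ⟨v, hv⟩ := hR
    exact ⟨by omega, hI ⟨v, hv, v.2⟩⟩

/-- Queries a separator of one of the components of the alive vertices. -/
def round : Program :=
  findAlive ;; explore ;; findCentroid ;; .assign 5 (.reg 17) ;; explore ;; findSeparator ;;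
  queryMarked

/-- The time is stated per vertex of `S` so that it can be amortized over the vertices removed. The
second exploration roots the layout at the centroid, as the dynamic program needs. -/
theorem round_spec {N p q : ℕ} {σ : Stage (Fin n)} (hT : T.IsAcyclic) (h : AtStage T σ s)
    (hne : σ.alive.Nonempty) (hw : s.arr 1 = toArray w) (hc : s.arr 0 = toArray c)
    (hwb : ∑ v, w v ≤ b) (hNb : N + 1 ≤ b) (hcb : (∑ v, c v) * N ≤ b)
    (hcb' : n * ∑ v, c v ≤ b) (h4 : s.reg 4 = N) (hq : 0 < q) (hN : 8 * n * q ≤ p * N) :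
    wp b round s fun t s' => ∃ (τ : Stage (Fin n)) (H : Set (Fin n)) (S : Finset (Fin n)),
      IsComponent T σ.alive H ∧ IsGoodSeparator T w c (4 * q) (4 * q + p) H S ∧
      t ≤ S.card * (800 * n ^ 3 + 600 * n ^ 2 * (N + 1)) ∧
      Relation.ReflTransGen (Stage.Step T c label) σ τ ∧ AtStage T τ s' ∧
      τ.alive = σ.alive \ S ∧
      ∑ x, w x * τ.pay x ≤ ∑ x, w x * σ.pay x + weight w H * ∑ v ∈ S, c v := by
  refine wp.seq ((findAlive_spec h.env hne).mono ?_)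
  rintro t₁ s₁ hF₁ hB₁ ⟨ht₁, x, hxR, hx⟩
  have h₁ := h.frame hF₁ rfl rfl rfl rfl rfl
  refine wp.seq ((explore_spec hT h₁.env hx hxR).mono ?_)
  rintro t₂ s₂ hF₂ hB₂ ⟨ht₂, o, ho, hX⟩
  have h₂ := h₁.frame hF₂ rfl rfl rfl rfl rfl
  set H := component T σ.alive x with hHdef
  have hH : IsComponent T σ.alive H := ⟨x, hxR, rfl⟩
  have hw₂ : s₂.arr 1 = toArray w := ((hF₂.arr 1 rfl).trans (hF₁.arr 1 rfl)).trans hw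
  refine wp.seq ((findCentroid_spec hX hw₂ hwb (by rw [ho, hF₂.reg 5 rfl, hx])).mono ?_)
  rintro t₃ s₃ hF₃ hB₃ ⟨ht₃, h12, z, hz, hzc⟩
  have h₃ := h₂.frame hF₃ rfl rfl rfl rfl rfl
  refine wp.seq (wp.assign rfl (fun h => h.reg 17) (wp.seq ?_))
  set s₄ := s₃.setReg 5 ((Expr.reg 17).eval s₃)
  have h₄ : AtStage T σ s₄ :=
    ⟨⟨h₃.env.size, h₃.env.adj, h₃.env.alive⟩, h₃.parent, h₃.count⟩
  refine (explore_spec hT h₄.env (z := z) hz (hH.subset hzc.1)).mono ?_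
  rintro t₅ s₅ hF₅ hB₅ ⟨ht₅, o', ho', hX'⟩
  rw [← hH.eq_component hzc.1] at hX'
  have h₅ := h₄.frame hF₅ rfl rfl rfl rfl rfl
  have e5 : s₅.reg 5 = o' 0 := by
    rw [hF₅.reg 5 rfl, ho']
    exact hz
  have e1 : s₅.arr 1 = toArray w := ((hF₅.arr 1 rfl).trans (hF₃.arr 1 rfl)).trans hw₂
  have e0 : s₅.arr 0 = toArray c := ((((hF₅.arr 0 rfl).trans (hF₃.arr 0 rfl)).trans
    (hF₂.arr 0 rfl)).trans (hF₁.arr 0 rfl)).trans hc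
  have e12 : s₅.reg 12 = weight w H := (hF₅.reg 12 rfl).trans h12
  have e4 : s₅.reg 4 = N := ((((hF₅.reg 4 rfl).trans (hF₃.reg 4 rfl)).trans
    (hF₂.reg 4 rfl)).trans (hF₁.reg 4 rfl)).trans h4
  refine wp.seq ((findSeparator_spec (p := p) (q := q) (N := N) h₅.env.size hX' hH.preconnected
    (ho'.symm ▸ hzc) e5 e1 e0 hwb hNb hcb hcb' e12 e4 hq hN).mono ?_)
  rintro t₆ s₆ hF₆ hB₆ ⟨ht₆, S, hS, hM⟩
  have h₆ := h₅.frame hF₆ rfl rfl rfl rfl rfl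
  refine (queryMarked_spec (w := w) (c := c) h₆ hH hS.subset hM).mono ?_
  rintro t₇ s₇ hF₇ hB₇ ⟨ht₇, τ, hτ⟩
  refine ⟨τ, H, S, hH, hS, ?_, hτ⟩
  have hcard : 1 ≤ S.card := hS.nonempty.card_pos
  have hn : 1 ≤ n := z.pos
  have a1 : n ≤ n ^ 3 := Nat.le_self_pow (by norm_num) n
  have a2 : n ^ 2 ≤ n ^ 3 := Nat.pow_le_pow_right hn (by norm_num)
  have a3 : 1 ≤ n ^ 3 := Nat.one_le_pow _ _ hn
  have a4 : 610 * n ^ 3 + 600 * n ^ 2 * (N + 1)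
      ≤ S.card * (610 * n ^ 3 + 600 * n ^ 2 * (N + 1)) := Nat.le_mul_of_pos_left _ hcard
  simp only [Expr.steps]
  nlinarith

/-- The approximation algorithm. -/
def algorithm : Program :=
  .assign 3 (.reg 0) ;;
  .assign 4 (.add (.div (.mul (.mul (.lit 8) (.reg 0)) (.reg 2)) (.reg 1)) (.lit 1)) ;;
  .loop (.reg 3) round

theorem algorithm_spec {N p q : ℕ} (hT : T.IsAcyclic) (hp : 0 < p) (hq : 0 < q)
    (hN : N = 8 * n * q / p + 1) (hwb : ∑ v, w v ≤ b) (hNb : N + 1 ≤ b)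
    (hcb : (∑ v, c v) * N ≤ b) (hcb' : n * ∑ v, c v ≤ b) :
    wp b algorithm (input T c w p q) fun t s' =>
      t ≤ n * (810 * n ^ 3 + 600 * n ^ 2 * (N + 1)) + 20 ∧
      ∃ τ : Stage (Fin n), τ.alive = ∅ ∧
        Relation.ReflTransGen (Stage.Step T c label) ⟨Set.univ, fun _ => 0, fun _ => 0⟩ τ ∧
        (∀ v : Fin n, s'.arr 3 v = τ.parent v) ∧
        ∀ D : DecisionTree T Set.univ,
          4 * q * ∑ x, w x * τ.pay x ≤ 4 * (4 * q + p) * D.cost c w := by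
  have hN' : 8 * n * q ≤ p * N := by
    rw [hN]
    exact (Nat.lt_mul_div_succ _ hp).le
  refine wp.seq (wp.assign rfl (fun h => h.reg 0) (wp.seq ?_))
  have hv : (Expr.add (.div (.mul (.mul (.lit 8) (.reg 0)) (.reg 2)) (.reg 1)) (.lit 1)).eval
      ((input T c w p q).setReg 3 ((Expr.reg 0).eval (input T c w p q))) = N := by
    simp [Expr.eval, State.setReg, input, hN]
  refine wp.assign rfl (fun _ => by rw [hv]; omega) ?_
  rw [hv]
  set s₀ := ((input T c w p q).setReg 3 ((Expr.reg 0).eval (input T c w p q))).setReg 4 N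
  set K := 810 * n ^ 3 + 600 * n ^ 2 * (N + 1) with hK
  -- Each vertex brings a credit of `K` steps that is spent when it is queried. The charging is
  -- maintained for all decision trees at once, since the optimum is unknown to the program.
  refine wp.loop (fun t s' => t + s'.reg 3 * K ≤ n * K ∧
    ∃ τ : Stage (Fin n),
      Relation.ReflTransGen (Stage.Step T c label) ⟨Set.univ, fun _ => 0, fun _ => 0⟩ τ ∧
      AtStage T τ s' ∧
      ∀ D : DecisionTree T Set.univ, Charged D c w (4 * q) (4 * q + p) τ.alive τ.pay)
    (fun s' => s'.reg 3) rfl ?_ ?_ ?_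
  · refine ⟨?_, _, .refl, ⟨⟨rfl, rfl, ?_⟩, fun _ => rfl, ?_⟩, fun D => Charged.zero D c w _ _ _⟩
    · have : s₀.reg 3 = n := rfl
      rw [this]
      omega
    · intro v
      exact ⟨fun _ => trivial, fun _ => rfl⟩
    · have : s₀.reg 3 = n := rfl
      rw [this]
      simp [Set.ncard_univ]
  · rintro t s₁ hF₁ hB₁ ⟨ht, σ, hσ, hst, hch⟩ hg
    have hne : σ.alive.Nonempty := by
      rw [Set.nonempty_iff_ne_empty]
      intro h
      simp [Expr.eval, hst.count, h] at hg
    refine (round_spec (N := N) (p := p) (q := q) hT hst hne ((hF₁.arr 1 rfl).trans rfl)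
      ((hF₁.arr 0 rfl).trans rfl) hwb hNb hcb hcb' ((hF₁.reg 4 rfl).trans rfl) hq hN').mono ?_
    rintro t' s₂ hF₂ hB₂ ⟨τ, H, S, hH, hS, ht', hτ, hst', halive, hpay⟩
    have hcount : s₂.reg 3 + S.card = s₁.reg 3 := by
      rw [hst'.count, hst.count, halive, ← Set.ncard_coe_finset S]
      exact Set.ncard_sdiff_add_ncard_of_subset fun v hv => hH.subset (hS.subset v hv)
    have hcard : 1 ≤ S.card := hS.nonempty.card_pos
    refine ⟨⟨?_, τ, hσ.trans hτ, hst', fun D => ?_⟩, by omega⟩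
    · have hn : 1 ≤ n := by
        obtain ⟨v, -⟩ := hne
        exact v.pos
      have a3 : 1 ≤ n ^ 3 := Nat.one_le_pow _ _ hn
      have a4 : 10 * n ^ 3 ≤ S.card * (10 * n ^ 3) := Nat.le_mul_of_pos_left _ hcard
      have a5 : S.card * (800 * n ^ 3 + 600 * n ^ 2 * (N + 1)) + S.card * (10 * n ^ 3)
          = S.card * K := by
        rw [hK]
        ring
      rw [← hcount, add_mul] at ht
      simp only [Expr.steps]
      omega
    · exact (hch D).step hH hS.isSeparator hS.le hpay halive.le
  · rintro t s₁ hF₁ hB₁ ⟨ht, τ, hτ, hst, hch⟩ hg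
    refine ⟨?_, τ, ?_, hτ, hst.parent, fun D => (hch D).le⟩
    · simp only [Expr.steps]
      omega
    · have h1 : τ.alive.ncard = 0 := by
        rw [← hst.count]
        exact hg
      exact (Set.ncard_eq_zero (Set.toFinite _)).1 h1

theorem isComponent_univ (hT : T.Connected) : IsComponent T Set.univ Set.univ := by
  obtain ⟨x⟩ := hT.nonempty
  have h : (T.induce Set.univ).Preconnected :=
    (SimpleGraph.Iso.connected_iff (SimpleGraph.induceUnivIso T)).2 hT |>.preconnected
  exact ⟨x, trivial, (subset_component h le_rfl (Set.mem_univ x)).antisymm component_subset⟩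

theorem input_bdd {p q : ℕ} (b : ℕ) (h16 : 16 ≤ b) (hb : n + ∑ v, c v + ∑ v, w v + p + q ≤ b) :
    Bdd b (input T c w p q) where
  sixteen_le := h16
  reg x := by
    simp only [input]
    split <;> omega
  arr a i := by
    have h : ∀ f : Fin n → ℕ, toArray f i ≤ ∑ v, f v := fun f => by
      rw [toArray]
      split_ifs with h
      · exact Finset.single_le_sum (f := f) (fun _ _ => Nat.zero_le _) (Finset.mem_univ _)
      · exact Nat.zero_le _
    simp only [input]
    split
    · have := h c
      omega
    · have := h w
      omega
    · rw [adjArray]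
      split_ifs <;> omega
    · exact Nat.zero_le _

end Algorithm

end TreeSearch

/-! ### The main theorem -/

open TreeSearch in
theorem mainTheorem1 :
    ∃ (P : TreeSearch.Program) (κ : ℕ) (C : ℝ),
      ∀ (ε : ℝ), 0 < ε →
      ∀ (p q : ℕ), 0 < p → 0 < q → (p : ℝ) / q ≤ ε → ε ≤ 2 * ((p : ℝ) / q) →
      ∀ (n : ℕ) (T : SimpleGraph (Fin n)), T.IsTree → ∀ (c w : Fin n → ℕ),
        ∃ (t : ℕ) (s : TreeSearch.State) (D : TreeSearch.DecisionTree T Set.univ),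
          TreeSearch.Runs (TreeSearch.wordBound κ c w p q) P (TreeSearch.input T c w p q) t s ∧
          (t : ℝ) ≤ C * ((n : ℝ) ^ 4 * (1 + 1 / ε ^ 2)) ∧
          TreeSearch.Outputs s D ∧
          (D.cost c w : ℝ) ≤ (4 + ε) * (TreeSearch.opt T c w : ℝ) := by
  -- Stored numbers are at most `X ^ 6` and computed ones at most its eighth power, whence `48`. The
  -- constant `12000` absorbs `810 + 9600 + 1200 + 20`.
  refine ⟨algorithm, 48, 12000, fun ε hε p q hp hq hpq hεpq n T hT c w => ?_⟩
  have hn : 1 ≤ n := by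
    obtain ⟨x⟩ := hT.connected.nonempty
    exact x.pos
  set X := n + ∑ v, c v + ∑ v, w v + p + q + 2 with hX
  set N := 8 * n * q / p + 1 with hN
  have hX5 : 5 ≤ X := by omega
  have hX6 : X ≤ X ^ 6 := Nat.le_self_pow (by norm_num) X
  have hX26 : 25 * X ^ 3 ≤ X ^ 6 := by
    have h1 : 5 ^ 2 * X ^ 3 ≤ X ^ 3 * X ^ 3 := Nat.mul_le_mul_right _
      ((Nat.pow_le_pow_left hX5 2).trans (Nat.pow_le_pow_right (by omega) (by norm_num)))
    calc 25 * X ^ 3 = 5 ^ 2 * X ^ 3 := by norm_num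
      _ ≤ X ^ 3 * X ^ 3 := h1
      _ = X ^ 6 := by ring
  have hX23 : X ^ 2 ≤ X ^ 3 := Nat.pow_le_pow_right (by omega) (by norm_num)
  have hXX : X ≤ X ^ 2 := Nat.le_self_pow (by norm_num) X
  have hNX : N ≤ 9 * X ^ 2 := by
    have h1 : 8 * n * q / p ≤ 8 * n * q := Nat.div_le_self _ _
    have h2 : n * q ≤ X * X := Nat.mul_le_mul (by omega) (by omega)
    nlinarith
  obtain ⟨t, s, hrun, -, ht, τ, hτ, hsteps, hpar, hcost⟩ := algorithm_spec (b := X ^ 6)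
    (c := c) (w := w) hT.isAcyclic hp hq hN (by omega) (by omega)
    (by
      have h1 : ∑ v, c v ≤ X := by omega
      have := Nat.mul_le_mul h1 hNX
      nlinarith)
    (by
      have h1 : ∑ v, c v ≤ X := by omega
      have h2 : n ≤ X := by omega
      have := Nat.mul_le_mul h2 h1
      nlinarith)
    (input_bdd (X ^ 6) (by nlinarith) (by omega))
  obtain ⟨D, hroot, hedge, hDpay⟩ := exists_decisionTree hτ hsteps
    (isComponent_univ hT.connected) (a := 0) fun _ _ => rfl
  have hDcost : D.cost c w = ∑ x, w x * τ.pay x := by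
    rw [DecisionTree.cost]
    refine Finset.sum_congr rfl fun x _ => ?_
    rw [hDpay x trivial]
    simp
  have hp' : (0 : ℝ) < p := by exact_mod_cast hp
  have hq' : (0 : ℝ) < q := by exact_mod_cast hq
  have hn' : (1 : ℝ) ≤ n := by exact_mod_cast hn
  refine ⟨t, s, D, ?_, ?_, ⟨(hpar _).trans hroot, fun u v h => (hpar v).trans (hedge u v h)⟩, ?_⟩
  · rw [wordBound, ← hX]
    rwa [← pow_mul] at hrun
  · have h1 : (N : ℝ) ≤ 16 * n / ε + 1 := by
      have h2 : ((8 * n * q / p : ℕ) : ℝ) ≤ 8 * n * q / p := by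
        have := Nat.cast_div_le (α := ℝ) (m := 8 * n * q) (n := p)
        push_cast at this
        exact this
      have h3 : (q : ℝ) / p ≤ 2 / ε := by
        rw [div_le_div_iff₀ hp' hε]
        rw [← mul_div_assoc, le_div_iff₀ hq'] at hεpq
        linarith
      have h4 : (8 * n * q / p : ℝ) = 8 * n * (q / p) := by ring
      have h5 : 8 * (n : ℝ) * (q / p) ≤ 8 * n * (2 / ε) := by gcongr
      have h6 : 8 * (n : ℝ) * (2 / ε) = 16 * n / ε := by ring
      rw [hN]
      push_cast
      linarith
    -- The time obtained is linear in `1 / ε`; this passes to the stated bound.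
    have h2 : 1 / ε ≤ 1 + 1 / ε ^ 2 := by
      have := sq_nonneg (1 / ε - 1)
      have h3 : (1 / ε) ^ 2 = 1 / ε ^ 2 := by rw [div_pow, one_pow]
      have h4 : 0 < 1 / ε := by positivity
      nlinarith
    have h3 : (t : ℝ) ≤ n * (810 * n ^ 3 + 600 * n ^ 2 * (N + 1)) + 20 := by exact_mod_cast ht
    have h4 : (n : ℝ) * (600 * n ^ 2 * (N + 1)) ≤ n * (600 * n ^ 2 * (16 * n / ε + 1 + 1)) := by
      gcongr
    have h5 : (n : ℝ) * (600 * n ^ 2 * (16 * n / ε + 1 + 1))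
        = 9600 * n ^ 4 * (1 / ε) + 1200 * n ^ 3 := by ring
    have h6 : (n : ℝ) ^ 3 ≤ n ^ 4 := pow_le_pow_right₀ hn' (by norm_num)
    have h7 : (1 : ℝ) ≤ n ^ 4 := one_le_pow₀ hn'
    have h8 : 9600 * (n : ℝ) ^ 4 * (1 / ε) ≤ 9600 * n ^ 4 * (1 + 1 / ε ^ 2) := by gcongr
    have h9 : (n : ℝ) ^ 4 * 1 ≤ n ^ 4 * (1 + 1 / ε ^ 2) := by
      gcongr
      have : 0 < 1 / ε ^ 2 := by positivity
      linarith
    nlinarith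
  -- The infimum is attained, the range being nonempty because of `D`.
  · obtain ⟨D', hD'⟩ : opt T c w ∈ Set.range fun D : DecisionTree T Set.univ => D.cost c w :=
      Nat.sInf_mem ⟨_, D, rfl⟩
    have h1 := hcost D'
    rw [← hDcost] at h1
    have h2 : D'.cost c w = opt T c w := hD'
    rw [h2] at h1
    have h3 : (4 : ℝ) * q * D.cost c w ≤ 4 * (4 * q + p) * opt T c w := by exact_mod_cast h1
    have h4 : (D.cost c w : ℝ) ≤ (4 + p / q) * opt T c w := by
      rw [← sub_nonneg] at h3 ⊢
      have h5 : (4 + p / q : ℝ) * opt T c w - D.cost c w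
          = (4 * (4 * q + p) * opt T c w - 4 * q * D.cost c w) / (4 * q) := by
        field_simp
      rw [h5]
      positivity
    refine h4.trans ?_
    gcongr
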